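/- Let $\mathbf K$ be a field of characteristic $0$, and let $L$ be a conilpotent dg Lie coalgebra over $\mathbf K$: a $\mathbb Z$-graded chain complex with an antisymmetric cobracket $\delta\colon L\to L\otimes L$ that satisfies the co-Jacobi identity (all signs by the Koszul rule, $\tau$ denoting the signed interchange of tensor factors) and such that every $x\in L$ is annihilated by some iterate $(1\otimes\cdots\otimes 1\otimes\delta)\cdots(1\otimes\delta)\delta$. Regard every (not necessarily counital) coassociative dg coalgebra $C$ as a dg Lie coalgebra with cobracket $\Delta-\tau\Delta$. Then $L$ has a universal enveloping conilpotent coalgebra, i.e. a conilpotent coassociative dg coalgebra $U^c(L)$ with a morphism of dg Lie coalgebras $p\colon U^c(L)\to L$ such that every morphism of dg Lie coalgebras $C\to L$ from a conilpotent coassociative dg coalgebra $C$ factors as $p\circ g$ for a unique morphism of dg coalgebras $g\colon C\to U^c(L)$. For any such $(U^c(L),p)$ there is an isomorphism of dg $L$-comodules $$U^c(L)\;\cong\;\mathrm{Sym}^c(L).$$ Here $L$ coacts on $U^c(L)$ by $(p\otimes 1)(\Delta-\tau\Delta)$; and $\mathrm{Sym}^c(L)=\bigoplus_{n\ge 1}(L^{\otimes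 n})_{S_n}$, with $L$ coacting by extending $\delta$ as a derivation, $x_1\cdots x_n\mapsto\sum_i\pm\, x_i'\otimes x_1\cdots x_i''\cdots x_n$ for $\delta(x_i)=\sum x_i'\otimes x_i''$ (Koszul sign of moving $x_i'$ to the front). -/

import Mathlib

universe u v w

noncomputable section

open scoped TensorProduct DirectSum

namespace DGCo

/-- The Koszul sign `(-1)^n` as an element of the ground field. -/
def sg (K : Type u) [Field K] (n : ℤ) : K := ((n.negOnePow : ℤ) : K)

section Basic

variable {K : Type u} [Field K]

lemma sg_even {n : ℤ} (h : Even n) : sg K n = 1 := by simp [sg, Int.negOnePow_even n h]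

lemma sg_odd {n : ℤ} (h : Odd n) : sg K n = -1 := by simp [sg, Int.negOnePow_odd n h]

lemma sg_add (m n : ℤ) : sg K (m + n) = sg K m * sg K n := by
  simp [sg, Int.negOnePow_add]

lemma sg_sq (n : ℤ) : sg K n * sg K n = 1 := by
  rcases Int.even_or_odd n with h | h
  · simp [sg_even h]
  · simp [sg_odd h]

lemma sg_sub_one (n : ℤ) : sg K (n - 1) = -sg K n := by
  have := sg_add (K := K) (n - 1) 1
  rw [sub_add_cancel, sg_odd (n := 1) odd_one] at this
  rw [this]; ring

lemma isInternal_of_proj {V : Type v} [AddCommGroup V] [Module K V] (gr : ℤ → Submodule K V)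
    (htop : ⨆ i, gr i = ⊤) (π : ℤ → V →ₗ[K] V)
    (h1 : ∀ n, ∀ x ∈ gr n, π n x = x) (h2 : ∀ m n, m ≠ n → ∀ x ∈ gr m, π n x = 0) :
    DirectSum.IsInternal gr := by
  classical
  have key : ∀ n, (π n) ∘ₗ DirectSum.coeLinearMap gr =
      (gr n).subtype ∘ₗ DirectSum.component K ℤ (fun i => gr i) n := by
    intro n
    ext i x
    by_cases h : i = n
    · subst h
      simp [h1 i x x.2]
    · simp [h2 i n h x x.2, DirectSum.component.of, h]
  constructor
  · intro a b hab
    refine DirectSum.ext_component K fun n => ?_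
    have e1 := LinearMap.congr_fun (key n) a
    have e2 := LinearMap.congr_fun (key n) b
    apply Subtype.ext
    simp only [LinearMap.comp_apply] at e1 e2
    have hab' : DirectSum.coeLinearMap gr a = DirectSum.coeLinearMap gr b := hab
    rw [hab'] at e1
    exact e1.symm.trans e2
  · have : LinearMap.range (DirectSum.coeLinearMap gr) = ⊤ := by
      rw [← htop, Submodule.iSup_eq_range_dfinsupp_lsum]; rfl
    exact LinearMap.range_eq_top.mp this

end Basic

/-- The structure of a chain complex (a dg vector space) on a `K`-vector space `V`: a decomposition
`V = ⨁ᵢ Vᵢ` over `i : ℤ`, and a differential of degree `-1` and square zero. -/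
structure DGSpace (K : Type u) [Field K] (V : Type v) [AddCommGroup V] [Module K V] where
  gr : ℤ → Submodule K V
  internal : DirectSum.IsInternal gr
  d : V →ₗ[K] V
  d_mem : ∀ (i : ℤ) (x : V), x ∈ gr i → d x ∈ gr (i - 1)
  d_d : ∀ x : V, d (d x) = 0

namespace DGSpace

variable {K : Type u} [Field K]
variable {V : Type v} [AddCommGroup V] [Module K V] {W : Type w} [AddCommGroup W] [Module K W]
variable {V' : Type*} [AddCommGroup V'] [Module K V'] {W' : Type*} [AddCommGroup W'] [Module K W']
variable {N : Type*} [AddCommGroup N] [Module K N]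
variable (X : DGSpace K V) (Y : DGSpace K W) (X' : DGSpace K V') (Y' : DGSpace K W')

/-- The decomposition of `V` as a linear equivalence. -/
def total : (⨁ i, X.gr i) ≃ₗ[K] V := LinearEquiv.ofBijective (DirectSum.coeLinearMap X.gr) X.internal

/-- The linear map on `V` which is `f i` on the homogeneous elements of degree `i`. -/
def homLift (f : ℤ → V →ₗ[K] N) : V →ₗ[K] N :=
  DirectSum.toModule K ℤ N (fun i => f i ∘ₗ (X.gr i).subtype) ∘ₗ X.total.symm.toLinearMap

lemma homLift_apply (f : ℤ → V →ₗ[K] N) {i : ℤ} {x : V} (hx : x ∈ X.gr i) :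
    X.homLift f x = f i x := by
  have : X.total.symm x = DirectSum.lof K ℤ (fun i => X.gr i) i ⟨x, hx⟩ := by
    rw [LinearEquiv.symm_apply_eq]
    exact (DirectSum.coeLinearMap_lof X.gr i ⟨x, hx⟩).symm
  simp [homLift, this]

lemma iSup_gr : ⨆ i, X.gr i = ⊤ := X.internal.submodule_iSup_eq_top

/-- Linear maps that agree on homogeneous elements are equal. -/
lemma hom_ext {f g : V →ₗ[K] N} (h : ∀ i, ∀ x ∈ X.gr i, f x = g x) : f = g := by
  ext x
  have hx : x ∈ ⨆ i, X.gr i := by rw [X.iSup_gr]; trivial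
  induction hx using Submodule.iSup_induction' with
  | mem i x hx => exact h i x hx
  | zero => simp
  | add x y _ _ hx hy => simp [hx, hy]

/-- The projection to the degree `n` component. -/
def proj (n : ℤ) : V →ₗ[K] V := X.homLift fun i => if i = n then LinearMap.id else 0

lemma proj_same {n : ℤ} {x : V} (hx : x ∈ X.gr n) : X.proj n x = x := by
  simp [proj, X.homLift_apply _ hx]

lemma proj_ne {m n : ℤ} (h : m ≠ n) {x : V} (hx : x ∈ X.gr m) : X.proj n x = 0 := by
  simp [proj, X.homLift_apply _ hx, h]

/-- The linear map `x ↦ (-1)^(k|x|) x`. -/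
def sgn (k : ℤ) : V →ₗ[K] V := X.homLift fun i => sg K (k * i) • LinearMap.id

lemma sgn_apply (k : ℤ) {i : ℤ} {x : V} (hx : x ∈ X.gr i) : X.sgn k x = sg K (k * i) • x := by
  simp [sgn, X.homLift_apply _ hx]

/-- The symmetry of the tensor product of graded vector spaces, `x ⊗ y ↦ (-1)^(|x||y|) y ⊗ x`. -/
def swap : V ⊗[K] W →ₗ[K] W ⊗[K] V :=
  TensorProduct.lift (X.homLift fun i =>
    (LinearMap.llcomp K W W (W ⊗[K] V)).flip (Y.sgn i) ∘ₗ (TensorProduct.mk K W V).flip)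

lemma swap_tmul {i j : ℤ} {x : V} {y : W} (hx : x ∈ X.gr i) (hy : y ∈ Y.gr j) :
    X.swap Y (x ⊗ₜ y) = sg K (i * j) • (y ⊗ₜ x) := by
  simp [swap, X.homLift_apply _ hx, Y.sgn_apply _ hy, TensorProduct.smul_tmul']

/-- The degree `n` part of `V ⊗ W`, spanned by the `x ⊗ y` with `|x| + |y| = n`. -/
def tensorGr (n : ℤ) : Submodule K (V ⊗[K] W) :=
  Submodule.span K {t | ∃ i j : ℤ, i + j = n ∧ ∃ x ∈ X.gr i, ∃ y ∈ Y.gr j, x ⊗ₜ[K] y = t}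

variable {X Y} in
lemma tmul_mem {i j : ℤ} {x : V} {y : W} (hx : x ∈ X.gr i) (hy : y ∈ Y.gr j) :
    x ⊗ₜ[K] y ∈ X.tensorGr Y (i + j) :=
  Submodule.subset_span ⟨i, j, rfl, x, hx, y, hy, rfl⟩

variable {X Y} in
lemma tmul_mem' {i j n : ℤ} (h : i + j = n) {x : V} {y : W} (hx : x ∈ X.gr i) (hy : y ∈ Y.gr j) :
    x ⊗ₜ[K] y ∈ X.tensorGr Y n := h ▸ tmul_mem hx hy

/-- Linear maps on `V ⊗ W` that agree on tensors of homogeneous elements are equal. -/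
lemma tensor_ext {f g : V ⊗[K] W →ₗ[K] N}
    (h : ∀ i j, ∀ x ∈ X.gr i, ∀ y ∈ Y.gr j, f (x ⊗ₜ y) = g (x ⊗ₜ y)) : f = g := by
  apply TensorProduct.ext
  refine X.hom_ext fun i x hx => Y.hom_ext fun j y hy => ?_
  exact h i j x hx y hy

/-- The differential `x ⊗ y ↦ dx ⊗ y + (-1)^|x| x ⊗ dy` of a tensor product. -/
def tensorD : V ⊗[K] W →ₗ[K] V ⊗[K] W :=
  TensorProduct.map X.d LinearMap.id + TensorProduct.map (X.sgn 1) Y.d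

lemma tensorD_tmul {i : ℤ} {x : V} (hx : x ∈ X.gr i) (y : W) :
    X.tensorD Y (x ⊗ₜ y) = X.d x ⊗ₜ y + sg K i • (x ⊗ₜ Y.d y) := by
  simp [tensorD, X.sgn_apply _ hx, TensorProduct.smul_tmul']

lemma iSup_tensorGr : ⨆ n, X.tensorGr Y n = ⊤ := by
  have h : (⨆ n, X.tensorGr Y n).mkQ = 0 := by
    refine X.tensor_ext Y fun i j x hx y hy => ?_
    simp only [LinearMap.zero_apply, Submodule.mkQ_apply, Submodule.Quotient.mk_eq_zero]
    exact Submodule.mem_iSup_of_mem _ (tmul_mem hx hy)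
  rw [← Submodule.ker_mkQ (⨆ n, X.tensorGr Y n), h, LinearMap.ker_zero]

lemma tensorGr_internal : DirectSum.IsInternal (X.tensorGr Y) := by
  let π : ℤ → V ⊗[K] W →ₗ[K] V ⊗[K] W := fun n =>
    TensorProduct.lift (X.homLift fun i =>
      (LinearMap.llcomp K W W (V ⊗[K] W)).flip (Y.proj (n - i)) ∘ₗ (TensorProduct.mk K V W))
  refine isInternal_of_proj _ (X.iSup_tensorGr Y) π ?_ ?_
  · intro n t ht
    induction ht using Submodule.span_induction with
    | mem t ht =>
      obtain ⟨i, j, rfl, x, hx, y, hy, rfl⟩ := ht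
      simp [π, X.homLift_apply _ hx, Y.proj_same hy]
    | zero => simp
    | add a b _ _ ha hb => rw [map_add, ha, hb]
    | smul c a _ ha => rw [map_smul, ha]
  · intro m n hmn t ht
    induction ht using Submodule.span_induction with
    | mem t ht =>
      obtain ⟨i, j, rfl, x, hx, y, hy, rfl⟩ := ht
      have : j ≠ n - i := by omega
      simp [π, X.homLift_apply _ hx, Y.proj_ne this hy]
    | zero => simp
    | add a b _ _ ha hb => rw [map_add, ha, hb, add_zero]
    | smul c a _ ha => rw [map_smul, ha, smul_zero]

/-- The tensor product of two dg vector spaces. -/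
def tensor : DGSpace K (V ⊗[K] W) where
  gr := X.tensorGr Y
  internal := X.tensorGr_internal Y
  d := X.tensorD Y
  d_mem := by
    intro n t ht
    induction ht using Submodule.span_induction with
    | mem t ht =>
      obtain ⟨i, j, rfl, x, hx, y, hy, rfl⟩ := ht
      rw [X.tensorD_tmul Y hx]
      exact add_mem (tmul_mem' (by omega) (X.d_mem i x hx) hy)
        (Submodule.smul_mem _ _ (tmul_mem' (by omega) hx (Y.d_mem j y hy)))
    | zero => simp
    | add a b _ _ ha hb => rw [map_add]; exact add_mem ha hb
    | smul c a _ ha => rw [map_smul]; exact Submodule.smul_mem _ _ ha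
  d_d := by
    have : X.tensorD Y ∘ₗ X.tensorD Y = 0 := by
      refine X.tensor_ext Y fun i j x hx y hy => ?_
      simp [X.tensorD_tmul Y hx, X.tensorD_tmul Y (X.d_mem i x hx), X.d_d, Y.d_d, sg_sub_one]
    exact fun x => LinearMap.congr_fun this x

/-- Morphisms of dg vector spaces: linear maps of degree `0` that commute with the differentials. -/
structure IsHom (f : V →ₗ[K] W) : Prop where
  map_mem : ∀ (i : ℤ) (x : V), x ∈ X.gr i → f x ∈ Y.gr i
  map_d : ∀ x : V, f (X.d x) = Y.d (f x)

section Maps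

variable {X Y X' Y'}

lemma IsHom.comp {f : V →ₗ[K] W} {g : W →ₗ[K] V'} (hg : Y.IsHom X' g) (hf : X.IsHom Y f) :
    X.IsHom X' (g ∘ₗ f) :=
  ⟨fun i x hx => hg.map_mem i _ (hf.map_mem i x hx), fun x => by simp [hf.map_d, hg.map_d]⟩

lemma IsHom.id : X.IsHom X LinearMap.id := ⟨fun _ _ h => h, fun _ => rfl⟩

lemma IsHom.sub {f g : V →ₗ[K] W} (hf : X.IsHom Y f) (hg : X.IsHom Y g) : X.IsHom Y (f - g) :=
  ⟨fun i x hx => sub_mem (hf.map_mem i _ hx) (hg.map_mem i x hx),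
    fun x => by simp [hf.map_d, hg.map_d]⟩

/-- A map out of a tensor product is a morphism if it is one on tensors of homogeneous elements. -/
lemma isHom_of_tmul {f : V ⊗[K] W →ₗ[K] V'}
    (h1 : ∀ i j, ∀ x ∈ X.gr i, ∀ y ∈ Y.gr j, f (x ⊗ₜ y) ∈ X'.gr (i + j))
    (h2 : ∀ i j, ∀ x ∈ X.gr i, ∀ y ∈ Y.gr j,
      f (X.d x ⊗ₜ y) + sg K i • f (x ⊗ₜ Y.d y) = X'.d (f (x ⊗ₜ y))) :
    (X.tensor Y).IsHom X' f := by
  constructor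
  · intro n t ht
    induction ht using Submodule.span_induction with
    | mem t ht =>
      obtain ⟨i, j, rfl, x, hx, y, hy, rfl⟩ := ht
      exact h1 i j x hx y hy
    | zero => simp
    | add a b _ _ ha hb => rw [map_add]; exact add_mem ha hb
    | smul c a _ ha => rw [map_smul]; exact Submodule.smul_mem _ _ ha
  · have : f ∘ₗ X.tensorD Y = X'.d ∘ₗ f := by
      refine X.tensor_ext Y fun i j x hx y hy => ?_
      simp [X.tensorD_tmul Y hx, ← h2 i j x hx y hy]
    exact fun x => LinearMap.congr_fun this x

lemma IsHom.tensor {f : V →ₗ[K] V'} {g : W →ₗ[K] W'} (hf : X.IsHom X' f) (hg : Y.IsHom Y' g) :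
    (X.tensor Y).IsHom (X'.tensor Y') (TensorProduct.map f g) := by
  refine isHom_of_tmul (fun i j x hx y hy => ?_) (fun i j x hx y hy => ?_)
  · exact tmul_mem (hf.map_mem i x hx) (hg.map_mem j y hy)
  · simp only [TensorProduct.map_tmul]
    refine Eq.trans ?_ (X'.tensorD_tmul Y' (hf.map_mem i x hx) (g y)).symm
    simp [hf.map_d, hg.map_d]

variable (X Y) in
lemma swap_isHom : (X.tensor Y).IsHom (Y.tensor X) (X.swap Y) := by
  refine isHom_of_tmul (fun i j x hx y hy => ?_) (fun i j x hx y hy => ?_)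
  · rw [X.swap_tmul Y hx hy]
    exact Submodule.smul_mem _ _ (tmul_mem' (by omega) hy hx)
  · rw [X.swap_tmul Y hx hy, X.swap_tmul Y (X.d_mem i x hx) hy,
      X.swap_tmul Y hx (Y.d_mem j y hy), map_smul]
    have := Y.tensorD_tmul X hy x
    change _ = _ • Y.tensorD X _
    rw [this]
    have e1 : sg K ((i - 1) * j) = sg K (i * j) * sg K j := by
      rw [← sg_add]
      rcases Int.even_or_odd j with h | h
      · rw [sg_even (h.mul_left _), sg_even ((h.mul_left _).add h)]
      · rw [show i * j + j = (i - 1) * j + 2 * j by ring, sg_add, sg_even (n := 2 * j) (by simp),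
          mul_one]
    have e2 : sg K i * sg K (i * (j - 1)) = sg K (i * j) := by
      rw [← sg_add]; congr 1; ring
    rw [smul_smul, e1, e2, smul_add, smul_smul, add_comm]

lemma swap_natural {f : V →ₗ[K] V'} {g : W →ₗ[K] W'} (hf : X.IsHom X' f) (hg : Y.IsHom Y' g)
    (t : V ⊗[K] W) :
    X'.swap Y' (TensorProduct.map f g t) = TensorProduct.map g f (X.swap Y t) := by
  have : X'.swap Y' ∘ₗ TensorProduct.map f g = TensorProduct.map g f ∘ₗ X.swap Y := by
    refine X.tensor_ext Y fun i j x hx y hy => ?_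
    simp [X.swap_tmul Y hx hy, X'.swap_tmul Y' (hf.map_mem _ _ hx) (hg.map_mem _ _ hy)]
  exact LinearMap.congr_fun this t

variable (X Y) in
lemma swap_swap (t : V ⊗[K] W) : Y.swap X (X.swap Y t) = t := by
  have : Y.swap X ∘ₗ X.swap Y = LinearMap.id := by
    refine X.tensor_ext Y fun i j x hx y hy => ?_
    simp [X.swap_tmul Y hx hy, Y.swap_tmul X hy hx, smul_smul, mul_comm j i, sg_sq]
  exact LinearMap.congr_fun this t

end Maps

/-- The symmetry of the first two factors of `V ⊗ (W ⊗ N)`. -/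
def swapLeft (N : Type*) [AddCommGroup N] [Module K N] :
    V ⊗[K] (W ⊗[K] N) →ₗ[K] W ⊗[K] (V ⊗[K] N) :=
  (TensorProduct.assoc K W V N).toLinearMap ∘ₗ (X.swap Y).rTensor N ∘ₗ
    (TensorProduct.assoc K V W N).symm.toLinearMap

lemma swapLeft_tmul {i j : ℤ} {x : V} {y : W} (hx : x ∈ X.gr i) (hy : y ∈ Y.gr j) (n : N) :
    X.swapLeft Y N (x ⊗ₜ (y ⊗ₜ n)) = sg K (i * j) • (y ⊗ₜ (x ⊗ₜ n)) := by
  simp [swapLeft, X.swap_tmul Y hx hy, TensorProduct.smul_tmul']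


lemma swapLeft_swapLeft (t : V ⊗[K] (W ⊗[K] N)) : Y.swapLeft X N (X.swapLeft Y N t) = t := by
  simp only [swapLeft, LinearMap.comp_apply, LinearEquiv.coe_coe, LinearEquiv.symm_apply_apply]
  have : (Y.swap X).rTensor N ∘ₗ (X.swap Y).rTensor N = LinearMap.id := by
    rw [← LinearMap.rTensor_comp]
    have : Y.swap X ∘ₗ X.swap Y = LinearMap.id := LinearMap.ext (X.swap_swap Y)
    rw [this, LinearMap.rTensor_id]
  have h := LinearMap.congr_fun this ((TensorProduct.assoc K V W N).symm t)
  simp only [LinearMap.comp_apply, LinearMap.id_apply] at h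
  rw [h, LinearEquiv.apply_symm_apply]

end DGSpace

open DGSpace

/-- The filtration of `C` by the subspaces on which the iterates of a map `μ : C → C ⊗ C` vanish:
`F₀ = 0`, and `Fₙ₊₁` consists of the `x` with `μ x ∈ C ⊗ Fₙ`; that is, `Fₙ` is the kernel of the
`n`-fold iterate `(1 ⊗ ⋯ ⊗ 1 ⊗ μ) ∘ ⋯ ∘ (1 ⊗ μ) ∘ μ : C → C^{⊗ (n + 1)}`. -/
def coradical {K : Type u} [Field K] {C : Type v} [AddCommGroup C] [Module K C]
    (μ : C →ₗ[K] C ⊗[K] C) : ℕ → Submodule K C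
  | 0 => ⊥
  | n + 1 => (LinearMap.range ((coradical μ n).subtype.lTensor C)).comap μ

/-- Conilpotency: the coradical filtration is exhaustive. -/
def Conilpotent {K : Type u} [Field K] {C : Type v} [AddCommGroup C] [Module K C]
    (μ : C →ₗ[K] C ⊗[K] C) : Prop :=
  ∀ x : C, ∃ n : ℕ, x ∈ coradical μ n

/-- A (not necessarily counital) coassociative dg coalgebra. -/
structure DGCoalgebra (K : Type u) [Field K] (C : Type v) [AddCommGroup C] [Module K C]
    extends DGSpace K C where
  comul : C →ₗ[K] C ⊗[K] C
  comul_isHom : toDGSpace.IsHom (toDGSpace.tensor toDGSpace) comul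
  coassoc : ∀ x : C,
    TensorProduct.assoc K C C C (comul.rTensor C (comul x)) = comul.lTensor C (comul x)

/-- A dg Lie coalgebra: the cobracket `δ` is antisymmetric (for the Koszul sign rule) and satisfies
the co-Jacobi identity `(δ ⊗ 1) δ = (1 ⊗ δ) δ - (τ ⊗ 1) (1 ⊗ δ) δ`, which is dual to
`[[x, y], z] = [x, [y, z]] - (-1)^(|x||y|) [y, [x, z]]`. -/
structure DGLieCoalgebra (K : Type u) [Field K] (L : Type v) [AddCommGroup L] [Module K L]
    extends DGSpace K L where
  cobr : L →ₗ[K] L ⊗[K] L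
  cobr_isHom : toDGSpace.IsHom (toDGSpace.tensor toDGSpace) cobr
  antisymm : ∀ x : L, toDGSpace.swap toDGSpace (cobr x) = -cobr x
  coJacobi : ∀ x : L,
    TensorProduct.assoc K L L L (cobr.rTensor L (cobr x)) =
      cobr.lTensor L (cobr x) - toDGSpace.swapLeft toDGSpace L (cobr.lTensor L (cobr x))

/-- A dg comodule `M` over a dg Lie coalgebra `L`, with coaction `ρ : M → L ⊗ M` satisfying
`(δ ⊗ 1) ρ = (1 ⊗ ρ) ρ - (τ ⊗ 1) (1 ⊗ ρ) ρ`, which is dual to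
`[x, y] m = x (y m) - (-1)^(|x||y|) y (x m)`. -/
structure DGLieComodule {K : Type u} [Field K] {V : Type v} [AddCommGroup V] [Module K V]
    (L : DGLieCoalgebra K V) (M : Type w) [AddCommGroup M] [Module K M]
    extends DGSpace K M where
  coact : M →ₗ[K] V ⊗[K] M
  coact_isHom : toDGSpace.IsHom (L.toDGSpace.tensor toDGSpace) coact
  coact_cobr : ∀ m : M,
    TensorProduct.assoc K V V M (L.cobr.rTensor M (coact m)) =
      coact.lTensor V (coact m) - L.toDGSpace.swapLeft L.toDGSpace M (coact.lTensor V (coact m))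

section Coalgebras

variable {K : Type u} [Field K] {C : Type v} [AddCommGroup C] [Module K C]
variable {D : Type w} [AddCommGroup D] [Module K D]

/-- Morphisms of dg coalgebras. -/
structure DGCoalgebra.IsHom (A : DGCoalgebra K C) (B : DGCoalgebra K D) (f : C →ₗ[K] D) : Prop
    extends A.toDGSpace.IsHom B.toDGSpace f where
  map_comul : ∀ x : C, B.comul (f x) = TensorProduct.map f f (A.comul x)

/-- Morphisms of dg Lie coalgebras. -/
structure DGLieCoalgebra.IsHom (A : DGLieCoalgebra K C) (B : DGLieCoalgebra K D)
    (f : C →ₗ[K] D) : Prop extends A.toDGSpace.IsHom B.toDGSpace f where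
  map_cobr : ∀ x : C, B.cobr (f x) = TensorProduct.map f f (A.cobr x)

namespace DGSpace

variable (X : DGSpace K C)

lemma cyc_tmul {i j : ℤ} {x : C} (hx : x ∈ X.gr i) {u : C ⊗[K] C} (hu : u ∈ X.tensorGr X j) :
    (X.swap X).lTensor C (X.swapLeft X C (x ⊗ₜ u)) =
      sg K (i * j) • TensorProduct.assoc K C C C (u ⊗ₜ x) := by
  induction hu using Submodule.span_induction with
  | mem u hu =>
    obtain ⟨a, b, rfl, y, hy, z, hz, rfl⟩ := hu
    rw [X.swapLeft_tmul X hx hy, map_smul, LinearMap.lTensor_tmul, X.swap_tmul X hx hz,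
      TensorProduct.tmul_smul, smul_smul, ← sg_add, TensorProduct.assoc_tmul, mul_add]
  | zero => simp
  | add a b _ _ ha hb => simp only [TensorProduct.tmul_add, TensorProduct.add_tmul, map_add,
      ha, hb, smul_add]
  | smul c a _ ha => simp only [TensorProduct.tmul_smul, ← TensorProduct.smul_tmul', map_smul,
      ha, smul_comm c]

lemma cyc_tmul' {i j : ℤ} {x : C} (hx : x ∈ X.gr i) {u : C ⊗[K] C} (hu : u ∈ X.tensorGr X j) :
    X.swapLeft X C ((X.swap X).lTensor C (TensorProduct.assoc K C C C (u ⊗ₜ x))) =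
      sg K (j * i) • (x ⊗ₜ u) := by
  induction hu using Submodule.span_induction with
  | mem u hu =>
    obtain ⟨a, b, rfl, y, hy, z, hz, rfl⟩ := hu
    rw [TensorProduct.assoc_tmul, LinearMap.lTensor_tmul, X.swap_tmul X hz hx,
      TensorProduct.tmul_smul, map_smul, X.swapLeft_tmul X hy hx, smul_smul, ← sg_add, add_mul,
      add_comm (b * i)]
  | zero => simp
  | add a b _ _ ha hb => simp only [TensorProduct.tmul_add, TensorProduct.add_tmul, map_add,
      ha, hb, smul_add]
  | smul c a _ ha => simp only [TensorProduct.tmul_smul, ← TensorProduct.smul_tmul', map_smul,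
      ha, smul_comm c]

lemma braid (t : C ⊗[K] (C ⊗[K] C)) :
    X.swapLeft X C ((X.swap X).lTensor C (X.swapLeft X C t)) =
      (X.swap X).lTensor C (X.swapLeft X C ((X.swap X).lTensor C t)) := by
  have : X.swapLeft X C ∘ₗ (X.swap X).lTensor C ∘ₗ X.swapLeft X C =
      (X.swap X).lTensor C ∘ₗ X.swapLeft X C ∘ₗ (X.swap X).lTensor C := by
    refine X.tensor_ext (X.tensor X) fun i n x hx u hu => ?_
    simp only [LinearMap.comp_apply]
    induction hu using Submodule.span_induction with
    | mem u hu =>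
      obtain ⟨a, b, rfl, y, hy, z, hz, rfl⟩ := hu
      simp only [X.swapLeft_tmul X hx hy, X.swapLeft_tmul X hx hz, X.swapLeft_tmul X hy hz,
        X.swap_tmul X hx hy, X.swap_tmul X hx hz, X.swap_tmul X hy hz,
        map_smul, LinearMap.lTensor_tmul, TensorProduct.tmul_smul, smul_smul]
      congr 1; ring
    | zero => simp
    | add a b _ _ ha hb => simp only [TensorProduct.tmul_add, map_add, ha, hb]
    | smul c a _ ha => simp only [TensorProduct.tmul_smul, map_smul, ha]
  exact LinearMap.congr_fun this t

end DGSpace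

namespace DGCoalgebra

variable (A : DGCoalgebra K C)

lemma rTensor_swap (t : C ⊗[K] C) :
    TensorProduct.assoc K C C C (A.comul.rTensor C (A.swap A.toDGSpace t)) =
      (A.swap A.toDGSpace).lTensor C (A.swapLeft A.toDGSpace C (A.comul.lTensor C t)) := by
  have : (TensorProduct.assoc K C C C).toLinearMap ∘ₗ A.comul.rTensor C ∘ₗ A.swap A.toDGSpace =
      (A.swap A.toDGSpace).lTensor C ∘ₗ A.swapLeft A.toDGSpace C ∘ₗ A.comul.lTensor C := by
    refine A.tensor_ext A.toDGSpace fun i j x hx y hy => ?_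
    simp only [LinearMap.comp_apply, LinearMap.lTensor_tmul, LinearEquiv.coe_coe]
    rw [A.cyc_tmul hx (A.comul_isHom.map_mem j y hy), A.swap_tmul A.toDGSpace hx hy]
    simp
  exact LinearMap.congr_fun this t

lemma lTensor_swap (t : C ⊗[K] C) :
    A.comul.lTensor C (A.swap A.toDGSpace t) =
      A.swapLeft A.toDGSpace C ((A.swap A.toDGSpace).lTensor C
        (TensorProduct.assoc K C C C (A.comul.rTensor C t))) := by
  have : A.comul.lTensor C ∘ₗ A.swap A.toDGSpace =
      A.swapLeft A.toDGSpace C ∘ₗ (A.swap A.toDGSpace).lTensor C ∘ₗ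
        (TensorProduct.assoc K C C C).toLinearMap ∘ₗ A.comul.rTensor C := by
    refine A.tensor_ext A.toDGSpace fun i j x hx y hy => ?_
    simp only [LinearMap.comp_apply, LinearMap.rTensor_tmul, LinearEquiv.coe_coe]
    rw [A.cyc_tmul' hy (A.comul_isHom.map_mem i x hx), A.swap_tmul A.toDGSpace hx hy]
    simp
  exact LinearMap.congr_fun this t

lemma assoc_rTensor_swap (t : (C ⊗[K] C) ⊗[K] C) :
    TensorProduct.assoc K C C C ((A.swap A.toDGSpace).rTensor C t) =
      A.swapLeft A.toDGSpace C (TensorProduct.assoc K C C C t) := by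
  simp [DGSpace.swapLeft]

/-- The dg Lie coalgebra of a coassociative dg coalgebra, with the cocommutator
`δ = Δ - τ Δ` as cobracket. -/
def toLie : DGLieCoalgebra K C where
  toDGSpace := A.toDGSpace
  cobr := A.comul - A.swap A.toDGSpace ∘ₗ A.comul
  cobr_isHom := A.comul_isHom.sub ((A.swap_isHom A.toDGSpace).comp A.comul_isHom)
  antisymm := by
    intro x
    simp [A.swap_swap A.toDGSpace]
  coJacobi := by
    intro x
    set t := (A.swap A.toDGSpace).lTensor C with ht
    set s := A.swapLeft A.toDGSpace C with hs
    have e1 : ∀ y, (A.comul - A.swap A.toDGSpace ∘ₗ A.comul).lTensor C y =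
        A.comul.lTensor C y - t (A.comul.lTensor C y) := by
      intro y
      rw [LinearMap.lTensor_sub, LinearMap.lTensor_comp]; rfl
    have e2 : ∀ y, TensorProduct.assoc K C C C
        ((A.comul - A.swap A.toDGSpace ∘ₗ A.comul).rTensor C y) =
        TensorProduct.assoc K C C C (A.comul.rTensor C y) -
          s (TensorProduct.assoc K C C C (A.comul.rTensor C y)) := by
      intro y
      rw [LinearMap.rTensor_sub, LinearMap.rTensor_comp, LinearMap.sub_apply, map_sub,
        LinearMap.comp_apply, A.assoc_rTensor_swap]
    rw [e1, e2, LinearMap.sub_apply, LinearMap.comp_apply]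
    simp only [map_sub]
    rw [A.rTensor_swap, A.lTensor_swap, A.coassoc]
    simp only [← ht, ← hs]
    set θ := A.comul.lTensor C (A.comul x)
    have ss : ∀ y, s (s y) = y := fun y => A.swapLeft_swapLeft A.toDGSpace y
    have br : ∀ y, s (t (s y)) = t (s (t y)) := fun y => A.braid y
    have : s (t (s (t θ))) = t (s θ) := by rw [← br, ss]
    rw [this, ss, ← br]
    abel

end DGCoalgebra

/-- A dg Lie coalgebra is a comodule over itself through its cobracket. -/
def DGLieCoalgebra.adjoint (A : DGLieCoalgebra K C) : DGLieComodule A C where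
  toDGSpace := A.toDGSpace
  coact := A.cobr
  coact_isHom := A.cobr_isHom
  coact_cobr := A.coJacobi

/-- The comodule over `B` obtained from a comodule over `A` along a morphism `f : A → B`. -/
def DGLieComodule.push {M : Type*} [AddCommGroup M] [Module K M]
    {A : DGLieCoalgebra K C} (R : DGLieComodule A M) {B : DGLieCoalgebra K D} {f : C →ₗ[K] D}
    (hf : A.IsHom B f) : DGLieComodule B M where
  toDGSpace := R.toDGSpace
  coact := f.rTensor M ∘ₗ R.coact
  coact_isHom := (IsHom.tensor hf.toIsHom IsHom.id).comp R.coact_isHom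
  coact_cobr := by
    intro m
    have e1 : ∀ y, (f.rTensor M ∘ₗ R.coact).lTensor D (f.rTensor M y) =
        TensorProduct.map f (TensorProduct.map f LinearMap.id) (R.coact.lTensor C y) := by
      intro y
      induction y using TensorProduct.induction_on with
      | zero => simp
      | tmul a b => simp [LinearMap.rTensor]
      | add a b ha hb => simp only [map_add, ha, hb]
    have e2 : ∀ y : C ⊗[K] (C ⊗[K] M),
        B.swapLeft B.toDGSpace M (TensorProduct.map f (TensorProduct.map f LinearMap.id) y) =
        TensorProduct.map f (TensorProduct.map f LinearMap.id) (A.swapLeft A.toDGSpace M y) := by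
      intro y
      have : B.swapLeft B.toDGSpace M ∘ₗ TensorProduct.map f (TensorProduct.map f LinearMap.id) =
        TensorProduct.map f (TensorProduct.map f LinearMap.id) ∘ₗ
          A.swapLeft A.toDGSpace M := by
        refine A.tensor_ext (A.tensor R.toDGSpace) fun i n x hx u hu => ?_
        simp only [LinearMap.comp_apply]
        induction hu using Submodule.span_induction with
        | mem u hu =>
          obtain ⟨a, b, rfl, y, hy, z, hz, rfl⟩ := hu
          simp [A.swapLeft_tmul A.toDGSpace hx hy, B.swapLeft_tmul B.toDGSpace
            (hf.map_mem _ _ hx) (hf.map_mem _ _ hy)]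
        | zero => simp
        | add a b _ _ ha hb => simp only [TensorProduct.tmul_add, map_add, ha, hb]
        | smul c a _ ha => simp only [TensorProduct.tmul_smul, map_smul, ha]
      exact LinearMap.congr_fun this y
    have e3 : ∀ y : C ⊗[K] M,
        TensorProduct.assoc K D D M (B.cobr.rTensor M (f.rTensor M y)) =
        TensorProduct.map f (TensorProduct.map f LinearMap.id)
          (TensorProduct.assoc K C C M (A.cobr.rTensor M y)) := by
      intro y
      induction y using TensorProduct.induction_on with
      | zero => simp
      | tmul a b =>
        simp only [LinearMap.rTensor_tmul, hf.map_cobr]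
        generalize A.cobr a = u
        induction u using TensorProduct.induction_on with
        | zero => simp
        | tmul a b => simp
        | add a b ha hb => simp only [map_add, TensorProduct.add_tmul, ha, hb]
      | add a b ha hb => simp only [map_add, ha, hb]
    simp only [LinearMap.comp_apply]
    rw [e1, e2, e3, R.coact_cobr, map_sub]

end Coalgebras

section SymDefs

variable {K : Type u} [Field K] {V : Type v} [AddCommGroup V] [Module K V] (X : DGSpace K V)

/-- The relations `x y = (-1)^(|x||y|) y x` of graded commutativity in the tensor algebra. -/
inductive SymRel : TensorAlgebra K V → TensorAlgebra K V → Prop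
  | comm {i j : ℤ} {x y : V} (hx : x ∈ X.gr i) (hy : y ∈ X.gr j) :
      SymRel (TensorAlgebra.ι K x * TensorAlgebra.ι K y)
        (sg K (i * j) • (TensorAlgebra.ι K y * TensorAlgebra.ι K x))

/-- The graded symmetric algebra of `V`; as a vector space it is the sum over `n ≥ 0` of the
coinvariants of the symmetric groups `Sₙ` acting, with Koszul signs, on `V^{⊗ n}`. -/
def Sym : Type (max u v) := RingQuot (SymRel X)

instance : Ring (Sym X) := inferInstanceAs (Ring (RingQuot (SymRel X)))

instance : Algebra K (Sym X) := inferInstanceAs (Algebra K (RingQuot (SymRel X)))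

end SymDefs

namespace Sym

variable {K : Type u} [Field K] {V : Type v} [AddCommGroup V] [Module K V] (X : DGSpace K V)
variable {N : Type*} [AddCommGroup N] [Module K N]

/-- The quotient map from the tensor algebra. -/
def mk : TensorAlgebra K V →ₐ[K] Sym X := RingQuot.mkAlgHom K (SymRel X)

lemma mk_surjective : Function.Surjective (mk X) := RingQuot.mkAlgHom_surjective K (SymRel X)

lemma mk_rel {a b : TensorAlgebra K V} (h : SymRel X a b) : mk X a = mk X b :=
  RingQuot.mkAlgHom_rel K h

/-- The inclusion of the generators. -/
def ι : V →ₗ[K] Sym X := (mk X).toLinearMap ∘ₗ TensorAlgebra.ι K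

lemma ι_mul_ι {i j : ℤ} {x y : V} (hx : x ∈ X.gr i) (hy : y ∈ X.gr j) :
    ι X x * ι X y = sg K (i * j) • (ι X y * ι X x) := by
  simpa [ι] using mk_rel X (SymRel.comm hx hy)

lemma ι_mul_ι_mul {i j : ℤ} {x y : V} (hx : x ∈ X.gr i) (hy : y ∈ X.gr j) (a : Sym X) :
    ι X x * (ι X y * a) = sg K (i * j) • (ι X y * (ι X x * a)) := by
  rw [← mul_assoc, ι_mul_ι X hx hy, smul_mul_assoc, mul_assoc]

/-- The algebra map out of the graded symmetric algebra determined by a linear map on `V`. -/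
def lift {A : Type*} [Ring A] [Algebra K A] (f : V →ₗ[K] A)
    (hf : ∀ i j, ∀ x ∈ X.gr i, ∀ y ∈ X.gr j, f x * f y = sg K (i * j) • (f y * f x)) :
    Sym X →ₐ[K] A :=
  RingQuot.liftAlgHom K ⟨TensorAlgebra.lift K f, by
    rintro _ _ ⟨hx, hy⟩
    simpa using hf _ _ _ hx _ hy⟩

lemma lift_ι {A : Type*} [Ring A] [Algebra K A] (f : V →ₗ[K] A)
    (hf : ∀ i j, ∀ x ∈ X.gr i, ∀ y ∈ X.gr j, f x * f y = sg K (i * j) • (f y * f x)) (x : V) :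
    lift X f hf (ι X x) = f x := by
  have h := RingQuot.liftAlgHom_mkAlgHom_apply K (TensorAlgebra.lift K f) (s := SymRel X) (by
    rintro _ _ ⟨hx, hy⟩
    simpa using hf _ _ _ hx _ hy) (TensorAlgebra.ι K x)
  rw [TensorAlgebra.lift_ι_apply] at h
  exact h

/-- The products of finitely many homogeneous elements of `V`, of total degree `n`. -/
inductive HomProd : ℤ → Sym X → Prop
  | one : HomProd 0 1
  | cons {i n : ℤ} {x : V} {a : Sym X} (hx : x ∈ X.gr i) (ha : HomProd n a) :
      HomProd (i + n) (ι X x * a)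

/-- The degree `n` part of the graded symmetric algebra. -/
def gr (n : ℤ) : Submodule K (Sym X) := Submodule.span K {a | HomProd X n a}

lemma one_mem : (1 : Sym X) ∈ gr X 0 := Submodule.subset_span .one

variable {X} in
lemma ι_mul_mem {i n : ℤ} {x : V} {a : Sym X} (hx : x ∈ X.gr i) (ha : a ∈ gr X n) :
    ι X x * a ∈ gr X (i + n) := by
  induction ha using Submodule.span_induction with
  | mem a ha => exact Submodule.subset_span (.cons hx ha)
  | zero => simp
  | add a b _ _ ha hb => rw [mul_add]; exact add_mem ha hb
  | smul c a _ ha => rw [mul_smul_comm]; exact Submodule.smul_mem _ _ ha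

lemma eq_top_of {S : Submodule K (Sym X)} (h1 : 1 ∈ S)
    (h : ∀ i, ∀ x ∈ X.gr i, ∀ a ∈ S, ι X x * a ∈ S) : S = ⊤ := by
  have h' : ∀ (x : V), ∀ a ∈ S, ι X x * a ∈ S := by
    intro x a ha
    have : S.mkQ ∘ₗ (LinearMap.mul K (Sym X)).flip a ∘ₗ ι X = 0 := by
      refine X.hom_ext fun i x hx => ?_
      simpa using h i x hx a ha
    simpa using LinearMap.congr_fun this x
  have key : ∀ t : TensorAlgebra K V, ∀ s ∈ S, mk X t * s ∈ S := by
    intro t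
    induction t using TensorAlgebra.induction with
    | algebraMap r =>
      intro s hs
      rw [AlgHom.commutes, ← Algebra.smul_def]
      exact S.smul_mem _ hs
    | ι x => exact fun s hs => h' x s hs
    | mul a b ha hb => intro s hs; rw [map_mul, mul_assoc]; exact ha _ (hb _ hs)
    | add a b ha hb => intro s hs; rw [map_add, add_mul]; exact add_mem (ha _ hs) (hb _ hs)
  rw [eq_top_iff]
  intro a _
  obtain ⟨t, rfl⟩ := mk_surjective X a
  simpa using key t 1 h1

/-- Linear maps on the symmetric algebra are compared by induction on the length of products. -/
lemma hom_ext {f g : Sym X →ₗ[K] N} (h1 : f 1 = g 1)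
    (h : ∀ i, ∀ x ∈ X.gr i, ∀ a, f a = g a → f (ι X x * a) = g (ι X x * a)) : f = g := by
  have : LinearMap.eqLocus f g = ⊤ := eq_top_of X h1 h
  exact LinearMap.ext fun a => by
    have : a ∈ LinearMap.eqLocus f g := this ▸ Submodule.mem_top
    exact this

lemma gr_induction {n : ℤ} {S : ℤ → Submodule K (Sym X)} (h1 : 1 ∈ S 0)
    (h : ∀ i m, ∀ x ∈ X.gr i, ∀ a, HomProd X m a → a ∈ S m → ι X x * a ∈ S (i + m)) :
    gr X n ≤ S n := by
  refine Submodule.span_le.mpr fun a ha => ?_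
  induction ha with
  | one => exact h1
  | cons hx ha ih => exact h _ _ _ hx _ ha ih

lemma iSup_gr : ⨆ n, gr X n = ⊤ := by
  refine eq_top_of X (Submodule.mem_iSup_of_mem 0 (one_mem X)) fun i x hx a ha => ?_
  induction ha using Submodule.iSup_induction' with
  | mem n a ha => exact Submodule.mem_iSup_of_mem _ (ι_mul_mem hx ha)
  | zero => simp
  | add a b _ _ ha hb => rw [mul_add]; exact add_mem ha hb

/-- The map `a ↦ a tⁿ` into the Laurent polynomials. -/
def tpow (n : ℤ) : Sym X →ₗ[K] AddMonoidAlgebra (Sym X) ℤ := AddMonoidAlgebra.lsingle n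

lemma tpow_mul (m n : ℤ) (a b : Sym X) : tpow X m a * tpow X n b = tpow X (m + n) (a * b) :=
  AddMonoidAlgebra.single_mul_single ..

/-- The algebra map that records degrees: `a ↦ a tⁿ` for `a` of degree `n`. -/
def weight : Sym X →ₐ[K] AddMonoidAlgebra (Sym X) ℤ :=
  lift X (X.homLift (N := AddMonoidAlgebra (Sym X) ℤ) fun i => tpow X i ∘ₗ ι X) (by
    intro i j x hx y hy
    simp only [X.homLift_apply _ hx, X.homLift_apply _ hy, LinearMap.comp_apply, tpow_mul]
    rw [ι_mul_ι X hx hy, add_comm j i, map_smul])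

lemma weight_apply {n : ℤ} {a : Sym X} (ha : a ∈ gr X n) : weight X a = tpow X n a := by
  refine gr_induction X (n := n)
    (S := fun n => LinearMap.eqLocus (weight X).toLinearMap (tpow X n)) ?_ ?_ ha
  · rw [LinearMap.mem_eqLocus, AlgHom.toLinearMap_apply, map_one]; rfl
  · intro i m x hx a _ ha
    rw [LinearMap.mem_eqLocus, AlgHom.toLinearMap_apply] at ha ⊢
    rw [map_mul, ha, weight, lift_ι, X.homLift_apply _ hx, LinearMap.comp_apply, tpow_mul]

lemma gr_internal : DirectSum.IsInternal (gr X) := by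
  have h : ∀ m n a, (tpow X m a).coeff n = if m = n then a else 0 := by
    intro m n a
    exact Finsupp.single_apply
  refine isInternal_of_proj _ (iSup_gr X)
    (fun n => (Finsupp.lapply n : (ℤ →₀ Sym X) →ₗ[K] Sym X) ∘ₗ
      (AddMonoidAlgebra.coeffLinearEquiv K).toLinearMap ∘ₗ (weight X).toLinearMap) ?_ ?_
  · intro n x hx
    simp [weight_apply X hx, h]
  · intro m n hmn x hx
    simp [weight_apply X hx, h, hmn]

/-- The algebra map behind `deriv`: `x` acts on `Sym X × N` by `(a, n) ↦ (x a, l x n + D x a)`. -/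
def derivAct (l : V →ₗ[K] Module.End K N) (D : V →ₗ[K] Sym X →ₗ[K] N) :
    V →ₗ[K] Module.End K (Sym X × N) where
  toFun x := (LinearMap.mulLeft K (ι X x) ∘ₗ LinearMap.fst K (Sym X) N).prod
    (l x ∘ₗ LinearMap.snd K (Sym X) N + D x ∘ₗ LinearMap.fst K (Sym X) N)
  map_add' x y := by
    refine LinearMap.ext fun p => Prod.ext ?_ ?_
    · simp [add_mul]
    · simp; abel
  map_smul' c x := by
    refine LinearMap.ext fun p => Prod.ext ?_ ?_ <;> simp

lemma derivAct_apply (l : V →ₗ[K] Module.End K N) (D : V →ₗ[K] Sym X →ₗ[K] N) (x : V)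
    (p : Sym X × N) : derivAct X l D x p = (ι X x * p.1, l x p.2 + D x p.1) := rfl

/-- Compatibility of the data of `deriv` with graded commutativity. -/
structure DerivData (l : V →ₗ[K] Module.End K N) (D : V →ₗ[K] Sym X →ₗ[K] N) : Prop where
  comm : ∀ i j, ∀ x ∈ X.gr i, ∀ y ∈ X.gr j, ∀ n, l x (l y n) = sg K (i * j) • l y (l x n)
  der : ∀ i j, ∀ x ∈ X.gr i, ∀ y ∈ X.gr j, ∀ a, l x (D y a) + D x (ι X y * a) =
    sg K (i * j) • (l y (D x a) + D y (ι X x * a))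

variable {X} in
lemma DerivData.rel {l : V →ₗ[K] Module.End K N} {D : V →ₗ[K] Sym X →ₗ[K] N}
    (h : DerivData X l D) (i j : ℤ) (x : V) (hx : x ∈ X.gr i) (y : V) (hy : y ∈ X.gr j) :
    derivAct X l D x * derivAct X l D y = sg K (i * j) • (derivAct X l D y * derivAct X l D x) := by
  refine LinearMap.ext fun p => Prod.ext ?_ ?_
  · simp [derivAct_apply, ι_mul_ι_mul X hx hy p.1]
  · have e1 := h.comm i j x hx y hy p.2
    have e2 := h.der i j x hx y hy p.1
    simp only [Module.End.mul_apply, LinearMap.smul_apply, derivAct_apply, map_add, Prod.smul_snd]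
    rw [add_assoc, e1, e2, ← smul_add, add_assoc]

variable {X} in
/-- The action of the symmetric algebra on `Sym X × N` that extends `derivAct`. -/
def DerivData.act {l : V →ₗ[K] Module.End K N} {D : V →ₗ[K] Sym X →ₗ[K] N}
    (h : DerivData X l D) : Sym X →ₐ[K] Module.End K (Sym X × N) :=
  lift X (A := Module.End K (Sym X × N)) (derivAct X l D) h.rel

variable {X} in
/-- The linear map `f` on the symmetric algebra with `f 1 = 0` and `f (x a) = l x (f a) + D x a`
for `x` in `V`: a derivation in the graded sense, for a suitable action `l`. -/
def DerivData.deriv {l : V →ₗ[K] Module.End K N} {D : V →ₗ[K] Sym X →ₗ[K] N}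
    (h : DerivData X l D) : Sym X →ₗ[K] N where
  toFun a := (h.act a (1, 0)).2
  map_add' a b := by simp
  map_smul' c a := by simp

section deriv

variable {X} {l : V →ₗ[K] Module.End K N} {D : V →ₗ[K] Sym X →ₗ[K] N} (h : DerivData X l D)

lemma DerivData.act_mul (x : V) (a : Sym X) (p : Sym X × N) :
    h.act (ι X x * a) p = (ι X x * (h.act a p).1, l x (h.act a p).2 + D x (h.act a p).1) := by
  rw [map_mul, Module.End.mul_apply]
  have : h.act (ι X x) = derivAct X l D x := lift_ι X (A := Module.End K (Sym X × N)) _ h.rel x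
  rw [this, derivAct_apply]

lemma DerivData.deriv_one : h.deriv 1 = 0 := by simp [DerivData.deriv]

lemma DerivData.fst_eq (a : Sym X) : (h.act a (1, 0)).1 = a := by
  let F : Sym X →ₗ[K] Sym X :=
    { toFun := fun a => (h.act a (1, 0)).1
      map_add' := fun a b => by simp
      map_smul' := fun c a => by simp }
  have hF : ∀ a, F a = (h.act a (1, 0)).1 := fun _ => rfl
  have : F = LinearMap.id := by
    refine hom_ext X (by simp [hF]) fun i x hx a ha => ?_
    rw [LinearMap.id_apply, hF] at ha ⊢
    rw [h.act_mul, ha]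
  exact LinearMap.congr_fun this a

lemma DerivData.deriv_mul (x : V) (a : Sym X) :
    h.deriv (ι X x * a) = l x (h.deriv a) + D x a := by
  have e := h.fst_eq a
  change (h.act (ι X x * a) (1, 0)).2 = l x (h.act a (1, 0)).2 + D x a
  rw [h.act_mul, e]

end deriv

lemma sgn_mem (k : ℤ) {i : ℤ} {x : V} (hx : x ∈ X.gr i) : X.sgn k x ∈ X.gr i := by
  rw [X.sgn_apply k hx]; exact Submodule.smul_mem _ _ hx

lemma d_data : DerivData X (N := Sym X) (LinearMap.mul K (Sym X) ∘ₗ ι X ∘ₗ X.sgn 1)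
    (LinearMap.mul K (Sym X) ∘ₗ ι X ∘ₗ X.d) := by
  constructor
  · intro i j x hx y hy a
    simp only [LinearMap.comp_apply, LinearMap.mul_apply']
    exact ι_mul_ι_mul X (sgn_mem X 1 hx) (sgn_mem X 1 hy) a
  · intro i j x hx y hy a
    simp only [LinearMap.comp_apply, LinearMap.mul_apply']
    rw [ι_mul_ι_mul X (sgn_mem X 1 hx) (X.d_mem j y hy), ι_mul_ι_mul X (X.d_mem i x hx) hy,
      X.sgn_apply 1 hx, X.sgn_apply 1 hy]
    simp only [map_smul, smul_mul_assoc, mul_smul_comm, smul_smul, smul_add, one_mul]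
    have e1 : sg K (i * (j - 1)) * sg K i = sg K (i * j) := by rw [← sg_add]; congr 1; ring
    have e2 : sg K ((i - 1) * j) = sg K (i * j) * sg K j := by
      have : sg K (i * j) = sg K ((i - 1) * j) * sg K j := by rw [← sg_add]; congr 1; ring
      rw [this, mul_assoc, sg_sq, mul_one]
    rw [e1, e2, add_comm]

/-- The differential of the symmetric algebra, the graded derivation that extends that of `V`:
`d (x a) = (d x) a + (-1)^|x| x (d a)`. -/
def d : Sym X →ₗ[K] Sym X := (d_data X).deriv

lemma d_one : d X 1 = 0 := (d_data X).deriv_one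

lemma d_mul (x : V) (a : Sym X) :
    d X (ι X x * a) = ι X (X.sgn 1 x) * d X a + ι X (X.d x) * a := (d_data X).deriv_mul x a

lemma d_mul' {i : ℤ} {x : V} (hx : x ∈ X.gr i) (a : Sym X) :
    d X (ι X x * a) = ι X (X.d x) * a + sg K i • (ι X x * d X a) := by
  rw [d_mul, X.sgn_apply 1 hx, add_comm]; simp

/-- The graded symmetric algebra of a dg vector space, as a dg vector space. -/
def toDGSpace : DGSpace K (Sym X) where
  gr := gr X
  internal := gr_internal X
  d := d X
  d_mem := by
    intro n a ha
    refine gr_induction X (S := fun n => (gr X (n - 1)).comap (d X)) ?_ ?_ ha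
    · simp [d_one]
    · intro i m x hx a ha' ha
      have ha'' : a ∈ gr X m := Submodule.subset_span ha'
      simp only [Submodule.mem_comap] at ha ⊢
      rw [d_mul' X hx]
      refine add_mem ?_ (Submodule.smul_mem _ _ ?_)
      · rw [show i + m - 1 = (i - 1) + m by ring]; exact ι_mul_mem (X.d_mem i x hx) ha''
      · rw [show i + m - 1 = i + (m - 1) by ring]; exact ι_mul_mem hx ha
  d_d := by
    have : d X ∘ₗ d X = 0 := by
      refine hom_ext X (by simp [d_one]) fun i x hx a ha => ?_
      simp only [LinearMap.comp_apply, LinearMap.zero_apply] at ha ⊢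
      rw [d_mul' X hx, map_add, map_smul, d_mul' X hx, d_mul' X (X.d_mem i x hx), ha, X.d_d,
        sg_sub_one]
      simp only [map_zero, zero_mul, mul_zero, smul_zero, zero_add, add_zero, neg_smul,
        neg_add_cancel]
    exact fun a => LinearMap.congr_fun this a

/-- The augmentation, which is zero on the generators. -/
def aug : Sym X →ₐ[K] K := lift X 0 (by simp)

lemma aug_mul (x : V) (a : Sym X) : aug X (ι X x * a) = 0 := by
  rw [map_mul, aug, lift_ι]; simp

/-- The projection `a ↦ a - ε(a) 1`, with `ε` the augmentation. -/
def toPlusAux : Sym X →ₗ[K] Sym X := LinearMap.id - Algebra.linearMap K (Sym X) ∘ₗ (aug X).toLinearMap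

lemma toPlusAux_one : toPlusAux X 1 = 0 := by simp [toPlusAux]

lemma toPlusAux_mul (x : V) (a : Sym X) : toPlusAux X (ι X x * a) = ι X x * a := by
  simp [toPlusAux, aug_mul]

lemma toPlusAux_isHom : (toDGSpace X).IsHom (toDGSpace X) (toPlusAux X) := by
  constructor
  · intro n a ha
    refine gr_induction X (S := fun n => (gr X n).comap (toPlusAux X)) ?_ ?_ ha
    · simp [toPlusAux_one]
    · intro i m x hx a ha' _
      rw [Submodule.mem_comap, toPlusAux_mul]
      exact ι_mul_mem hx (Submodule.subset_span ha')
  · have : toPlusAux X ∘ₗ d X = d X ∘ₗ toPlusAux X := by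
      refine hom_ext X (by simp [d_one, toPlusAux_one]) fun i x hx a ha => ?_
      simp [d_mul, toPlusAux_mul]
    exact fun a => LinearMap.congr_fun this a

end Sym

namespace DGSpace

variable {K : Type u} [Field K] {M : Type v} [AddCommGroup M] [Module K M] (X : DGSpace K M)

/-- The dg structure on a subspace `S` that is the image of a projector `P` of dg vector spaces. -/
def sub (S : Submodule K M) (P : M →ₗ[K] S) (hP : ∀ x : S, P x = x)
    (hE : X.IsHom X (S.subtype ∘ₗ P)) : DGSpace K S where
  gr n := (X.gr n).comap S.subtype
  internal := by
    refine isInternal_of_proj _ ?_ (fun n => P ∘ₗ X.proj n ∘ₗ S.subtype) ?_ ?_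
    · have : (⨆ n, (X.gr n).comap S.subtype).mkQ ∘ₗ P = 0 := by
        refine X.hom_ext fun i x hx => ?_
        simp only [LinearMap.comp_apply, LinearMap.zero_apply, Submodule.mkQ_apply,
          Submodule.Quotient.mk_eq_zero]
        exact Submodule.mem_iSup_of_mem i (hE.map_mem i x hx)
      rw [eq_top_iff]
      intro x _
      have h := LinearMap.congr_fun this x
      simpa [hP] using h
    · intro n x hx
      have hx' : (x : M) ∈ X.gr n := hx
      simp [X.proj_same hx', hP]
    · intro m n hmn x hx
      have hx' : (x : M) ∈ X.gr m := hx
      simp [X.proj_ne hmn hx']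
  d := P ∘ₗ X.d ∘ₗ S.subtype
  d_mem := fun i x hx => hE.map_mem _ _ (X.d_mem i x hx)
  d_d := by
    intro x
    have h := hE.map_d (X.d x)
    simp only [LinearMap.comp_apply, Submodule.subtype_apply, X.d_d] at h ⊢
    have h2 := hE.map_d x
    simp only [LinearMap.comp_apply, Submodule.subtype_apply, hP] at h2
    rw [h2, X.d_d, map_zero]

lemma sub_d (S : Submodule K M) (P : M →ₗ[K] S) (hP : ∀ x : S, P x = x)
    (hE : X.IsHom X (S.subtype ∘ₗ P)) (x : S) : ((X.sub S P hP hE).d x : M) = X.d x := by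
  have h2 := hE.map_d x
  simp only [LinearMap.comp_apply, Submodule.subtype_apply, hP] at h2
  exact h2

lemma sub_isHom (S : Submodule K M) (P : M →ₗ[K] S) (hP : ∀ x : S, P x = x)
    (hE : X.IsHom X (S.subtype ∘ₗ P)) : X.IsHom (X.sub S P hP hE) P := by
  refine ⟨fun i x hx => hE.map_mem i x hx, fun x => Subtype.ext ?_⟩
  rw [sub_d]
  exact hE.map_d x

lemma sub_incl_isHom (S : Submodule K M) (P : M →ₗ[K] S) (hP : ∀ x : S, P x = x)
    (hE : X.IsHom X (S.subtype ∘ₗ P)) : (X.sub S P hP hE).IsHom X S.subtype :=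
  ⟨fun _ _ hx => hx, fun x => X.sub_d S P hP hE x⟩

end DGSpace

section SubComodule

variable {K : Type u} [Field K] {V : Type v} [AddCommGroup V] [Module K V]
variable {L : DGLieCoalgebra K V} {M : Type w} [AddCommGroup M] [Module K M]

/-- The subcomodule of `M` on a subspace `S` with `ρ(S) ⊆ L ⊗ S`, where `S` is the image of a
projector `P` of dg vector spaces. -/
def DGLieComodule.sub (R : DGLieComodule L M) (S : Submodule K M) (P : M →ₗ[K] S)
    (hP : ∀ x : S, P x = x) (hE : R.toDGSpace.IsHom R.toDGSpace (S.subtype ∘ₗ P))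
    (hρ : ∀ x : S, (S.subtype ∘ₗ P).lTensor V (R.coact x) = R.coact x) : DGLieComodule L S where
  toDGSpace := R.toDGSpace.sub S P hP hE
  coact := P.lTensor V ∘ₗ R.coact ∘ₗ S.subtype
  coact_isHom := ((IsHom.id (X := L.toDGSpace)).tensor (R.sub_isHom S P hP hE)).comp
    (R.coact_isHom.comp (R.sub_incl_isHom S P hP hE))
  coact_cobr := by
    intro x
    have e1 : ∀ t : V ⊗[K] M, (P.lTensor V ∘ₗ R.coact ∘ₗ S.subtype).lTensor V (P.lTensor V t) =
        (P.lTensor V).lTensor V (R.coact.lTensor V ((S.subtype ∘ₗ P).lTensor V t)) := by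
      intro t
      induction t using TensorProduct.induction_on with
      | zero => simp
      | tmul a b => simp
      | add a b ha hb => simp only [map_add, ha, hb]
    have e2 : ∀ t : V ⊗[K] (V ⊗[K] M),
        L.swapLeft L.toDGSpace S ((P.lTensor V).lTensor V t) =
        (P.lTensor V).lTensor V (L.swapLeft L.toDGSpace M t) := by
      intro t
      have : L.swapLeft L.toDGSpace S ∘ₗ (P.lTensor V).lTensor V =
          (P.lTensor V).lTensor V ∘ₗ L.swapLeft L.toDGSpace M := by
        refine L.tensor_ext (L.tensor R.toDGSpace) fun i n x hx u hu => ?_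
        simp only [LinearMap.comp_apply]
        induction hu using Submodule.span_induction with
        | mem u hu =>
          obtain ⟨a, b, rfl, y, hy, z, hz, rfl⟩ := hu
          simp [L.swapLeft_tmul L.toDGSpace hx hy]
        | zero => simp
        | add a b _ _ ha hb => simp only [TensorProduct.tmul_add, map_add, ha, hb]
        | smul c a _ ha => simp only [TensorProduct.tmul_smul, map_smul, ha]
      exact LinearMap.congr_fun this t
    have e3 : ∀ t : V ⊗[K] M, TensorProduct.assoc K V V S (L.cobr.rTensor S (P.lTensor V t)) =
        (P.lTensor V).lTensor V (TensorProduct.assoc K V V M (L.cobr.rTensor M t)) := by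
      intro t
      induction t using TensorProduct.induction_on with
      | zero => simp
      | tmul a b =>
        simp only [LinearMap.rTensor_tmul, LinearMap.lTensor_tmul]
        generalize L.cobr a = u
        induction u using TensorProduct.induction_on with
        | zero => simp
        | tmul a b => simp
        | add a b ha hb => simp only [map_add, TensorProduct.add_tmul, ha, hb]
      | add a b ha hb => simp only [map_add, ha, hb]
    have h1 : (P.lTensor V ∘ₗ R.coact ∘ₗ S.subtype) x = P.lTensor V (R.coact x) := rfl
    rw [h1, e1, hρ, e2, e3, R.coact_cobr, map_sub]

lemma DGLieComodule.sub_coact (R : DGLieComodule L M) (S : Submodule K M) (P : M →ₗ[K] S)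
    (hP : ∀ x : S, P x = x) (hE : R.toDGSpace.IsHom R.toDGSpace (S.subtype ∘ₗ P))
    (hρ : ∀ x : S, (S.subtype ∘ₗ P).lTensor V (R.coact x) = R.coact x) (x : S) :
    S.subtype.lTensor V ((R.sub S P hP hE hρ).coact x) = R.coact x := by
  rw [← hρ, LinearMap.lTensor_comp]; rfl

end SubComodule

namespace Sym

variable {K : Type u} [Field K] {V : Type v} [AddCommGroup V] [Module K V]

section Ops

variable (X : DGSpace K V)

/-- The multiplication map `x ⊗ a ↦ x a`. -/
def mulMap : V ⊗[K] Sym X →ₗ[K] Sym X := TensorProduct.lift (LinearMap.mul K (Sym X) ∘ₗ ι X)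

/-- The action `x ⊗ (v ⊗ a) ↦ (-1)^(|x||v|) v ⊗ x a` of `V` on `V ⊗ Sym V`. -/
def lact : V →ₗ[K] Module.End K (V ⊗[K] Sym X) :=
  TensorProduct.curry ((mulMap X).lTensor V ∘ₗ X.swapLeft X (Sym X))

/-- The map `(v ⊗ w) ⊗ a ↦ v ⊗ w a`. -/
def ract : V ⊗[K] V →ₗ[K] Sym X →ₗ[K] V ⊗[K] Sym X :=
  TensorProduct.curry ((mulMap X).lTensor V ∘ₗ (TensorProduct.assoc K V V (Sym X)).toLinearMap)

lemma lact_tmul {i j : ℤ} {x y : V} (hx : x ∈ X.gr i) (hy : y ∈ X.gr j) (a : Sym X) :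
    lact X x (y ⊗ₜ a) = sg K (i * j) • (y ⊗ₜ (ι X x * a)) := by
  simp [lact, X.swapLeft_tmul X hx hy, mulMap]

lemma ract_tmul (x y : V) (a : Sym X) : ract X (x ⊗ₜ y) a = x ⊗ₜ (ι X y * a) := by
  simp [ract, mulMap]

lemma lact_comm {i j : ℤ} {x y : V} (hx : x ∈ X.gr i) (hy : y ∈ X.gr j) (t : V ⊗[K] Sym X) :
    lact X x (lact X y t) = sg K (i * j) • lact X y (lact X x t) := by
  have : lact X x ∘ₗ lact X y = sg K (i * j) • (lact X y ∘ₗ lact X x) := by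
    refine X.tensor_ext (toDGSpace X) fun k n z hz a _ => ?_
    simp only [LinearMap.comp_apply, LinearMap.smul_apply]
    rw [lact_tmul X hx hz, lact_tmul X hy hz, map_smul, map_smul, lact_tmul X hx hz,
      lact_tmul X hy hz, ι_mul_ι_mul X hx hy, TensorProduct.tmul_smul]
    simp only [smul_smul]
    congr 1; ring
  exact LinearMap.congr_fun this t

lemma lact_ract {i j : ℤ} {x : V} {u : V ⊗[K] V} (hx : x ∈ X.gr i) (hu : u ∈ X.tensorGr X j)
    (a : Sym X) : lact X x (ract X u a) = sg K (i * j) • ract X u (ι X x * a) := by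
  induction hu using Submodule.span_induction with
  | mem u hu =>
    obtain ⟨k, l, rfl, y, hy, z, hz, rfl⟩ := hu
    rw [ract_tmul, ract_tmul, lact_tmul X hx hy, ι_mul_ι_mul X hx hz, TensorProduct.tmul_smul,
      smul_smul, ← sg_add, mul_add]
  | zero => simp
  | add a b _ _ ha hb => simp only [map_add, LinearMap.add_apply, ha, hb, smul_add]
  | smul c a _ ha => simp only [map_smul, LinearMap.smul_apply, ha, smul_comm c]

lemma lact_mem {i n : ℤ} {x : V} {t : V ⊗[K] Sym X} (hx : x ∈ X.gr i)
    (ht : t ∈ X.tensorGr (toDGSpace X) n) : lact X x t ∈ X.tensorGr (toDGSpace X) (i + n) := by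
  induction ht using Submodule.span_induction with
  | mem u hu =>
    obtain ⟨k, l, rfl, y, hy, a, ha, rfl⟩ := hu
    rw [lact_tmul X hx hy]
    refine Submodule.smul_mem _ _ (tmul_mem' (i := k) (j := i + l) (by ring) hy ?_)
    exact ι_mul_mem hx ha
  | zero => simp
  | add a b _ _ ha hb => rw [map_add]; exact add_mem ha hb
  | smul c a _ ha => rw [map_smul]; exact Submodule.smul_mem _ _ ha

lemma ract_mem {i n : ℤ} {u : V ⊗[K] V} {a : Sym X} (hu : u ∈ X.tensorGr X i) (ha : a ∈ gr X n) :
    ract X u a ∈ X.tensorGr (toDGSpace X) (i + n) := by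
  induction hu using Submodule.span_induction with
  | mem u hu =>
    obtain ⟨k, l, rfl, y, hy, z, hz, rfl⟩ := hu
    rw [ract_tmul]
    exact tmul_mem' (i := k) (j := l + n) (by ring) hy (ι_mul_mem hz ha)
  | zero => simp
  | add a b _ _ ha hb => rw [map_add]; exact add_mem ha hb
  | smul c a _ ha => rw [map_smul]; exact Submodule.smul_mem _ _ ha

lemma tensorD_lact {i : ℤ} {x : V} (hx : x ∈ X.gr i) (t : V ⊗[K] Sym X) :
    X.tensorD (toDGSpace X) (lact X x t) =
      lact X (X.d x) t + sg K i • lact X x (X.tensorD (toDGSpace X) t) := by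
  have : X.tensorD (toDGSpace X) ∘ₗ lact X x =
      lact X (X.d x) + sg K i • (lact X x ∘ₗ X.tensorD (toDGSpace X)) := by
    refine X.tensor_ext (toDGSpace X) fun k n y hy a _ => ?_
    have hd : ∀ b, (toDGSpace X).d b = d X b := fun _ => rfl
    simp only [LinearMap.comp_apply, LinearMap.smul_apply, LinearMap.add_apply]
    rw [lact_tmul X hx hy, map_smul, X.tensorD_tmul _ hy, X.tensorD_tmul _ hy, map_add, map_smul,
      lact_tmul X hx hy, lact_tmul X (X.d_mem i x hx) hy, lact_tmul X hx (X.d_mem k y hy),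
      hd, hd, d_mul' X hx, TensorProduct.tmul_add, TensorProduct.tmul_smul]
    simp only [smul_add, smul_smul]
    have e1 : sg K (i * k) * sg K k = sg K ((i - 1) * k) := by
      have : sg K (i * k) = sg K ((i - 1) * k) * sg K k := by rw [← sg_add]; congr 1; ring
      rw [this, mul_assoc, sg_sq, mul_one]
    have e2 : sg K i * sg K (i * (k - 1)) = sg K (i * k) := by rw [← sg_add]; congr 1; ring
    have e3 : sg K (i * k) * (sg K k * sg K i) = sg K i * (sg K k * sg K (i * k)) := by ring
    rw [e1, e2, e3]
    abel
  exact LinearMap.congr_fun this t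

lemma tensorD_ract {i : ℤ} {u : V ⊗[K] V} (hu : u ∈ X.tensorGr X i) (a : Sym X) :
    X.tensorD (toDGSpace X) (ract X u a) =
      ract X (X.tensorD X u) a + sg K i • ract X u (d X a) := by
  have hd : ∀ b, (toDGSpace X).d b = d X b := fun _ => rfl
  induction hu using Submodule.span_induction with
  | mem u hu =>
    obtain ⟨k, l, rfl, y, hy, z, hz, rfl⟩ := hu
    rw [ract_tmul, ract_tmul, X.tensorD_tmul _ hy, X.tensorD_tmul _ hy, hd, d_mul' X hz,
      map_add, map_smul, LinearMap.add_apply, LinearMap.smul_apply, ract_tmul, ract_tmul,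
      TensorProduct.tmul_add, TensorProduct.tmul_smul, smul_add, smul_smul, ← sg_add, add_assoc]
  | zero => simp
  | add a b _ _ ha hb =>
    simp only [map_add, LinearMap.add_apply, ha, hb, smul_add]; abel
  | smul c a _ ha =>
    simp only [map_smul, LinearMap.smul_apply, ha, smul_add, smul_comm c]

end Ops

variable (L : DGLieCoalgebra K V)

lemma coact_data : DerivData L.toDGSpace (lact L.toDGSpace) (ract L.toDGSpace ∘ₗ L.cobr) := by
  constructor
  · exact fun i j x hx y hy t => lact_comm L.toDGSpace hx hy t
  · intro i j x hx y hy a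
    simp only [LinearMap.comp_apply]
    rw [lact_ract L.toDGSpace hx (L.cobr_isHom.map_mem j y hy),
      lact_ract L.toDGSpace hy (L.cobr_isHom.map_mem i x hx), smul_add, smul_smul,
      mul_comm j i, sg_sq, one_smul, add_comm]

/-- The coaction `ρ : Sym L → L ⊗ Sym L` that extends the cobracket of `L` as a derivation:
`ρ (x₁ ⋯ xₙ) = ∑ᵢ ± xᵢ' ⊗ x₁ ⋯ xᵢ'' ⋯ xₙ`, where `δ x = ∑ x' ⊗ x''` and where the sign is the Koszul
sign of moving `xᵢ'` to the left past `x₁, …, xᵢ₋₁`. -/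
def coact : Sym L.toDGSpace →ₗ[K] V ⊗[K] Sym L.toDGSpace := (coact_data L).deriv

lemma coact_one : coact L 1 = 0 := (coact_data L).deriv_one

lemma coact_mul (x : V) (a : Sym L.toDGSpace) :
    coact L (ι _ x * a) = lact _ x (coact L a) + ract _ (L.cobr x) a := (coact_data L).deriv_mul x a

/-- On generators, the coaction is the cobracket. -/
lemma coact_ι (x : V) : coact L (ι _ x) = (ι L.toDGSpace).lTensor V (L.cobr x) := by
  have h := coact_mul L x 1
  rw [mul_one, coact_one, map_zero, zero_add] at h
  rw [h]
  generalize L.cobr x = u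
  induction u using TensorProduct.induction_on with
  | zero => simp
  | tmul a b => simp [ract_tmul]
  | add a b ha hb => simp only [map_add, LinearMap.add_apply, ha, hb]

lemma coact_isHom :
    (toDGSpace L.toDGSpace).IsHom (L.tensor (toDGSpace L.toDGSpace)) (coact L) := by
  constructor
  · intro n a ha
    refine gr_induction L.toDGSpace
      (S := fun n => (L.tensorGr (toDGSpace L.toDGSpace) n).comap (coact L)) ?_ ?_ ha
    · simp [coact_one]
    · intro i m x hx a ha' ha
      rw [Submodule.mem_comap] at ha ⊢
      rw [coact_mul]
      exact add_mem (lact_mem _ hx ha)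
        (ract_mem _ (L.cobr_isHom.map_mem i x hx) (Submodule.subset_span ha'))
  · have : coact L ∘ₗ d L.toDGSpace = L.tensorD (toDGSpace L.toDGSpace) ∘ₗ coact L := by
      refine hom_ext _ (by simp [d_one, coact_one]) fun i x hx a ha => ?_
      simp only [LinearMap.comp_apply] at ha ⊢
      have hδ : L.tensorD L.toDGSpace (L.cobr x) = L.cobr (L.d x) :=
        (L.cobr_isHom.map_d x).symm
      rw [d_mul' _ hx, map_add, map_smul, coact_mul, coact_mul, coact_mul, map_add,
        tensorD_lact _ hx, tensorD_ract _ (L.cobr_isHom.map_mem i x hx), ha, hδ, smul_add]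
      abel
    exact fun a => LinearMap.congr_fun this a

section Axiom

variable {L}

/-- The action `y ⊗ (z ⊗ a) ↦ ± y ⊗ (z ⊗ x a)` of `x` on `V ⊗ (V ⊗ Sym V)`. -/
def lact2 {i : ℤ} (x : V) : V ⊗[K] (V ⊗[K] (Sym L.toDGSpace)) →ₗ[K] V ⊗[K] (V ⊗[K] (Sym L.toDGSpace)) :=
  TensorProduct.map (L.sgn i) (lact L.toDGSpace x)

lemma lact_eq {i : ℤ} {x : V} (hx : x ∈ L.gr i) (t : V ⊗[K] (Sym L.toDGSpace)) :
    lact L.toDGSpace x t = TensorProduct.map (L.sgn i) (LinearMap.mulLeft K (ι _ x)) t := by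
  have : lact L.toDGSpace x = TensorProduct.map (L.sgn i) (LinearMap.mulLeft K (ι _ x)) := by
    refine L.tensor_ext (toDGSpace L.toDGSpace) fun k n y hy a _ => ?_
    rw [lact_tmul _ hx hy, TensorProduct.map_tmul, L.sgn_apply i hy,
      TensorProduct.smul_tmul', LinearMap.mulLeft_apply]
  exact LinearMap.congr_fun this t

/-- `(l ⊗ l') ⊗ (v ⊗ a) ↦ l ⊗ l' · (v ⊗ a)`. -/
def Q' (u : V ⊗[K] V) : V ⊗[K] (Sym L.toDGSpace) →ₗ[K] V ⊗[K] (V ⊗[K] (Sym L.toDGSpace)) :=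
  TensorProduct.lift (LinearMap.mk₂ K (fun l l' => TensorProduct.mk K V (V ⊗[K] (Sym L.toDGSpace)) l ∘ₗ
    lact L.toDGSpace l')
    (by intros; ext; simp)
    (by intros; ext; simp) (by intros; ext; simp [TensorProduct.tmul_add]) (by intros; ext; simp)) u

lemma Q'_tmul (l l' : V) (t : V ⊗[K] (Sym L.toDGSpace)) :
    Q' (l ⊗ₜ[K] l') t = l ⊗ₜ[K] lact L.toDGSpace l' t := by simp [Q']

/-- `v ⊗ a ↦ ± v ⊗ δ(x) a`. -/
def Q {i : ℤ} (x : V) : V ⊗[K] (Sym L.toDGSpace) →ₗ[K] V ⊗[K] (V ⊗[K] (Sym L.toDGSpace)) :=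
  TensorProduct.map (L.sgn i) (ract L.toDGSpace (L.cobr x))

lemma swap_Q {i : ℤ} {x : V} (hx : x ∈ L.gr i) (t : V ⊗[K] (Sym L.toDGSpace)) :
    L.swapLeft L.toDGSpace (Sym L.toDGSpace) (Q (L := L) (i := i) x t) = Q' (L := L) (L.cobr x) t := by
  have : ∀ u ∈ L.tensorGr L.toDGSpace i, L.swapLeft L.toDGSpace (Sym L.toDGSpace) ∘ₗ
      TensorProduct.map (L.sgn i) (ract L.toDGSpace u) = Q' (L := L) u := by
    intro u hu
    refine L.tensor_ext (toDGSpace L.toDGSpace) fun k n y hy a _ => ?_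
    simp only [LinearMap.comp_apply, TensorProduct.map_tmul, L.sgn_apply i hy]
    induction hu using Submodule.span_induction with
    | mem u hu =>
      obtain ⟨p, q, rfl, z, hz, w, hw, rfl⟩ := hu
      rw [ract_tmul, Q'_tmul, lact_tmul _ hw hy, ← TensorProduct.smul_tmul', map_smul,
        L.swapLeft_tmul _ hy hz, smul_smul, TensorProduct.tmul_smul]
      congr 1
      have : sg K ((p + q) * k) = sg K (q * k) * sg K (k * p) := by
        rw [← sg_add]; congr 1; ring
      rw [this, mul_assoc, sg_sq, mul_one]
    | zero => simp [Q']
    | add a b _ _ ha hb =>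
      simp only [map_add, LinearMap.add_apply, TensorProduct.tmul_add, ha, hb]
      simp [Q']
    | smul c a _ ha =>
      simp only [map_smul, LinearMap.smul_apply, TensorProduct.tmul_smul, ha]
      simp [Q']
  exact LinearMap.congr_fun (this _ (L.cobr_isHom.map_mem i x hx)) t

lemma swap_lact2 {i : ℤ} {x : V} (hx : x ∈ L.gr i) (t : V ⊗[K] (V ⊗[K] (Sym L.toDGSpace))) :
    L.swapLeft L.toDGSpace (Sym L.toDGSpace) (lact2 (L := L) (i := i) x t) =
      lact2 (L := L) (i := i) x (L.swapLeft L.toDGSpace (Sym L.toDGSpace) t) := by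
  have : L.swapLeft L.toDGSpace (Sym L.toDGSpace) ∘ₗ lact2 (L := L) (i := i) x =
      lact2 (L := L) (i := i) x ∘ₗ L.swapLeft L.toDGSpace (Sym L.toDGSpace) := by
    refine L.tensor_ext (L.tensor (toDGSpace L.toDGSpace)) fun k n y hy u hu => ?_
    simp only [LinearMap.comp_apply]
    induction hu using Submodule.span_induction with
    | mem u hu =>
      obtain ⟨p, q, rfl, z, hz, w, hw, rfl⟩ := hu
      rw [L.swapLeft_tmul _ hy hz, map_smul]
      simp only [lact2, TensorProduct.map_tmul, L.sgn_apply i hy, L.sgn_apply i hz,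
        lact_tmul _ hx hz, lact_tmul _ hx hy, ← TensorProduct.smul_tmul', map_smul,
        TensorProduct.tmul_smul, L.swapLeft_tmul _ hy hz, smul_smul]
      congr 1; ring
    | zero => simp
    | add a b _ _ ha hb => simp only [map_add, TensorProduct.tmul_add, ha, hb]
    | smul c a _ ha => simp only [map_smul, TensorProduct.tmul_smul, ha]
  exact LinearMap.congr_fun this t

/-- `((l ⊗ m) ⊗ n) ⊗ a ↦ l ⊗ (m ⊗ n a)`, for a tensor in `V ⊗ (V ⊗ V)`. -/
def ract2 (a : Sym L.toDGSpace) : V ⊗[K] (V ⊗[K] V) →ₗ[K] V ⊗[K] (V ⊗[K] (Sym L.toDGSpace)) :=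
  ((ract L.toDGSpace).flip a).lTensor V

lemma lTensor_lact {i : ℤ} {x : V} (hx : x ∈ L.gr i) (t : V ⊗[K] (Sym L.toDGSpace)) :
    (coact L).lTensor V (lact L.toDGSpace x t) =
      lact2 (L := L) (i := i) x ((coact L).lTensor V t) + Q (L := L) (i := i) x t := by
  rw [lact_eq hx]
  induction t using TensorProduct.induction_on with
  | zero => simp
  | tmul y a => simp [lact2, Q, coact_mul, TensorProduct.tmul_add]
  | add a b ha hb => simp only [map_add, ha, hb]; abel

lemma lTensor_ract (u : V ⊗[K] V) (a : Sym L.toDGSpace) :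
    (coact L).lTensor V (ract L.toDGSpace u a) =
      Q' (L := L) u (coact L a) + ract2 a (L.cobr.lTensor V u) := by
  induction u using TensorProduct.induction_on with
  | zero => simp [Q']
  | tmul y z => simp [ract_tmul, Q'_tmul, ract2, coact_mul, TensorProduct.tmul_add]
  | add p q hp hq =>
    simp only [map_add, LinearMap.add_apply, hp, hq]
    simp only [Q', map_add, LinearMap.add_apply]; abel

lemma assoc_lact {i : ℤ} {x : V} (hx : x ∈ L.gr i) (t : V ⊗[K] (Sym L.toDGSpace)) :
    TensorProduct.assoc K V V (Sym L.toDGSpace) (L.cobr.rTensor (Sym L.toDGSpace) (lact L.toDGSpace x t)) =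
      lact2 (L := L) (i := i) x (TensorProduct.assoc K V V (Sym L.toDGSpace) (L.cobr.rTensor (Sym L.toDGSpace) t)) := by
  have : (TensorProduct.assoc K V V (Sym L.toDGSpace)).toLinearMap ∘ₗ L.cobr.rTensor (Sym L.toDGSpace) ∘ₗ lact L.toDGSpace x =
      lact2 (L := L) (i := i) x ∘ₗ (TensorProduct.assoc K V V (Sym L.toDGSpace)).toLinearMap ∘ₗ
        L.cobr.rTensor (Sym L.toDGSpace) := by
    refine L.tensor_ext (toDGSpace L.toDGSpace) fun k n y hy a _ => ?_
    simp only [LinearMap.comp_apply, LinearEquiv.coe_coe, lact_tmul _ hx hy, map_smul,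
      LinearMap.rTensor_tmul]
    have hu := L.cobr_isHom.map_mem k y hy
    revert hu
    generalize L.cobr y = u
    intro hu
    induction hu using Submodule.span_induction with
    | mem u hu =>
      obtain ⟨p, q, rfl, z, hz, w, hw, rfl⟩ := hu
      simp only [TensorProduct.assoc_tmul, lact2, TensorProduct.map_tmul, L.sgn_apply i hz,
        lact_tmul _ hx hw, ← TensorProduct.smul_tmul', TensorProduct.tmul_smul, smul_smul]
      rw [← sg_add, mul_add, add_comm (i * q)]
    | zero => simp
    | add a b _ _ ha hb => simp only [map_add, TensorProduct.add_tmul, smul_add, ha, hb]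
    | smul c a _ ha =>
      simp only [map_smul, ← TensorProduct.smul_tmul', ← ha, smul_comm c]
  exact LinearMap.congr_fun this t

lemma assoc_ract (u : V ⊗[K] V) (a : Sym L.toDGSpace) :
    TensorProduct.assoc K V V (Sym L.toDGSpace) (L.cobr.rTensor (Sym L.toDGSpace) (ract L.toDGSpace u a)) =
      ract2 a (TensorProduct.assoc K V V V (L.cobr.rTensor V u)) := by
  induction u using TensorProduct.induction_on with
  | zero => simp
  | tmul y z =>
    rw [ract_tmul, LinearMap.rTensor_tmul, LinearMap.rTensor_tmul]
    generalize L.cobr y = w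
    induction w using TensorProduct.induction_on with
    | zero => simp
    | tmul p q => simp [ract2, ract_tmul]
    | add a b ha hb => simp only [map_add, TensorProduct.add_tmul, ha, hb]
  | add p q hp hq => simp only [map_add, LinearMap.add_apply, hp, hq]

lemma swap_ract2 (a : Sym L.toDGSpace) (t : V ⊗[K] (V ⊗[K] V)) :
    L.swapLeft L.toDGSpace (Sym L.toDGSpace) (ract2 (L := L) a t) =
      ract2 (L := L) a (L.swapLeft L.toDGSpace V t) := by
  have : L.swapLeft L.toDGSpace (Sym L.toDGSpace) ∘ₗ ract2 (L := L) a =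
      ract2 (L := L) a ∘ₗ L.swapLeft L.toDGSpace V := by
    refine L.tensor_ext (L.tensor L.toDGSpace) fun k n y hy u hu => ?_
    simp only [LinearMap.comp_apply]
    induction hu using Submodule.span_induction with
    | mem u hu =>
      obtain ⟨p, q, rfl, z, hz, w, hw, rfl⟩ := hu
      simp [ract2, ract_tmul, L.swapLeft_tmul _ hy hz]
    | zero => simp
    | add a b _ _ ha hb => simp only [map_add, TensorProduct.tmul_add, ha, hb]
    | smul c a _ ha => simp only [map_smul, TensorProduct.tmul_smul, ha]
  exact LinearMap.congr_fun this t

variable (L) in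
lemma coact_cobr (a : Sym L.toDGSpace) :
    TensorProduct.assoc K V V (Sym L.toDGSpace) (L.cobr.rTensor (Sym L.toDGSpace) (coact L a)) =
      (coact L).lTensor V (coact L a) -
        L.swapLeft L.toDGSpace (Sym L.toDGSpace) ((coact L).lTensor V (coact L a)) := by
  have : (TensorProduct.assoc K V V (Sym L.toDGSpace)).toLinearMap ∘ₗ L.cobr.rTensor (Sym L.toDGSpace) ∘ₗ coact L =
      (coact L).lTensor V ∘ₗ coact L -
        L.swapLeft L.toDGSpace (Sym L.toDGSpace) ∘ₗ (coact L).lTensor V ∘ₗ coact L := by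
    refine hom_ext _ (by simp [coact_one]) fun i x hx a ha => ?_
    simp only [LinearMap.comp_apply, LinearMap.sub_apply, LinearEquiv.coe_coe] at ha ⊢
    simp only [coact_mul, map_add]
    rw [assoc_lact hx, ha, assoc_ract, lTensor_lact hx, lTensor_ract, L.coJacobi]
    simp only [map_add, map_sub]
    have hQ' : L.swapLeft L.toDGSpace (Sym L.toDGSpace) (Q' (L := L) (L.cobr x) (coact L a)) =
        Q (L := L) (i := i) x (coact L a) := by
      rw [← swap_Q hx, swapLeft_swapLeft]
    rw [swap_lact2 hx, swap_Q hx, hQ', swap_ract2]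
    abel
  exact LinearMap.congr_fun this a

end Axiom

/-- The graded symmetric algebra on a dg Lie coalgebra, as a comodule over it. -/
def comodule : DGLieComodule L (Sym L.toDGSpace) where
  toDGSpace := toDGSpace L.toDGSpace
  coact := coact L
  coact_isHom := coact_isHom L
  coact_cobr := coact_cobr L

/-- The augmentation ideal of the graded symmetric algebra: as a vector space, the sum over `n ≥ 1`
of the coinvariants of the symmetric groups `Sₙ` acting, with Koszul signs, on `V^{⊗ n}`. -/
def Plus (X : DGSpace K V) : Submodule K (Sym X) := LinearMap.ker (aug X).toLinearMap

lemma toPlusAux_mem (X : DGSpace K V) (a : Sym X) : toPlusAux X a ∈ Plus X := by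
  simp [Plus, toPlusAux]

/-- The projection `a ↦ a - ε(a) 1` onto the augmentation ideal. -/
def toPlus (X : DGSpace K V) : Sym X →ₗ[K] Plus X := (toPlusAux X).codRestrict _ (toPlusAux_mem X)

lemma toPlus_coe (X : DGSpace K V) (a : Plus X) : toPlus X a = a := by
  have h : aug X a = 0 := a.2
  exact Subtype.ext (by simp [toPlus, toPlusAux, h])

lemma lTensor_toPlusAux (a : Sym L.toDGSpace) :
    (toPlusAux L.toDGSpace).lTensor V (coact L a) = coact L a := by
  have : (toPlusAux L.toDGSpace).lTensor V ∘ₗ coact L = coact L := by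
    refine hom_ext _ (by simp [coact_one]) fun i x hx a _ => ?_
    rw [LinearMap.comp_apply, coact_mul, map_add]
    congr 1
    · rw [lact_eq hx]
      generalize coact L a = t
      induction t using TensorProduct.induction_on with
      | zero => simp
      | tmul y b => simp [toPlusAux_mul]
      | add a b ha hb => simp only [map_add, ha, hb]
    · generalize L.cobr x = u
      induction u using TensorProduct.induction_on with
      | zero => simp
      | tmul y z => simp [ract_tmul, toPlusAux_mul]
      | add a b ha hb => simp only [map_add, LinearMap.add_apply, ha, hb]
  exact LinearMap.congr_fun this a

end Sym

/-- `Sym^c(L)` as an `L`-comodule. Its underlying dg vector space is the sum over `n ≥ 1` of the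
coinvariants of `Sₙ` on `L^{⊗ n}` (the composition product of the cooperad `coCom` with `L`),
realized as the augmentation ideal of the graded symmetric algebra, and its coaction is the
extension of the cobracket of `L` as a derivation. -/
def DGLieCoalgebra.symc {K : Type u} [Field K] {V : Type v} [AddCommGroup V] [Module K V]
    (L : DGLieCoalgebra K V) : DGLieComodule L (Sym.Plus L.toDGSpace) :=
  (Sym.comodule L).sub (Sym.Plus L.toDGSpace) (Sym.toPlus L.toDGSpace)
    (Sym.toPlus_coe L.toDGSpace) (Sym.toPlusAux_isHom L.toDGSpace)
    fun x => Sym.lTensor_toPlusAux L x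

/-- The coaction of `Sym^c(L)` is the restriction of the derivation `Sym.coact`. -/
lemma DGLieCoalgebra.symc_coact {K : Type u} [Field K] {V : Type v} [AddCommGroup V] [Module K V]
    (L : DGLieCoalgebra K V) (a : Sym.Plus L.toDGSpace) :
    (Sym.Plus L.toDGSpace).subtype.lTensor V (L.symc.coact a) = Sym.coact L a :=
  (Sym.comodule L).sub_coact _ _ (Sym.toPlus_coe L.toDGSpace) (Sym.toPlusAux_isHom L.toDGSpace)
    (fun x => Sym.lTensor_toPlusAux L x) a

/-- An isomorphism of dg comodules: a linear equivalence that is a morphism of dg vector spaces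
(and then so is its inverse) and commutes with the coactions. -/
structure DGLieComodule.Iso {K : Type u} [Field K] {V : Type v} [AddCommGroup V] [Module K V]
    {L : DGLieCoalgebra K V} {M : Type*} [AddCommGroup M] [Module K M] {N : Type*}
    [AddCommGroup N] [Module K N] (R : DGLieComodule L M) (T : DGLieComodule L N) where
  equiv : M ≃ₗ[K] N
  isHom : R.toDGSpace.IsHom T.toDGSpace equiv.toLinearMap
  coact_equiv : ∀ m : M, T.coact (equiv m) = equiv.toLinearMap.lTensor V (R.coact m)

/-- `U`, together with `p : U → L`, is the universal enveloping conilpotent coalgebra of the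
dg Lie coalgebra `L`: it is the value at `L` of the right adjoint of the functor from conilpotent
dg coalgebras to dg Lie coalgebras given by the cocommutator, and `p` is the counit. -/
structure IsUniversalEnveloping {K : Type u} [Field K] {V : Type v} [AddCommGroup V] [Module K V]
    (L : DGLieCoalgebra K V) {C : Type w} [AddCommGroup C] [Module K C] (U : DGCoalgebra K C)
    (p : C →ₗ[K] V) : Prop where
  conilpotent : Conilpotent U.comul
  isHom : U.toLie.IsHom L p
  existsUnique : ∀ (D : Type w) [AddCommGroup D] [Module K D] (B : DGCoalgebra K D),
    Conilpotent B.comul → ∀ f : D →ₗ[K] V, B.toLie.IsHom L f →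
      ∃! g : D →ₗ[K] C, B.IsHom U g ∧ p ∘ₗ g = f

/-- A universal enveloping coalgebra `p : U → L` as an `L`-comodule: the cocommutator makes `U` a
comodule over itself, hence over `L` along `p`. The coaction is `(p ⊗ 1) (Δ - τ Δ)`, dual to the
adjoint action of a Lie algebra on its universal enveloping algebra. -/
def IsUniversalEnveloping.comodule {K : Type u} [Field K] {V : Type v} [AddCommGroup V]
    [Module K V] {L : DGLieCoalgebra K V} {C : Type w} [AddCommGroup C] [Module K C]
    {U : DGCoalgebra K C} {p : C →ₗ[K] V} (h : IsUniversalEnveloping L U p) : DGLieComodule L C :=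
  U.toLie.adjoint.push h.isHom

end DGCo

end

/-! The cofree conilpotent coalgebra on L is the space of words in L with deconcatenation. Let τ_i
be the signed exchange of the letters i and i + 1 of a word (counted from 0), and let δ_i be the
cobracket applied to the letter i. Inside the words, `envelope L` consists of the tensors w = ∑ w_n
without constant term such that (1 − τ_i) w_{n+1} = δ_i w_n for all n and i. This is dual to the
presentation of an enveloping algebra by the relations xy ∓ yx = [x, y].

Universal property. A coalgebra morphism g from a conilpotent C to the words is determined by its
one-letter part f through the recursion g = f + (f ⊗ g)Δ, which has a unique solution by
conilpotency. If f respects the cobrackets, the recursion forces the image of g into the envelope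
(`cond_eq_zero`). Conversely, the two-letter part of the conditions says that the projection of the
envelope to L is a Lie morphism (`envelopingProj_isHom`). Hence `enveloping_isUniversal`.

Isomorphism. The map is the restriction to the envelope of the quotient map from words to the
symmetric algebra. It is injective because the lowest nonzero component of an element of the
envelope is invariant under all τ_i, and in characteristic zero invariants inject into coinvariants
(`eq_zero_of_antisymm_of_toSym`). For surjectivity, a symmetric tensor w_n has to be completed by
w_{n+1}, w_{n+2}, … . To solve (1 − τ_i) w_{n+1} = δ_i w_n means to write a family indexed by the
adjacent transpositions as a coboundary of a symmetric group. The family is a cocycle by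
antisymmetry, co-Jacobi and the equations already solved (`cobrAt_cocycle`), and the first
cohomology vanishes in characteristic zero (`CoxeterOn.exists_primitive`). The solutions can be
taken in the kernel of the map to the symmetric algebra, so the image does not change. The process
stops because L is conilpotent: if a letter killed by k iterates of δ weighs 2^k, then neither τ_i
nor δ_i raises the weight, while weight bounds length (`exists_cond_eq_cobrAt`).

Coaction. After projection to L ⊗ Sym L, the cocommutator of a word is its first letter split off
minus its last letter moved to the front. On the envelope the difference telescopes: each exchange
of neighbours costs one δ_i, and the sum of these is the derivation that extends δ
(`coactDefect_eq_zero`). An arbitrary universal enveloping coalgebra is compared with this one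
through the universal property. -/

noncomputable section

open scoped TensorProduct DirectSum

namespace DGCo

/-! ### Linear algebra over a field: tensors and their slices. -/

section LinearAlgebra

variable {K : Type u} [Field K] {M : Type*} [AddCommGroup M] [Module K M]
variable {N : Type*} [AddCommGroup N] [Module K N] {N' : Type*} [AddCommGroup N'] [Module K N']

/-- Functionals on the second factor separate the points of a tensor product. -/
lemma eq_zero_of_lTensor_functional (t : M ⊗[K] N) (h : ∀ φ : N →ₗ[K] K, φ.lTensor M t = 0) :
    t = 0 := by
  classical
  let b := Module.Basis.ofVectorSpace K N
  refine (TensorProduct.equivFinsuppOfBasisRight (M := M) b).injective (Finsupp.ext fun i => ?_)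
  have key : Finsupp.lapply i ∘ₗ (TensorProduct.equivFinsuppOfBasisRight (M := M) b).toLinearMap =
      (TensorProduct.rid K M).toLinearMap ∘ₗ (b.coord i).lTensor M := by
    refine TensorProduct.ext' fun x y => ?_
    simp
  have := LinearMap.congr_fun key t
  simpa [h] using this

lemma exists_retract (S : Submodule K M) : ∃ P : M →ₗ[K] S, ∀ x : S, P x = x := by
  obtain ⟨P, hP⟩ := S.subtype.exists_leftInverse_of_injective S.ker_subtype
  exact ⟨P, fun x => LinearMap.congr_fun hP x⟩

/-- The slice `(1 ⊗ φ) t` of a tensor. -/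
def rslice (φ : N →ₗ[K] K) : M ⊗[K] N →ₗ[K] M :=
  (TensorProduct.rid K M).toLinearMap ∘ₗ φ.lTensor M

@[simp] lemma rslice_tmul (φ : N →ₗ[K] K) (x : M) (y : N) :
    rslice φ (x ⊗ₜ[K] y) = φ y • x := by simp [rslice]

lemma rslice_rTensor (φ : N →ₗ[K] K) (f : M →ₗ[K] N') (t : M ⊗[K] N) :
    rslice φ (f.rTensor N t) = f (rslice φ t) := by
  have : rslice φ ∘ₗ f.rTensor N = f ∘ₗ rslice φ :=
    TensorProduct.ext' fun x y => by simp
  exact LinearMap.congr_fun this t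

lemma rslice_comm_lTensor (φ : M →ₗ[K] K) (f : N →ₗ[K] N') (z : M ⊗[K] N) :
    rslice φ (TensorProduct.comm K M N' (f.lTensor M z)) =
      f (rslice φ (TensorProduct.comm K M N z)) := by
  have : rslice φ ∘ₗ (TensorProduct.comm K M N').toLinearMap ∘ₗ f.lTensor M =
      f ∘ₗ rslice φ ∘ₗ (TensorProduct.comm K M N).toLinearMap :=
    TensorProduct.ext' fun a b => by simp
  exact LinearMap.congr_fun this z

lemma rslice_ext {s t : M ⊗[K] N} (h : ∀ φ : N →ₗ[K] K, rslice φ s = rslice φ t) : s = t := by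
  rw [← sub_eq_zero]
  refine eq_zero_of_lTensor_functional _ fun φ => (TensorProduct.rid K M).injective ?_
  have := h φ
  rw [← sub_eq_zero, ← map_sub] at this
  simpa [rslice] using this

/-- A tensor all of whose slices are in `S` is a tensor over `S`. -/
lemma rTensor_retract_eq {S : Submodule K M} {P : M →ₗ[K] S} (hP : ∀ x : S, P x = x)
    {t : M ⊗[K] N} (h : ∀ φ : N →ₗ[K] K, rslice φ t ∈ S) :
    (S.subtype ∘ₗ P).rTensor N t = t := by
  refine rslice_ext fun φ => ?_
  rw [rslice_rTensor, LinearMap.comp_apply]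
  exact congrArg Subtype.val (hP ⟨_, h φ⟩)

lemma lTensor_retract_eq {S : Submodule K M} {P : M →ₗ[K] S} (hP : ∀ x : S, P x = x)
    {t : N ⊗[K] M} (h : ∀ φ : N →ₗ[K] K, rslice φ (TensorProduct.comm K N M t) ∈ S) :
    (S.subtype ∘ₗ P).lTensor N t = t := by
  apply (TensorProduct.comm K N M).injective
  rw [← rTensor_retract_eq hP h]
  have : (TensorProduct.comm K N M).toLinearMap ∘ₗ (S.subtype ∘ₗ P).lTensor N =
      (S.subtype ∘ₗ P).rTensor N ∘ₗ (TensorProduct.comm K N M).toLinearMap :=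
    TensorProduct.ext' fun x y => by simp
  exact LinearMap.congr_fun this t

/-- A linear projection onto S fixes t because it fixes every slice of t. Through this criterion
membership in N ⊗ S is reduced to membership of vectors in S. -/
lemma mem_range_lTensor_of_slices {S : Submodule K M} {t : N ⊗[K] M}
    (h : ∀ φ : N →ₗ[K] K, rslice φ (TensorProduct.comm K N M t) ∈ S) :
    t ∈ LinearMap.range (S.subtype.lTensor N) := by
  obtain ⟨P, hP⟩ := exists_retract S
  rw [← lTensor_retract_eq hP h, LinearMap.lTensor_comp]
  exact ⟨_, rfl⟩

lemma retract_lTensor_of_mem_range {S : Submodule K M} {P : M →ₗ[K] S} (hP : ∀ x : S, P x = x)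
    {t : N ⊗[K] M} (h : t ∈ LinearMap.range (S.subtype.lTensor N)) :
    (S.subtype ∘ₗ P).lTensor N t = t := by
  obtain ⟨s, rfl⟩ := h
  rw [← LinearMap.comp_apply, ← LinearMap.lTensor_comp]
  congr 2
  ext x
  simp [hP]

lemma retract_rTensor_of_mem_range {S : Submodule K M} {P : M →ₗ[K] S} (hP : ∀ x : S, P x = x)
    {t : M ⊗[K] N} (h : t ∈ LinearMap.range (S.subtype.rTensor N)) :
    (S.subtype ∘ₗ P).rTensor N t = t := by
  obtain ⟨s, rfl⟩ := h
  rw [← LinearMap.comp_apply, ← LinearMap.rTensor_comp]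
  congr 2
  ext x
  simp [hP]

lemma comm_slice_mem_of_mem_range {S : Submodule K M} {t : N ⊗[K] M}
    (h : t ∈ LinearMap.range (S.subtype.lTensor N)) (φ : N →ₗ[K] K) :
    rslice φ (TensorProduct.comm K N M t) ∈ S := by
  obtain ⟨s, rfl⟩ := h
  induction s using TensorProduct.induction_on with
  | zero => simp
  | tmul x y => simpa using S.smul_mem _ y.2
  | add a b ha hb => simp only [map_add]; exact add_mem ha hb

lemma range_lTensor_mono {S S' : Submodule K M} (h : S ≤ S') :
    LinearMap.range (S.subtype.lTensor N) ≤ LinearMap.range (S'.subtype.lTensor N) := by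
  rintro _ ⟨t, rfl⟩
  refine ⟨(Submodule.inclusion h).lTensor N t, ?_⟩
  rw [← LinearMap.comp_apply, ← LinearMap.lTensor_comp]
  rfl

lemma lTensor_congr_of_mem_range {S : Submodule K M} {t : N ⊗[K] M}
    (h : t ∈ LinearMap.range (S.subtype.lTensor N)) {f g : M →ₗ[K] N'}
    (hfg : ∀ x ∈ S, f x = g x) : f.lTensor N t = g.lTensor N t := by
  obtain ⟨s, rfl⟩ := h
  rw [← LinearMap.comp_apply, ← LinearMap.comp_apply, ← LinearMap.lTensor_comp,
    ← LinearMap.lTensor_comp]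
  congr 2
  ext x
  exact hfg x x.2

lemma lTensor_mem_range {S : Submodule K M} {S' : Submodule K N'} {t : N ⊗[K] M}
    (h : t ∈ LinearMap.range (S.subtype.lTensor N)) {P : Type*} [AddCommGroup P] [Module K P]
    (g : N →ₗ[K] P) {f : M →ₗ[K] N'}
    (hf : ∀ x ∈ S, f x ∈ S') :
    TensorProduct.map g f t ∈ LinearMap.range (S'.subtype.lTensor P) := by
  obtain ⟨s, rfl⟩ := h
  refine ⟨TensorProduct.map g (f.restrict hf) s, ?_⟩
  induction s using TensorProduct.induction_on with
  | zero => simp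
  | tmul x y => simp
  | add a b ha hb => simp only [map_add, ha, hb]

end LinearAlgebra

/-! ### The coradical filtration and recursion along it. -/

section Coradical

variable {K : Type u} [Field K] {C : Type v} [AddCommGroup C] [Module K C]
variable {μ : C →ₗ[K] C ⊗[K] C} {N : Type*} [AddCommGroup N] [Module K N]

lemma coradical_le_succ (n : ℕ) : coradical μ n ≤ coradical μ (n + 1) := by
  induction n with
  | zero => exact bot_le
  | succ n ih => exact Submodule.comap_mono (range_lTensor_mono ih)

lemma coradical_mono : Monotone (coradical μ) := monotone_nat_of_le_succ coradical_le_succ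

lemma mem_coradical_succ {n : ℕ} {x : C} :
    x ∈ coradical μ (n + 1) ↔ μ x ∈ LinearMap.range ((coradical μ n).subtype.lTensor C) := Iff.rfl

/-- The approximations of the solution of `g x = a x + b ((1 ⊗ g) μ x)`. -/
def recApprox (μ : C →ₗ[K] C ⊗[K] C) (a : C →ₗ[K] N) (b : C ⊗[K] N →ₗ[K] N) : ℕ → C →ₗ[K] N
  | 0 => 0
  | n + 1 => a + b ∘ₗ (recApprox μ a b n).lTensor C ∘ₗ μ

/-- Each application of μ lowers the filtration level of the second factor by one, so at level n
nothing changes after n stages. The approximations therefore converge pointwise when μ is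
conilpotent. -/
lemma recApprox_eq (a : C →ₗ[K] N) (b : C ⊗[K] N →ₗ[K] N) {n m : ℕ} (h : n ≤ m) {x : C}
    (hx : x ∈ coradical μ n) : recApprox μ a b m x = recApprox μ a b n x := by
  induction n generalizing m x with
  | zero =>
    have : x = 0 := hx
    simp [this]
  | succ n ih =>
    obtain ⟨m, rfl⟩ : ∃ k, m = k + 1 := ⟨m - 1, by omega⟩
    have := lTensor_congr_of_mem_range (mem_coradical_succ.1 hx)
      (f := recApprox μ a b m) (g := recApprox μ a b n) fun y hy => ih (by omega) hy
    simp [recApprox, this]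

lemma Conilpotent.exists_eventually_recApprox (hμ : Conilpotent μ) (a : C →ₗ[K] N)
    (b : C ⊗[K] N →ₗ[K] N) :
    ∃ g : C →ₗ[K] N, ∀ x, ∃ n, ∀ m ≥ n, g x = recApprox μ a b m x := by
  choose k hk using hμ
  have key : ∀ x m, k x ≤ m → recApprox μ a b (k x) x = recApprox μ a b m x :=
    fun x m h => (recApprox_eq a b h (hk x)).symm
  refine ⟨{ toFun := fun x => recApprox μ a b (k x) x, map_add' := ?_, map_smul' := ?_ },
    fun x => ⟨k x, key x⟩⟩
  -- The chosen stage depends on the vector, so additivity is read off at one stage beyond all three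
  -- choices.
  · intro x y
    have h1 := key x (k x + k y + k (x + y)) (by omega)
    have h2 := key y (k x + k y + k (x + y)) (by omega)
    have h3 := key (x + y) (k x + k y + k (x + y)) (by omega)
    simp only [h1, h2, h3, map_add]
  · intro c x
    have h1 := key x (k x + k (c • x)) (by omega)
    have h3 := key (c • x) (k x + k (c • x)) (by omega)
    simp only [h1, h3, map_smul, RingHom.id_apply]

lemma Conilpotent.recApprox_limit (hμ : Conilpotent μ) {a : C →ₗ[K] N} {b : C ⊗[K] N →ₗ[K] N}
    {g : C →ₗ[K] N} (hg : ∀ x, ∃ n, ∀ m ≥ n, g x = recApprox μ a b m x) (x : C) :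
    g x = a x + b (g.lTensor C (μ x)) := by
  have hg' : ∀ n, ∀ x ∈ coradical μ n, g x = recApprox μ a b n x := by
    intro n x hx
    obtain ⟨m, hm⟩ := hg x
    rw [hm (max m n) (le_max_left _ _), recApprox_eq a b (le_max_right _ _) hx]
  obtain ⟨n, hn⟩ := hμ x
  have h1 := mem_coradical_succ.1 (coradical_le_succ n hn)
  rw [hg' _ _ (coradical_le_succ n hn), lTensor_congr_of_mem_range h1 (hg' n)]
  rfl

/-- Conilpotent induction. -/
lemma Conilpotent.induction (hμ : Conilpotent μ) {S : Submodule K C}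
    (h : ∀ x, μ x ∈ LinearMap.range (S.subtype.lTensor C) → x ∈ S) (x : C) : x ∈ S := by
  have key : ∀ n, coradical μ n ≤ S := by
    intro n
    induction n with
    | zero => exact bot_le
    | succ n ih => exact fun x hx => h x (range_lTensor_mono ih (mem_coradical_succ.1 hx))
  obtain ⟨n, hn⟩ := hμ x
  exact key n hn

/-- The locus where two solutions agree is closed under the step of conilpotent induction. This is
the source of uniqueness in the universal property. -/
lemma Conilpotent.rec_unique (hμ : Conilpotent μ) {a : C →ₗ[K] N} {b : C ⊗[K] N →ₗ[K] N}
    {g g' : C →ₗ[K] N} (hg : ∀ x, g x = a x + b (g.lTensor C (μ x)))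
    (hg' : ∀ x, g' x = a x + b (g'.lTensor C (μ x))) : g = g' := by
  refine LinearMap.ext fun x => hμ.induction (S := LinearMap.eqLocus g g') (fun x hx => ?_) x
  rw [LinearMap.mem_eqLocus, hg, hg', lTensor_congr_of_mem_range hx fun y hy => hy]

end Coradical

/-! ### Morphisms and subspaces of dg vector spaces. -/

namespace DGSpace

variable {K : Type u} [Field K]
variable {V : Type v} [AddCommGroup V] [Module K V] {W : Type w} [AddCommGroup W] [Module K W]
variable {V' : Type*} [AddCommGroup V'] [Module K V'] {W' : Type*} [AddCommGroup W'] [Module K W']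
variable {X : DGSpace K V} {Y : DGSpace K W} {Z : DGSpace K V'}

lemma proj_mem (n : ℤ) (x : V) : X.proj n x ∈ X.gr n := by
  have : (X.gr n).mkQ ∘ₗ X.proj n = 0 := by
    refine X.hom_ext fun i x hx => ?_
    by_cases h : i = n
    · subst h; simpa [X.proj_same hx] using hx
    · simp [X.proj_ne h hx]
  simpa using LinearMap.congr_fun this x

lemma mem_gr_iff {n : ℤ} {x : V} : x ∈ X.gr n ↔ X.proj n x = x :=
  ⟨X.proj_same, fun h => h ▸ proj_mem n x⟩

lemma IsHom.map_proj {f : V →ₗ[K] W} (hf : X.IsHom Y f) (n : ℤ) (x : V) :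
    f (X.proj n x) = Y.proj n (f x) := by
  have : f ∘ₗ X.proj n = Y.proj n ∘ₗ f := by
    refine X.hom_ext fun i x hx => ?_
    by_cases h : i = n
    · subst h; simp [X.proj_same hx, Y.proj_same (hf.map_mem _ _ hx)]
    · simp [X.proj_ne h hx, Y.proj_ne h (hf.map_mem _ _ hx)]
  exact LinearMap.congr_fun this x

lemma IsHom.map_sgn {f : V →ₗ[K] W} (hf : X.IsHom Y f) (k : ℤ) (x : V) :
    f (X.sgn k x) = Y.sgn k (f x) := by
  have : f ∘ₗ X.sgn k = Y.sgn k ∘ₗ f :=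
    X.hom_ext fun i x hx => by simp [X.sgn_apply k hx, Y.sgn_apply k (hf.map_mem _ _ hx)]
  exact LinearMap.congr_fun this x

lemma sgn_tensor (k : ℤ) (t : V ⊗[K] W) :
    (X.tensor Y).sgn k t = TensorProduct.map (X.sgn k) (Y.sgn k) t := by
  have : (X.tensor Y).sgn k = TensorProduct.map (X.sgn k) (Y.sgn k) := by
    refine X.tensor_ext Y fun i j x hx y hy => ?_
    rw [(X.tensor Y).sgn_apply k (tmul_mem hx hy), TensorProduct.map_tmul, X.sgn_apply k hx,
      Y.sgn_apply k hy, TensorProduct.smul_tmul_smul, mul_add, sg_add]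
  exact LinearMap.congr_fun this t

/-- Homogeneity of degree n means being fixed by the projection to degree n, and morphisms commute
with these projections. -/
lemma IsHom.mem_of_injective {f : V →ₗ[K] W} (hf : X.IsHom Y f) (hi : Function.Injective f)
    {n : ℤ} {x : V} (hx : f x ∈ Y.gr n) : x ∈ X.gr n := by
  rw [mem_gr_iff] at hx ⊢
  exact hi (by rw [hf.map_proj, hx])

lemma IsHom.of_comp_injective {f : V →ₗ[K] W} {g : W →ₗ[K] V'} (hg : Y.IsHom Z g)
    (hi : Function.Injective g) (h : X.IsHom Z (g ∘ₗ f)) : X.IsHom Y f :=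
  ⟨fun i x hx => hg.mem_of_injective hi (h.map_mem i x hx),
    fun x => hi (by rw [hg.map_d]; exact h.map_d x)⟩

lemma IsHom.add {f g : V →ₗ[K] W} (hf : X.IsHom Y f) (hg : X.IsHom Y g) : X.IsHom Y (f + g) :=
  ⟨fun i x hx => add_mem (hf.map_mem i _ hx) (hg.map_mem i x hx),
    fun x => by simp [hf.map_d, hg.map_d]⟩

lemma IsHom.zero : X.IsHom Y (0 : V →ₗ[K] W) :=
  ⟨fun i x _ => by simp, fun x => by simp⟩

variable (X Y Z) in
lemma assoc_isHom : ((X.tensor Y).tensor Z).IsHom (X.tensor (Y.tensor Z))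
    (TensorProduct.assoc K V W V').toLinearMap := by
  refine isHom_of_tmul (fun i j t ht z hz => ?_) (fun i j t ht z hz => ?_)
  · induction ht using Submodule.span_induction with
    | mem t ht =>
      obtain ⟨a, b, rfl, x, hx, y, hy, rfl⟩ := ht
      exact tmul_mem' (j := b + j) (by ring) hx (tmul_mem hy hz)
    | zero => simp
    | add a b _ _ ha hb => rw [TensorProduct.add_tmul, map_add]; exact add_mem ha hb
    | smul c a _ ha => rw [← TensorProduct.smul_tmul', map_smul]; exact Submodule.smul_mem _ _ ha
  · have hd : ∀ s, (X.tensor Y).d s = X.tensorD Y s := fun _ => rfl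
    have hd' : ∀ s, (X.tensor (Y.tensor Z)).d s = X.tensorD (Y.tensor Z) s := fun _ => rfl
    have hd'' : ∀ s, (Y.tensor Z).d s = Y.tensorD Z s := fun _ => rfl
    induction ht using Submodule.span_induction with
    | mem t ht =>
      obtain ⟨a, b, rfl, x, hx, y, hy, rfl⟩ := ht
      simp only [hd, hd', X.tensorD_tmul Y hx, LinearEquiv.coe_coe, TensorProduct.add_tmul,
        map_add, TensorProduct.assoc_tmul, ← TensorProduct.smul_tmul', map_smul,
        X.tensorD_tmul _ hx, hd'', Y.tensorD_tmul Z hy, TensorProduct.tmul_add,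
        TensorProduct.tmul_smul, smul_add, smul_smul, sg_add, add_assoc]
    | zero => simp
    | add a b _ _ ha hb =>
      simp only [TensorProduct.add_tmul, map_add, smul_add, ← ha, ← hb]; abel
    | smul c a _ ha =>
      simp only [← TensorProduct.smul_tmul', map_smul, ← ha, smul_add, smul_comm c]

lemma IsHom.symm {f : V ≃ₗ[K] W} (hf : X.IsHom Y f.toLinearMap) :
    Y.IsHom X f.symm.toLinearMap := by
  refine hf.of_comp_injective f.injective ?_
  have : f.toLinearMap ∘ₗ f.symm.toLinearMap = LinearMap.id := by ext; simp
  rw [this]; exact .id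

variable (X Y Z) in
lemma swapLeft_isHom : (X.tensor (Y.tensor Z)).IsHom (Y.tensor (X.tensor Z))
    (X.swapLeft Y V') :=
  (assoc_isHom Y X Z).comp (((X.swap_isHom Y).tensor IsHom.id).comp (assoc_isHom X Y Z).symm)

/-- The dg structure on a subspace that is stable under the projections and the differential. -/
def restrict (X : DGSpace K V) (S : Submodule K V) (hp : ∀ n, ∀ x ∈ S, X.proj n x ∈ S)
    (hd : ∀ x ∈ S, X.d x ∈ S) : DGSpace K S where
  gr n := (X.gr n).comap S.subtype
  internal := by
    have key : ∀ n, ∀ x : S, (X.proj n).restrict (hp n) x ∈ (X.gr n).comap S.subtype :=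
      fun n x => proj_mem n _
    refine isInternal_of_proj _ ?_ (fun n => (X.proj n).restrict (hp n)) ?_ ?_
    · rw [eq_top_iff]
      rintro x -
      obtain ⟨P, hP⟩ := exists_retract S
      have hx : (x : V) ∈ ⨆ i, X.gr i := by rw [X.iSup_gr]; trivial
      obtain ⟨f, hf, hs⟩ := (Submodule.mem_iSup_iff_exists_finsupp _ _).1 hx
      have hproj : ∀ n, X.proj n x = f n := by
        intro n
        rw [← hs, Finsupp.sum, map_sum]
        rw [Finset.sum_eq_single n (fun m _ hm => X.proj_ne hm (hf m))
          (fun hn => by simp [Finsupp.notMem_support_iff.1 hn])]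
        exact X.proj_same (hf n)
      have : x = ∑ n ∈ f.support, (X.proj n).restrict (hp n) x := by
        apply Subtype.ext
        rw [← hs, Finsupp.sum, Submodule.coe_sum]
        refine Finset.sum_congr rfl fun n _ => ?_
        exact (hproj n).symm
      rw [this]
      exact Submodule.sum_mem _ fun n _ => Submodule.mem_iSup_of_mem n (key n x)
    · intro n x hx
      exact Subtype.ext (X.proj_same hx)
    · intro m n hmn x hx
      exact Subtype.ext (X.proj_ne hmn hx)
  d := X.d.restrict hd
  d_mem i x hx := X.d_mem i x hx
  d_d x := Subtype.ext (X.d_d x)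

lemma restrict_incl (X : DGSpace K V) (S : Submodule K V) (hp : ∀ n, ∀ x ∈ S, X.proj n x ∈ S)
    (hd : ∀ x ∈ S, X.d x ∈ S) : (X.restrict S hp hd).IsHom X S.subtype :=
  ⟨fun _ _ hx => hx, fun _ => rfl⟩

end DGSpace

open DGSpace

/-! ### Subcoalgebras detected by slices. -/

section SubCoalgebra

variable {K : Type u} [Field K] {C : Type v} [AddCommGroup C] [Module K C]
variable {D : Type w} [AddCommGroup D] [Module K D]

lemma map_subtype_injective (S : Submodule K C) :
    Function.Injective (TensorProduct.map S.subtype S.subtype) := by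
  obtain ⟨P, hP⟩ := exists_retract S
  have h : TensorProduct.map P P ∘ₗ TensorProduct.map S.subtype S.subtype = LinearMap.id := by
    rw [← TensorProduct.map_comp]
    have : P ∘ₗ S.subtype = LinearMap.id := LinearMap.ext hP
    rw [this, TensorProduct.map_id]
  exact Function.LeftInverse.injective (g := TensorProduct.map P P) fun t => LinearMap.congr_fun h t

/-- A graded subspace, stable under the differential, both of whose slices of the coproduct stay in
it. -/
structure DGCoalgebra.IsSub (A : DGCoalgebra K C) (S : Submodule K C) : Prop where
  proj_mem : ∀ n, ∀ x ∈ S, A.proj n x ∈ S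
  d_mem : ∀ x ∈ S, A.d x ∈ S
  left : ∀ x ∈ S, ∀ φ : C →ₗ[K] K, rslice φ (A.comul x) ∈ S
  right : ∀ x ∈ S, ∀ φ : C →ₗ[K] K, rslice φ (TensorProduct.comm K C C (A.comul x)) ∈ S

namespace DGCoalgebra.IsSub

variable {A : DGCoalgebra K C} {S : Submodule K C} (h : A.IsSub S)

/-- Both families of slices lie in S, so a projection P onto S fixes Δx in either factor, and (P ⊗
P)Δx still represents Δx. -/
lemma exists_comul (h : A.IsSub S) : ∃ μ : S →ₗ[K] S ⊗[K] S,
    ∀ x, TensorProduct.map S.subtype S.subtype (μ x) = A.comul x := by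
  obtain ⟨P, hP⟩ := exists_retract S
  refine ⟨TensorProduct.map P P ∘ₗ A.comul ∘ₗ S.subtype, fun x => ?_⟩
  have e1 := rTensor_retract_eq hP (h.left x x.2)
  have e2 := lTensor_retract_eq hP (h.right x x.2)
  rw [LinearMap.comp_apply, ← LinearMap.comp_apply, ← TensorProduct.map_comp]
  change TensorProduct.map (S.subtype ∘ₗ P) (S.subtype ∘ₗ P) (A.comul x) = _
  rw [← LinearMap.lTensor_comp_rTensor, LinearMap.comp_apply, e1, e2]

/-- The coproduct of a subcoalgebra. -/
def comul : S →ₗ[K] S ⊗[K] S := h.exists_comul.choose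

lemma map_comul (x : S) : TensorProduct.map S.subtype S.subtype (h.comul x) = A.comul x :=
  h.exists_comul.choose_spec x

/-- A subcoalgebra as a dg coalgebra. -/
def toDGCoalgebra : DGCoalgebra K S where
  toDGSpace := A.toDGSpace.restrict S h.proj_mem h.d_mem
  comul := h.comul
  comul_isHom := by
    have hi := A.toDGSpace.restrict_incl S h.proj_mem h.d_mem
    refine (hi.tensor hi).of_comp_injective (map_subtype_injective S) ?_
    have : TensorProduct.map S.subtype S.subtype ∘ₗ h.comul = A.comul ∘ₗ S.subtype :=
      LinearMap.ext h.map_comul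
    rw [this]
    exact A.comul_isHom.comp hi
  coassoc := by
    intro x
    obtain ⟨P, hP⟩ := exists_retract S
    have hinj : Function.Injective
        (TensorProduct.map S.subtype (TensorProduct.map S.subtype S.subtype)) := by
      have hh : TensorProduct.map P (TensorProduct.map P P) ∘ₗ
          TensorProduct.map S.subtype (TensorProduct.map S.subtype S.subtype) =
          LinearMap.id := by
        have : P ∘ₗ S.subtype = LinearMap.id := LinearMap.ext hP
        simp only [← TensorProduct.map_comp, this, TensorProduct.map_id]
      exact Function.LeftInverse.injective (g := TensorProduct.map P (TensorProduct.map P P))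
        fun t => LinearMap.congr_fun hh t
    apply hinj
    have e1 : ∀ t : S ⊗[K] S, TensorProduct.map S.subtype (TensorProduct.map S.subtype S.subtype)
        (TensorProduct.assoc K S S S (h.comul.rTensor S t)) =
        TensorProduct.assoc K C C C (A.comul.rTensor C
          (TensorProduct.map S.subtype S.subtype t)) := by
      intro t
      induction t using TensorProduct.induction_on with
      | zero => simp
      | tmul a b =>
        simp only [LinearMap.rTensor_tmul, TensorProduct.map_tmul, Submodule.subtype_apply]
        rw [← h.map_comul]
        generalize h.comul a = s
        induction s using TensorProduct.induction_on with
        | zero => simp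
        | tmul a b => simp
        | add a b ha hb => simp only [map_add, TensorProduct.add_tmul, ha, hb]
      | add a b ha hb => simp only [map_add, ha, hb]
    have e2 : ∀ t : S ⊗[K] S, TensorProduct.map S.subtype (TensorProduct.map S.subtype S.subtype)
        (h.comul.lTensor S t) =
        A.comul.lTensor C (TensorProduct.map S.subtype S.subtype t) := by
      intro t
      induction t using TensorProduct.induction_on with
      | zero => simp
      | tmul a b => simp [h.map_comul]
      | add a b ha hb => simp only [map_add, ha, hb]
    rw [e1, e2, h.map_comul, A.coassoc]

lemma incl_isHom : h.toDGCoalgebra.IsHom A S.subtype where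
  toIsHom := A.toDGSpace.restrict_incl S h.proj_mem h.d_mem
  map_comul x := (h.map_comul x).symm

/-- An element of S at level n of the filtration of A is also at level n of the filtration of the
subcoalgebra. -/
lemma conilpotent (hA : Conilpotent A.comul) : Conilpotent h.toDGCoalgebra.comul := by
  obtain ⟨P, hP⟩ := exists_retract S
  have key : ∀ n, ∀ x : S, (x : C) ∈ coradical A.comul n →
      x ∈ coradical h.toDGCoalgebra.comul n := by
    intro n
    induction n with
    | zero => exact fun x hx => Subtype.ext hx
    | succ n ih =>
      intro x hx
      rw [mem_coradical_succ] at hx ⊢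
      refine mem_range_lTensor_of_slices fun φ => ih _ ?_
      -- A functional on S is extended to C through the projection P, so that slices over S become
      -- slices over C.
      have h1 := comm_slice_mem_of_mem_range hx (φ ∘ₗ P)
      convert h1 using 1
      rw [← h.map_comul]
      change ((rslice φ (TensorProduct.comm K S S (h.comul x)) : S) : C) = _
      generalize h.comul x = s
      induction s using TensorProduct.induction_on with
      | zero => simp
      | tmul a b => simp [hP]
      | add a b ha hb => simp only [map_add, Submodule.coe_add, ha, hb]
  intro x
  obtain ⟨n, hn⟩ := hA x
  exact ⟨n, key n x hn⟩

/-- Morphisms into a subcoalgebra. -/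
lemma codRestrict_isHom {B : DGCoalgebra K D} {g : D →ₗ[K] S}
    (hg : B.IsHom A (S.subtype ∘ₗ g)) : B.IsHom h.toDGCoalgebra g where
  toIsHom := (A.toDGSpace.restrict_incl S h.proj_mem h.d_mem).of_comp_injective
    S.injective_subtype hg.toIsHom
  map_comul x := by
    apply map_subtype_injective S
    refine (h.map_comul (g x)).trans ((hg.map_comul x).trans ?_)
    rw [TensorProduct.map_comp]; rfl

end DGCoalgebra.IsSub

end SubCoalgebra

/-! ### Words: the tensor algebra, its letters and its grading. -/

/-- The tensor algebra, as the underlying space of the cofree conilpotent coalgebra. -/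
def Ten (K : Type u) [Field K] (V : Type v) [AddCommGroup V] [Module K V] : Type (max u v) :=
  TensorAlgebra K V

namespace Ten

variable {K : Type u} [Field K] {V : Type v} [AddCommGroup V] [Module K V]

instance : Ring (Ten K V) := inferInstanceAs (Ring (TensorAlgebra K V))

instance : Algebra K (Ten K V) := inferInstanceAs (Algebra K (TensorAlgebra K V))

variable (K) in
/-- The words of length one. -/
def ι : V →ₗ[K] Ten K V := TensorAlgebra.ι K

/-- The algebra map determined by a linear map on the letters. -/
def lift {A : Type*} [Ring A] [Algebra K A] (f : V →ₗ[K] A) : Ten K V →ₐ[K] A :=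
  TensorAlgebra.lift K f

@[simp] lemma lift_ι {A : Type*} [Ring A] [Algebra K A] (f : V →ₗ[K] A) (x : V) :
    lift f (ι K x) = f x := TensorAlgebra.lift_ι_apply f x

@[elab_as_elim]
lemma induction {C : Ten K V → Prop} (algebraMap : ∀ r, C (algebraMap K (Ten K V) r))
    (ι : ∀ x, C (ι K x)) (mul : ∀ a b, C a → C b → C (a * b))
    (add : ∀ a b, C a → C b → C (a + b)) (a : Ten K V) : C a :=
  TensorAlgebra.induction algebraMap ι mul add a

variable {N : Type*} [AddCommGroup N] [Module K N]

lemma eq_top_of {S : Submodule K (Ten K V)} (h1 : 1 ∈ S) (h : ∀ x, ∀ a ∈ S, ι K x * a ∈ S) :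
    S = ⊤ := by
  have key : ∀ t : Ten K V, ∀ s ∈ S, t * s ∈ S := by
    intro t
    induction t using Ten.induction with
    | algebraMap r => intro s hs; rw [← Algebra.smul_def]; exact S.smul_mem _ hs
    | ι x => exact h x
    | mul a b ha hb => intro s hs; rw [mul_assoc]; exact ha _ (hb _ hs)
    | add a b ha hb => intro s hs; rw [add_mul]; exact add_mem (ha _ hs) (hb _ hs)
  rw [eq_top_iff]
  intro a _
  simpa using key a 1 h1

/-- Linear maps on the tensor algebra are compared by induction on the length of words. -/
lemma hom_ext {f g : Ten K V →ₗ[K] N} (h1 : f 1 = g 1)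
    (h : ∀ x, ∀ a, f a = g a → f (ι K x * a) = g (ι K x * a)) : f = g := by
  have : LinearMap.eqLocus f g = ⊤ := eq_top_of h1 h
  exact LinearMap.ext fun a => by
    have : a ∈ LinearMap.eqLocus f g := this ▸ Submodule.mem_top
    exact this

section fold

/-- The action behind `fold`: `x` acts on `T × N` by `(a, n) ↦ (x a, l x n + D x a)`. -/
def foldAct (l : V →ₗ[K] Module.End K N) (D : V →ₗ[K] Ten K V →ₗ[K] N) :
    V →ₗ[K] Module.End K (Ten K V × N) where
  toFun x := (LinearMap.mulLeft K (ι K x) ∘ₗ LinearMap.fst K (Ten K V) N).prod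
    (l x ∘ₗ LinearMap.snd K (Ten K V) N + D x ∘ₗ LinearMap.fst K (Ten K V) N)
  map_add' x y := by
    refine LinearMap.ext fun p => Prod.ext ?_ ?_
    · simp [add_mul]
    · simp; abel
  map_smul' c x := by
    refine LinearMap.ext fun p => Prod.ext ?_ ?_ <;> simp

variable (l : V →ₗ[K] Module.End K N) (D : V →ₗ[K] Ten K V →ₗ[K] N)

/-- The linear map with `f 1 = 0` and `f (x a) = l x (f a) + D x a`. -/
def fold : Ten K V →ₗ[K] N where
  toFun a := (lift (foldAct l D) a (1, 0)).2
  map_add' a b := by simp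
  map_smul' c a := by simp

lemma lift_foldAct_mul (x : V) (a : Ten K V) (p : Ten K V × N) :
    lift (foldAct l D) (ι K x * a) p =
      (ι K x * (lift (foldAct l D) a p).1,
        l x (lift (foldAct l D) a p).2 +
          D x (lift (foldAct l D) a p).1) := by
  rw [map_mul, Module.End.mul_apply, lift_ι]
  rfl

lemma fold_one : fold l D 1 = 0 := by simp [fold]

lemma lift_foldAct_fst (a : Ten K V) :
    (lift (foldAct l D) a (1, 0)).1 = a := by
  let F : Ten K V →ₗ[K] Ten K V :=
    { toFun := fun a => (lift (foldAct l D) a (1, 0)).1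
      map_add' := fun a b => by simp
      map_smul' := fun c a => by simp }
  have hF : ∀ a, F a = (lift (foldAct l D) a (1, 0)).1 := fun _ => rfl
  have : F = LinearMap.id := by
    refine hom_ext (by simp [hF]) fun x a ha => ?_
    rw [LinearMap.id_apply, hF] at ha ⊢
    rw [lift_foldAct_mul, ha]
  exact LinearMap.congr_fun this a

lemma fold_mul (x : V) (a : Ten K V) : fold l D (ι K x * a) = l x (fold l D a) + D x a := by
  change (lift (foldAct l D) (ι K x * a) (1, 0)).2 = _
  rw [lift_foldAct_mul, lift_foldAct_fst]
  rfl

end fold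

section cons

/-- Concatenation `x ⊗ t ↦ x t`. -/
def cons : V ⊗[K] Ten K V →ₗ[K] Ten K V :=
  TensorProduct.lift (LinearMap.mul K (Ten K V) ∘ₗ ι K)

@[simp] lemma cons_tmul (x : V) (t : Ten K V) : cons (x ⊗ₜ[K] t) = ι K x * t := by simp [cons]

/-- Splitting off the first letter, `x t ↦ x ⊗ t` and `1 ↦ 0`. -/
def uncons : Ten K V →ₗ[K] V ⊗[K] Ten K V := fold 0 (TensorProduct.mk K V (Ten K V))

@[simp] lemma uncons_one : uncons (1 : Ten K V) = 0 := fold_one _ _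

@[simp] lemma uncons_mul (x : V) (t : Ten K V) : uncons (ι K x * t) = x ⊗ₜ[K] t := by
  simp [uncons, fold_mul]

@[simp] lemma uncons_ι (x : V) : uncons (ι K x) = x ⊗ₜ[K] (1 : Ten K V) := by
  simpa using uncons_mul (K := K) x 1

lemma uncons_cons (u : V ⊗[K] Ten K V) : uncons (cons u) = u := by
  have : uncons ∘ₗ cons = (LinearMap.id : V ⊗[K] Ten K V →ₗ[K] _) :=
    TensorProduct.ext' fun x y => by simp
  exact LinearMap.congr_fun this u

/-- The operator `x t ↦ x (f t)`, `1 ↦ 0`. -/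
def up (f : Ten K V →ₗ[K] Ten K V) : Ten K V →ₗ[K] Ten K V := cons ∘ₗ f.lTensor V ∘ₗ uncons

variable (f g : Ten K V →ₗ[K] Ten K V)

@[simp] lemma up_one : up f 1 = 0 := by simp [up]

@[simp] lemma up_mul (x : V) (t : Ten K V) : up f (ι K x * t) = ι K x * f t := by simp [up]

@[simp] lemma up_ι (x : V) : up f (ι K x) = ι K x * f 1 := by simpa using up_mul f x 1

lemma uncons_up (t : Ten K V) : uncons (up f t) = f.lTensor V (uncons t) := by
  simp [up, uncons_cons]

/-- Linear maps on `T = K ⊕ V ⊗ T` are compared on the summands. -/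
lemma cons_ext {f g : Ten K V →ₗ[K] N} (h1 : f 1 = g 1)
    (h : ∀ x, ∀ a, f (ι K x * a) = g (ι K x * a)) : f = g :=
  hom_ext h1 fun x a _ => h x a

lemma up_comp : up (f ∘ₗ g) = up f ∘ₗ up g := cons_ext (by simp) (by simp)

lemma up_add : up (f + g) = up f + up g := cons_ext (by simp) (by simp [mul_add])

lemma up_sub : up (f - g) = up f - up g := cons_ext (by simp) (by simp [mul_sub])

lemma up_smul (c : K) : up (c • f) = c • up f := cons_ext (by simp) (by simp)

@[simp] lemma up_zero : up (0 : Ten K V →ₗ[K] Ten K V) = 0 := cons_ext (by simp) (by simp)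

/-- The constant term. -/
def aug : Ten K V →ₗ[K] K := (lift (0 : V →ₗ[K] K)).toLinearMap

@[simp] lemma aug_one : aug (1 : Ten K V) = 1 := by simp [aug]

@[simp] lemma aug_mul (x : V) (t : Ten K V) : aug (ι K x * t) = 0 := by
  simp [aug]

@[simp] lemma aug_cons (u : V ⊗[K] Ten K V) : aug (cons u) = 0 := by
  have : aug ∘ₗ cons = (0 : V ⊗[K] Ten K V →ₗ[K] _) := TensorProduct.ext' fun x y => by simp
  exact LinearMap.congr_fun this u

@[simp] lemma aug_up (t : Ten K V) : aug (up f t) = 0 := aug_cons _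

/-- The projection onto the words of positive length. -/
def plus : Ten K V →ₗ[K] Ten K V := up LinearMap.id

@[simp] lemma plus_one : plus (1 : Ten K V) = 0 := up_one _

@[simp] lemma plus_mul (x : V) (t : Ten K V) : plus (ι K x * t) = ι K x * t := up_mul _ x t

@[simp] lemma plus_ι (x : V) : plus (ι K x) = ι K x := by simp [plus]

lemma plus_eq (t : Ten K V) : plus t = t - aug t • 1 := by
  have : plus = LinearMap.id - (LinearMap.toSpanSingleton K (Ten K V) 1) ∘ₗ aug :=
    cons_ext (by simp) (by simp)
  exact LinearMap.congr_fun this t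

lemma plus_of_aug {t : Ten K V} (h : aug t = 0) : plus t = t := by simp [plus_eq, h]

variable {f} in
lemma apply_plus (h : f 1 = 0) (t : Ten K V) : f (plus t) = f t := by simp [plus_eq, h]

/-- The terms of length one. -/
def fst : Ten K V →ₗ[K] V := (TensorProduct.rid K V).toLinearMap ∘ₗ aug.lTensor V ∘ₗ uncons

@[simp] lemma fst_one : fst (1 : Ten K V) = 0 := by simp [fst]

@[simp] lemma fst_mul (x : V) (t : Ten K V) : fst (ι K x * t) = aug t • x := by simp [fst]

@[simp] lemma fst_ι (x : V) : fst (ι K x) = x := by simp [fst]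

lemma fst_plus (t : Ten K V) : fst (plus t) = fst t := by simp [plus_eq]

end cons

section grading

variable (X : DGSpace K V)

/-- The words in homogeneous letters, of total degree `n`. -/
inductive HomWord : ℤ → Ten K V → Prop
  | one : HomWord 0 1
  | cons {i n : ℤ} {x : V} {a : Ten K V} (hx : x ∈ X.gr i) (ha : HomWord n a) :
      HomWord (i + n) (ι K x * a)

/-- The degree `n` part of the tensor algebra. -/
def gr (n : ℤ) : Submodule K (Ten K V) := Submodule.span K {a | HomWord X n a}

lemma one_mem : (1 : Ten K V) ∈ gr X 0 := Submodule.subset_span .one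

variable {X} in
lemma ι_mul_mem {i n : ℤ} {x : V} {a : Ten K V} (hx : x ∈ X.gr i) (ha : a ∈ gr X n) :
    ι K x * a ∈ gr X (i + n) := by
  induction ha using Submodule.span_induction with
  | mem a ha => exact Submodule.subset_span (.cons hx ha)
  | zero => simp
  | add a b _ _ ha hb => rw [mul_add]; exact add_mem ha hb
  | smul c a _ ha => rw [mul_smul_comm]; exact Submodule.smul_mem _ _ ha

lemma eq_top_of_homogeneous {S : Submodule K (Ten K V)} (h1 : 1 ∈ S)
    (h : ∀ i, ∀ x ∈ X.gr i, ∀ a ∈ S, ι K x * a ∈ S) : S = ⊤ := by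
  refine eq_top_of h1 fun x a ha => ?_
  have : S.mkQ ∘ₗ (LinearMap.mul K (Ten K V)).flip a ∘ₗ ι K = 0 := by
    refine X.hom_ext fun i x hx => ?_
    simpa using h i x hx a ha
  simpa using LinearMap.congr_fun this x

lemma hom_ext_homogeneous {f g : Ten K V →ₗ[K] N} (h1 : f 1 = g 1)
    (h : ∀ i, ∀ x ∈ X.gr i, ∀ a, f a = g a → f (ι K x * a) = g (ι K x * a)) : f = g := by
  have : LinearMap.eqLocus f g = ⊤ := eq_top_of_homogeneous X h1 h
  exact LinearMap.ext fun a => by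
    have : a ∈ LinearMap.eqLocus f g := this ▸ Submodule.mem_top
    exact this

lemma gr_induction {n : ℤ} {S : ℤ → Submodule K (Ten K V)} (h1 : 1 ∈ S 0)
    (h : ∀ i m, ∀ x ∈ X.gr i, ∀ a, HomWord X m a → a ∈ S m → ι K x * a ∈ S (i + m)) :
    gr X n ≤ S n := by
  refine Submodule.span_le.mpr fun a ha => ?_
  induction ha with
  | one => exact h1
  | cons hx ha ih => exact h _ _ _ hx _ ha ih

lemma iSup_gr : ⨆ n, gr X n = ⊤ := by
  refine eq_top_of_homogeneous X (Submodule.mem_iSup_of_mem 0 (one_mem X)) fun i x hx a ha => ?_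
  induction ha using Submodule.iSup_induction' with
  | mem n a ha => exact Submodule.mem_iSup_of_mem _ (ι_mul_mem hx ha)
  | zero => simp
  | add a b _ _ ha hb => rw [mul_add]; exact add_mem ha hb

/-- The map `a ↦ a tⁿ` into the Laurent polynomials. -/
def tpow (n : ℤ) : Ten K V →ₗ[K] AddMonoidAlgebra (Ten K V) ℤ := AddMonoidAlgebra.lsingle n

lemma tpow_mul (m n : ℤ) (a b : Ten K V) : tpow m a * tpow n b = tpow (m + n) (a * b) :=
  AddMonoidAlgebra.single_mul_single ..

/-- The algebra map that records degrees: `a ↦ a tⁿ` for `a` of degree `n`. -/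
def weight : Ten K V →ₐ[K] AddMonoidAlgebra (Ten K V) ℤ :=
  lift (X.homLift (N := AddMonoidAlgebra (Ten K V) ℤ) fun i => tpow i ∘ₗ ι K)

lemma weight_apply {n : ℤ} {a : Ten K V} (ha : a ∈ gr X n) : weight X a = tpow n a := by
  refine gr_induction X (n := n)
    (S := fun n => LinearMap.eqLocus (weight X).toLinearMap (tpow n)) ?_ ?_ ha
  · rw [LinearMap.mem_eqLocus, AlgHom.toLinearMap_apply, map_one]; rfl
  · intro i m x hx a _ ha
    rw [LinearMap.mem_eqLocus, AlgHom.toLinearMap_apply] at ha ⊢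
    rw [map_mul, ha, weight, lift_ι, X.homLift_apply _ hx,
      LinearMap.comp_apply, tpow_mul]

lemma gr_internal : DirectSum.IsInternal (gr X) := by
  have h : ∀ m n a, (tpow (K := K) (V := V) m a).coeff n = if m = n then a else 0 := by
    intro m n a
    exact Finsupp.single_apply
  refine isInternal_of_proj _ (iSup_gr X)
    (fun n => (Finsupp.lapply n : (ℤ →₀ Ten K V) →ₗ[K] Ten K V) ∘ₗ
      (AddMonoidAlgebra.coeffLinearEquiv K).toLinearMap ∘ₗ (weight X).toLinearMap) ?_ ?_
  · intro n x hx
    simp [weight_apply X hx, h]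
  · intro m n hmn x hx
    simp [weight_apply X hx, h, hmn]

/-- The differential of the tensor algebra, the graded derivation that extends that of `V`. -/
def d : Ten K V →ₗ[K] Ten K V :=
  fold (LinearMap.mul K (Ten K V) ∘ₗ ι K ∘ₗ X.sgn 1) (LinearMap.mul K (Ten K V) ∘ₗ ι K ∘ₗ X.d)

@[simp] lemma d_one : d X 1 = 0 := fold_one _ _

lemma d_mul {i : ℤ} {x : V} (hx : x ∈ X.gr i) (a : Ten K V) :
    d X (ι K x * a) = ι K (X.d x) * a + sg K i • (ι K x * d X a) := by
  rw [d, fold_mul, add_comm]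
  simp [X.sgn_apply 1 hx]

/-- The tensor algebra of a dg vector space, as a dg vector space. -/
def dg : DGSpace K (Ten K V) where
  gr := gr X
  internal := gr_internal X
  d := d X
  d_mem := by
    intro n a ha
    refine gr_induction X (S := fun n => (gr X (n - 1)).comap (d X)) ?_ ?_ ha
    · simp
    · intro i m x hx a ha' ha
      have ha'' : a ∈ gr X m := Submodule.subset_span ha'
      simp only [Submodule.mem_comap] at ha ⊢
      rw [d_mul X hx]
      refine add_mem ?_ (Submodule.smul_mem _ _ ?_)
      · rw [show i + m - 1 = (i - 1) + m by ring]; exact ι_mul_mem (X.d_mem i x hx) ha''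
      · rw [show i + m - 1 = i + (m - 1) by ring]; exact ι_mul_mem hx ha
  d_d := by
    have : d X ∘ₗ d X = 0 := by
      refine hom_ext_homogeneous X (by simp) fun i x hx a ha => ?_
      simp only [LinearMap.comp_apply, LinearMap.zero_apply] at ha ⊢
      rw [d_mul X hx, map_add, map_smul, d_mul X hx, d_mul X (X.d_mem i x hx), ha, X.d_d,
        sg_sub_one]
      simp only [map_zero, zero_mul, mul_zero, smul_zero, zero_add, add_zero, neg_smul,
        neg_add_cancel]
    exact fun a => LinearMap.congr_fun this a

lemma dg_d (a : Ten K V) : (dg X).d a = d X a := rfl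

variable {X} in
/-- A linear map on the tensor algebra is a morphism if it is one on words. -/
lemma isHom_of_word {W : Type*} [AddCommGroup W] [Module K W] {Y : DGSpace K W}
    {f : Ten K V →ₗ[K] W} (h1 : f 1 ∈ Y.gr 0) (h1d : Y.d (f 1) = 0)
    (hm : ∀ i m, ∀ x ∈ X.gr i, ∀ a ∈ gr X m, f a ∈ Y.gr m → f (ι K x * a) ∈ Y.gr (i + m))
    (hd : ∀ i, ∀ x ∈ X.gr i, ∀ a, f (d X a) = Y.d (f a) →
      f (ι K (X.d x) * a) + sg K i • f (ι K x * d X a) = Y.d (f (ι K x * a))) :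
    (dg X).IsHom Y f := by
  constructor
  · intro n a ha
    refine gr_induction X (S := fun n => (Y.gr n).comap f) h1 ?_ ha
    exact fun i m x hx a ha => hm i m x hx a (Submodule.subset_span ha)
  · have : f ∘ₗ d X = Y.d ∘ₗ f := by
      refine hom_ext_homogeneous X (by simp [h1d]) fun i x hx a ha => ?_
      simp only [LinearMap.comp_apply] at ha ⊢
      rw [← hd i x hx a ha, d_mul X hx, map_add, map_smul]
    exact fun a => LinearMap.congr_fun this a

lemma cons_isHom : (X.tensor (dg X)).IsHom (dg X) cons := by
  refine isHom_of_tmul (fun i j x hx a ha => ?_) (fun i j x hx a ha => ?_)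
  · rw [cons_tmul]; exact ι_mul_mem hx ha
  · simp only [cons_tmul, dg_d, d_mul X hx]

lemma uncons_isHom : (dg X).IsHom (X.tensor (dg X)) uncons := by
  refine isHom_of_word (by simp) (by simp) (fun i m x hx a ha _ => ?_) (fun i x hx a _ => ?_)
  · rw [uncons_mul]; exact tmul_mem hx ha
  · simp only [uncons_mul]
    exact (X.tensorD_tmul (dg X) hx a).symm

variable {X} in
lemma up_isHom {f : Ten K V →ₗ[K] Ten K V} (hf : (dg X).IsHom (dg X) f) :
    (dg X).IsHom (dg X) (up f) :=
  (cons_isHom X).comp (((IsHom.id (X := X)).tensor hf).comp (uncons_isHom X))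

lemma plus_isHom : (dg X).IsHom (dg X) plus := up_isHom .id

lemma aug_d (t : Ten K V) : aug (d X t) = 0 := by
  have : aug ∘ₗ d X = 0 :=
    hom_ext_homogeneous X (by simp) fun i x hx a _ => by simp [d_mul X hx]
  exact LinearMap.congr_fun this t

lemma ι_isHom : X.IsHom (dg X) (ι K) := by
  constructor
  · intro i x hx
    have := ι_mul_mem hx (one_mem X)
    rwa [mul_one, add_zero] at this
  · have : ι K ∘ₗ X.d = d X ∘ₗ ι K := by
      refine X.hom_ext fun i x hx => ?_
      have := d_mul X hx 1
      rw [mul_one, mul_one, d_one, mul_zero, smul_zero, add_zero] at this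
      simp [this]
    exact fun x => LinearMap.congr_fun this x

lemma fst_isHom : (dg X).IsHom X fst := by
  refine isHom_of_word (by simp) (by simp) (fun i m x hx a ha _ => ?_) (fun i x hx a _ => ?_)
  · rw [fst_mul]
    refine gr_induction X (S := fun m => (X.gr (i + m)).comap
      ((LinearMap.toSpanSingleton K V x) ∘ₗ aug)) ?_ ?_ ha
    · simpa using hx
    · intro j m y hy a _ _
      simp
  · simp [aug_d]

end grading

/-! ### The deconcatenation coalgebra. -/

section comul

/-- The map `a ⊗ b ↦ x a ⊗ b`. -/
def lmul (W : Type*) [AddCommGroup W] [Module K W] :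
    V →ₗ[K] Module.End K (Ten K V ⊗[K] W) :=
  LinearMap.rTensorHom W ∘ₗ LinearMap.mul K (Ten K V) ∘ₗ ι K

@[simp] lemma lmul_tmul {W : Type*} [AddCommGroup W] [Module K W] (x : V) (a : Ten K V) (b : W) :
    lmul W x (a ⊗ₜ b) = (ι K x * a) ⊗ₜ[K] b := by simp [lmul]

lemma lmul_eq {W : Type*} [AddCommGroup W] [Module K W] (x : V) :
    lmul W x = (LinearMap.mulLeft K (ι K x)).rTensor W := rfl

/-- The reduced deconcatenation coproduct
`x₁ ⋯ xₙ ↦ ∑_{0 < i < n} x₁ ⋯ xᵢ ⊗ xᵢ₊₁ ⋯ xₙ`. -/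
def comul : Ten K V →ₗ[K] Ten K V ⊗[K] Ten K V :=
  fold (lmul (Ten K V)) (LinearMap.lcomp K _ plus ∘ₗ TensorProduct.mk K _ _ ∘ₗ ι K)

@[simp] lemma comul_one : comul (1 : Ten K V) = 0 := fold_one _ _

@[simp] lemma comul_mul (x : V) (a : Ten K V) :
    comul (ι K x * a) = lmul _ x (comul a) + ι K x ⊗ₜ plus a := by
  simp [comul, fold_mul]

@[simp] lemma comul_ι (x : V) : comul (ι K x) = 0 := by simpa using comul_mul (K := K) x 1

lemma lmul_map {W W' : Type*} [AddCommGroup W] [Module K W] [AddCommGroup W'] [Module K W']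
    (f : W →ₗ[K] W') (x : V) (t : Ten K V ⊗[K] W) :
    f.lTensor (Ten K V) (lmul W x t) = lmul W' x (f.lTensor (Ten K V) t) := by
  have : f.lTensor (Ten K V) ∘ₗ lmul W x = lmul W' x ∘ₗ f.lTensor (Ten K V) :=
    TensorProduct.ext' fun a b => by simp
  exact LinearMap.congr_fun this t

lemma rTensor_lmul {W W' : Type*} [AddCommGroup W] [Module K W] [AddCommGroup W'] [Module K W']
    {f : Ten K V →ₗ[K] W'} {x : V} {g : Ten K V →ₗ[K] W'} (h : ∀ a, f (ι K x * a) = g a)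
    (t : Ten K V ⊗[K] W) : f.rTensor W (lmul W x t) = g.rTensor W t := by
  have : f.rTensor W ∘ₗ lmul W x = g.rTensor W :=
    TensorProduct.ext' fun a b => by simp [h]
  exact LinearMap.congr_fun this t

lemma rTensor_plus_comul (t : Ten K V) : plus.rTensor _ (comul t) = comul t := by
  have : plus.rTensor (Ten K V) ∘ₗ comul = comul := by
    refine hom_ext (by simp) fun x a _ => ?_
    simp only [LinearMap.comp_apply, comul_mul, map_add, LinearMap.rTensor_tmul, plus_ι]
    rw [rTensor_lmul (g := LinearMap.mulLeft K (ι K x)) (by simp), lmul_eq]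
  exact LinearMap.congr_fun this t

/-- The left factors of the reduced coproduct have no constant term, so only the values of f on
words of positive length matter. -/
lemma rTensor_eq_zero_of_aug {W' : Type*}
    [AddCommGroup W'] [Module K W'] {f : Ten K V →ₗ[K] W'} (h : ∀ t, f (plus t) = 0)
    (t : Ten K V) : f.rTensor _ (comul t) = 0 := by
  rw [← rTensor_plus_comul, ← LinearMap.comp_apply, ← LinearMap.rTensor_comp]
  have : f ∘ₗ plus = 0 := LinearMap.ext h
  simp [this]

lemma comul_plus (t : Ten K V) : comul (plus t) = comul t := by simp [plus_eq]

lemma lTensor_plus_comul (t : Ten K V) : plus.lTensor _ (comul t) = comul t := by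
  have : plus.lTensor (Ten K V) ∘ₗ comul = comul := by
    refine hom_ext (by simp) fun x a ha => ?_
    rw [LinearMap.comp_apply] at ha
    simp only [LinearMap.comp_apply, comul_mul, map_add, LinearMap.lTensor_tmul, lmul_map, ha]
    rw [plus_of_aug (t := plus a) (by simp [plus])]
  exact LinearMap.congr_fun this t

lemma coassoc (t : Ten K V) :
    TensorProduct.assoc K _ _ _ (comul.rTensor _ (comul t)) = comul.lTensor _ (comul t) := by
  have : (TensorProduct.assoc K (Ten K V) (Ten K V) (Ten K V)).toLinearMap ∘ₗ
      comul.rTensor _ ∘ₗ comul = comul.lTensor _ ∘ₗ comul := by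
    refine hom_ext (by simp) fun x a ha => ?_
    simp only [LinearMap.comp_apply, LinearEquiv.coe_coe] at ha ⊢
    -- A letter put in front of the left factor is carried along by every cut of that factor; the
    -- only new cut is the one directly behind the letter.
    have key : ∀ z : Ten K V ⊗[K] Ten K V,
        TensorProduct.assoc K _ _ _ (comul.rTensor _ (lmul _ x z)) =
          lmul _ x (TensorProduct.assoc K _ _ _ (comul.rTensor _ z)) +
            ι K x ⊗ₜ (plus.rTensor _ z) := by
      intro z
      induction z using TensorProduct.induction_on with
      | zero => simp
      | tmul a b =>
        simp only [lmul_tmul, LinearMap.rTensor_tmul, comul_mul, TensorProduct.add_tmul, map_add,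
          TensorProduct.assoc_tmul]
        congr 1
        generalize comul a = s
        induction s using TensorProduct.induction_on with
        | zero => simp
        | tmul p q => simp
        | add a b ha hb => simp only [map_add, TensorProduct.add_tmul, ha, hb]
      | add a b ha hb => simp only [map_add, TensorProduct.tmul_add, ha, hb]; abel
    rw [comul_mul, map_add, map_add, key, ha, rTensor_plus_comul, map_add, lmul_map,
      LinearMap.rTensor_tmul, comul_ι, LinearMap.lTensor_tmul, comul_plus]
    simp
  exact LinearMap.congr_fun this t

variable (X : DGSpace K V)

lemma comul_isHom : (dg X).IsHom ((dg X).tensor (dg X)) comul := by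
  refine isHom_of_word (by simp) (by simp) (fun i m x hx a ha hm => ?_) (fun i x hx a hd => ?_)
  · rw [comul_mul]
    refine add_mem ?_ (tmul_mem ((ι_isHom X).map_mem i x hx) ((plus_isHom X).map_mem m a ha))
    generalize comul a = z at hm
    induction hm using Submodule.span_induction with
    | mem z hz =>
      obtain ⟨p, q, rfl, y, hy, w, hw, rfl⟩ := hz
      rw [lmul_tmul, ← add_assoc]
      exact tmul_mem (ι_mul_mem hx hy) hw
    | zero => simp
    | add a b _ _ ha hb => rw [map_add]; exact add_mem ha hb
    | smul c a _ ha => rw [map_smul]; exact Submodule.smul_mem _ _ ha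
  · have hD : ∀ z, ((dg X).tensor (dg X)).d z = (dg X).tensorD (dg X) z := fun _ => rfl
    have key : (dg X).tensorD (dg X) ∘ₗ lmul _ x =
        lmul _ (X.d x) + sg K i • lmul _ x ∘ₗ (dg X).tensorD (dg X) := by
      refine (dg X).tensor_ext (dg X) fun p q y hy w hw => ?_
      have h1 : ι K x * y ∈ (dg X).gr (i + p) := ι_mul_mem hx hy
      simp only [LinearMap.comp_apply, lmul_tmul, (dg X).tensorD_tmul _ h1, LinearMap.add_apply,
        LinearMap.smul_apply, (dg X).tensorD_tmul _ hy, map_add, map_smul, dg_d, d_mul X hx,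
        TensorProduct.add_tmul, ← TensorProduct.smul_tmul', sg_add, smul_add, smul_smul, add_assoc]
    have key' := LinearMap.congr_fun key (comul a)
    simp only [LinearMap.comp_apply, LinearMap.add_apply, LinearMap.smul_apply] at key'
    simp only [hD] at hd ⊢
    rw [comul_mul, comul_mul, comul_mul, map_add, key', hd,
      (dg X).tensorD_tmul (dg X) ((ι_isHom X).map_mem i x hx), ← (ι_isHom X).map_d,
      ← (plus_isHom X).map_d, dg_d, smul_add]
    abel

/-- The cofree conilpotent dg coalgebra on `V`, with an extra summand `K` on which the coproduct
is zero. -/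
def coalgebra : DGCoalgebra K (Ten K V) where
  toDGSpace := dg X
  comul := comul
  comul_isHom := comul_isHom X
  coassoc := coassoc

-- A letter put in front of a word raises its coradical level by at most one, so every word has a
-- finite level. The count starts at level one because the coproduct kills 1 but level zero contains
-- only 0.
variable (K V) in
lemma conilpotent : Conilpotent (comul (K := K) (V := V)) := by
  have h1 : (1 : Ten K V) ∈ coradical comul 1 := by simp [mem_coradical_succ]
  have key : ∀ n, ∀ x : V, ∀ t : Ten K V, t ∈ coradical comul (n + 1) →
      ι K x * t ∈ coradical comul (n + 2) := by
    intro n x t ht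
    rw [mem_coradical_succ, comul_mul]
    refine add_mem ?_ ?_
    · have h2 := range_lTensor_mono (N := Ten K V) (coradical_le_succ (μ := comul) n)
        (mem_coradical_succ.1 ht)
      exact lTensor_mem_range h2 (LinearMap.mulLeft K (ι K x)) (f := LinearMap.id) fun y hy => hy
    · have : plus t ∈ coradical comul (n + 1) := by
        rw [plus_eq]
        exact sub_mem ht (Submodule.smul_mem _ _ (coradical_mono (by omega) h1))
      exact ⟨ι K x ⊗ₜ ⟨_, this⟩, by simp⟩
  have top : (⨆ n, coradical (comul (K := K) (V := V)) (n + 1)) = ⊤ := by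
    have hdir : Directed (· ≤ ·) fun n => coradical (comul (K := K) (V := V)) (n + 1) :=
      (coradical_mono.comp (fun a b h => by simpa using h : Monotone (· + 1))).directed_le
    refine eq_top_of (Submodule.mem_iSup_of_mem 0 h1) fun x a ha => ?_
    rw [Submodule.mem_iSup_of_directed _ hdir] at ha ⊢
    obtain ⟨n, hn⟩ := ha
    exact ⟨n + 1, key n x a hn⟩
  intro t
  have ht : t ∈ ⨆ n, coradical (comul (K := K) (V := V)) (n + 1) := by rw [top]; trivial
  have hdir : Directed (· ≤ ·) fun n => coradical (comul (K := K) (V := V)) (n + 1) :=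
    (coradical_mono.comp (fun a b h => by simpa using h : Monotone (· + 1))).directed_le
  rw [Submodule.mem_iSup_of_directed _ hdir] at ht
  obtain ⟨n, hn⟩ := ht
  exact ⟨_, hn⟩

end comul

end Ten

/-! ### Vanishing of the first cohomology of symmetric groups. -/

section Cohomology

variable {K : Type u} [Field K] {M : Type*} [AddCommGroup M] [Module K M]

/-- Operators `κᵢ = 1 - τᵢ`, for `i < n`, that preserve `S`, such that the `τᵢ` satisfy on `S` the
relations of the adjacent transpositions in a symmetric group. -/
structure CoxeterOn (κ : ℕ → Module.End K M) (n : ℕ) (S : Submodule K M) : Prop where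
  mem : ∀ i < n, ∀ x ∈ S, κ i x ∈ S
  sq : ∀ i < n, ∀ x ∈ S, κ i (κ i x) = (2 : K) • κ i x
  far : ∀ i j, i + 2 ≤ j → j < n → ∀ x ∈ S, κ i (κ j x) = κ j (κ i x)
  braid : ∀ i, i + 1 < n → ∀ x ∈ S,
    κ i (κ (i + 1) (κ i x)) - κ i x = κ (i + 1) (κ i (κ (i + 1) x)) - κ (i + 1) x

lemma CoxeterOn.shift {κ : ℕ → Module.End K M} {n : ℕ} {S : Submodule K M}
    (h : CoxeterOn κ (n + 1) S) : CoxeterOn (fun i => κ (i + 1)) n S where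
  mem i hi := h.mem (i + 1) (by omega)
  sq i hi := h.sq (i + 1) (by omega)
  far i j hij hj := h.far (i + 1) (j + 1) (by omega) (by omega)
  braid i hi := h.braid (i + 1) (by omega)

/-- The elements `τₖ ⋯ τ₁ a`. -/
def cosetSeq (κ : ℕ → Module.End K M) (a : M) : ℕ → M
  | 0 => a
  | k + 1 => cosetSeq κ a k - κ (k + 1) (cosetSeq κ a k)

namespace CoxeterOn

variable {κ : ℕ → Module.End K M} {n : ℕ} {S : Submodule K M} {a : M}

/-- By the braid relation τ_i τ_{i+1} τ_i x = τ_{i+1} τ_i τ_{i+1} x, and τ_{i+1} fixes x; so τ_i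
fixes τ_{i+1} τ_i x. -/
lemma conj (h : CoxeterOn κ n S) {i : ℕ} (hi : i + 1 < n) {x : M} (hx : x ∈ S) (h0 : κ (i + 1) x = 0) :
    κ i ((x - κ i x) - κ (i + 1) (x - κ i x)) = 0 := by
  have e1 := h.sq i (by omega) x hx
  have e2 := h.braid i hi x hx
  simp only [map_sub, h0, map_zero, sub_zero, zero_sub] at e2 ⊢
  rw [e1, map_neg, sub_neg_eq_add, two_smul]
  rw [sub_eq_zero] at e2
  rw [e2]; abel

lemma cosetSeq_mem (h : CoxeterOn κ n S) (ha : a ∈ S) {k : ℕ} (hk : k < n) : cosetSeq κ a k ∈ S := by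
  induction k with
  | zero => exact ha
  | succ k ih => exact sub_mem (ih (by omega)) (h.mem _ hk _ (ih (by omega)))

/-- The index j is at least two away from 1, …, k, so τ_j commutes past τ_k ⋯ τ_1 and meets a, which
it fixes. -/
lemma apply_cosetSeq_of_lt (h : CoxeterOn κ n S) (ha : a ∈ S) (h2 : ∀ j, 2 ≤ j → j < n → κ j a = 0) {j k : ℕ}
    (hj : k + 2 ≤ j) (hn : j < n) : κ j (cosetSeq κ a k) = 0 := by
  induction k with
  | zero => exact h2 j hj hn
  | succ k ih =>
    have e := ih (by omega)
    rw [cosetSeq, map_sub, e, ← h.far (k + 1) j (by omega) hn _ (h.cosetSeq_mem ha (by omega)), e]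
    simp

/-- For k = j + 2 this is `conj` applied to τ_j ⋯ τ_1 a, which τ_{j+2} fixes; the later factors
commute with τ_{j+1}. -/
lemma apply_cosetSeq_of_gt (h : CoxeterOn κ n S) (ha : a ∈ S) (h2 : ∀ j, 2 ≤ j → j < n → κ j a = 0) {j k : ℕ}
    (hj : j + 2 ≤ k) (hn : k < n) : κ (j + 1) (cosetSeq κ a k) = 0 := by
  obtain ⟨m, rfl⟩ := Nat.exists_eq_add_of_le hj
  clear hj
  induction m with
  | zero =>
    exact h.conj (i := j + 1) hn (h.cosetSeq_mem ha (k := j) (by omega))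
      (h.apply_cosetSeq_of_lt ha h2 (by omega) hn)
  | succ m ih =>
    have e := ih (by omega)
    rw [← add_assoc, cosetSeq, map_sub, e,
      h.far (j + 1) (j + 2 + m + 1) (by omega) hn _ (h.cosetSeq_mem ha (by omega)), e]
    simp

/-- The data are a cocycle with value a at τ_0 and value 0 at τ_1, …, τ_{n−1}. It is constant on the
cosets of the subgroup generated by the latter, so averaging it over the group is averaging over n +
1 cosets. -/
lemma exists_of_concentrated [CharZero K] (h : CoxeterOn κ n S) (hn : 0 < n) (ha : a ∈ S) (h0 : κ 0 a = (2 : K) • a)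
    (h1 : 1 < n → κ 0 (κ 1 a) = a) (h2 : ∀ j, 2 ≤ j → j < n → κ j a = 0) :
    ∃ w ∈ S, κ 0 w = a ∧ ∀ i, i + 1 < n → κ (i + 1) w = 0 := by
  have hz : ∀ k, 0 < k → k < n → κ 0 (cosetSeq κ a k) = a := by
    intro k hk hkn
    obtain ⟨k, rfl⟩ : ∃ m, k = m + 1 := ⟨k - 1, by omega⟩
    clear hk
    induction k with
    | zero =>
      change κ 0 (a - κ 1 a) = a
      rw [map_sub, h0, h1 hkn, two_smul]; abel
    | succ k ih =>
      rw [cosetSeq, map_sub, h.far 0 (k + 2) (by omega) hkn _ (h.cosetSeq_mem ha (by omega)),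
        ih (by omega), h2 _ (by omega) hkn, sub_zero]
  -- The cosets are represented by 1 and by τ_k ⋯ τ_0 for k < n. The cocycle is 0 at the first and,
  -- by the cocycle law, τ_k ⋯ τ_1 a at the others: n terms, but denominator n + 1.
  refine ⟨((n : K) + 1)⁻¹ • ∑ k ∈ Finset.range n, cosetSeq κ a k,
    S.smul_mem _ (S.sum_mem fun k hk => h.cosetSeq_mem ha (Finset.mem_range.1 hk)), ?_, ?_⟩
  · have hs : ∑ k ∈ Finset.range n, κ 0 (cosetSeq κ a k) = ((n : K) + 1) • a := by
      obtain ⟨m, rfl⟩ : ∃ m, n = m + 1 := ⟨n - 1, by omega⟩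
      rw [Finset.sum_range_succ', Finset.sum_congr rfl fun k hk =>
        hz (k + 1) (by omega) (by simpa using hk), Finset.sum_const, Finset.card_range]
      change m • a + κ 0 a = _
      rw [h0, ← Nat.cast_smul_eq_nsmul K, ← add_smul]
      congr 1
      push_cast; ring
    rw [map_smul, map_sum, hs, smul_smul, inv_mul_cancel₀ (Nat.cast_add_one_ne_zero n), one_smul]
  · intro i hi
    -- The terms k = i and k = i + 1 are exchanged by τ_{i+1}, so their contributions are opposite;
    -- every other term is fixed by τ_{i+1}.
    have hs : ∀ k ∈ Finset.range n, κ (i + 1) (cosetSeq κ a k) =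
        (if k = i then κ (i + 1) (cosetSeq κ a i) else 0) +
          (if k = i + 1 then -κ (i + 1) (cosetSeq κ a i) else 0) := by
      intro k hk
      rw [Finset.mem_range] at hk
      rcases lt_trichotomy k i with hki | rfl | hki
      · rw [h.apply_cosetSeq_of_lt ha h2 (by omega) hi, if_neg (by omega), if_neg (by omega),
          add_zero]
      · simp
      · rcases eq_or_lt_of_le (Nat.succ_le_of_lt hki) with rfl | hki
        · rw [cosetSeq, map_sub, h.sq _ hi _ (h.cosetSeq_mem ha (by omega)), two_smul]
          simp
        · rw [h.apply_cosetSeq_of_gt ha h2 (by omega) hk, if_neg (by omega), if_neg (by omega),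
            add_zero]
    rw [map_smul, map_sum, Finset.sum_congr rfl hs, Finset.sum_add_distrib,
      Finset.sum_ite_eq', Finset.sum_ite_eq']
    simp [hi, show i < n by omega]

end CoxeterOn

/-- The first cohomology of a symmetric group vanishes in characteristic zero: a family that
satisfies the relations of a cocycle on the adjacent transpositions is a coboundary. -/
lemma CoxeterOn.exists_primitive [CharZero K] {n : ℕ} : ∀ {κ : ℕ → Module.End K M}
    {S : Submodule K M}, CoxeterOn κ n S → ∀ {a : ℕ → M}, (∀ i < n, a i ∈ S) →
    (∀ i < n, κ i (a i) = (2 : K) • a i) →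
    (∀ i j, i + 2 ≤ j → j < n → κ j (a i) = κ i (a j)) →
    (∀ i, i + 1 < n → κ i (κ (i + 1) (a i)) - a i = κ (i + 1) (κ i (a (i + 1))) - a (i + 1)) →
    ∃ w ∈ S, ∀ i < n, κ i w = a i := by
  induction n with
  | zero => exact fun _ _ _ _ _ _ => ⟨0, Submodule.zero_mem _, fun i hi => by omega⟩
  | succ n ih =>
    intro κ S h a ha hA hB hC
    obtain ⟨w, hw, hwa⟩ := ih h.shift (a := fun i => a (i + 1)) (fun i hi => ha _ (by omega))
      (fun i hi => hA _ (by omega)) (fun i j hij hj => hB _ _ (by omega) (by omega))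
      (fun i hi => hC _ (by omega))
    -- Induction solves the problem for the subgroup generated by τ_1, …, τ_n. Once the coboundary
    -- of w is subtracted, the cocycle is concentrated at τ_0.
    have hb : a 0 - κ 0 w ∈ S := sub_mem (ha 0 (by omega)) (h.mem 0 (by omega) w hw)
    obtain ⟨w', hw', hw0, hwi⟩ := h.exists_of_concentrated (a := a 0 - κ 0 w) (by omega) hb
      (by rw [map_sub, hA 0 (by omega), h.sq 0 (by omega) w hw, smul_sub])
      (fun hn => by
        have e1 := hC 0 hn
        have e2 := h.braid 0 hn w hw
        have e3 := hwa 0 (by omega)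
        simp only [zero_add] at e1 e2 e3
        rw [e3] at e2
        rw [map_sub, map_sub, sub_eq_iff_eq_add.1 e1, sub_eq_iff_eq_add.1 e2]
        abel)
      (fun j hj hjn => by
        obtain ⟨j, rfl⟩ : ∃ m, j = m + 1 := ⟨j - 1, by omega⟩
        rw [map_sub, hB 0 _ (by omega) hjn, ← h.far 0 _ (by omega) hjn w hw,
          hwa j (by omega), sub_self])
    refine ⟨w + w', add_mem hw hw', fun i hi => ?_⟩
    rcases i with _ | i
    · rw [map_add, hw0]; abel
    · rw [map_add, hwa i (by omega), hwi i hi, add_zero]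

end Cohomology

namespace Ten

variable {K : Type u} [Field K] {V : Type v} [AddCommGroup V] [Module K V]
variable {N : Type*} [AddCommGroup N] [Module K N]

/-! ### Adjacent transpositions acting on words. -/

section operators

/-- Words have zero, one, or at least two letters, and the first two letters may be taken
homogeneous by linearity. Identities between operators on the first two letters are checked in this
way, where the Koszul signs are explicit. -/
lemma cons_ext₂ (X : DGSpace K V) {f g : Ten K V →ₗ[K] N} (h1 : f 1 = g 1)
    (h2 : ∀ x, f (ι K x) = g (ι K x))
    (h3 : ∀ i j, ∀ x ∈ X.gr i, ∀ y ∈ X.gr j, ∀ t,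
      f (ι K x * (ι K y * t)) = g (ι K x * (ι K y * t))) : f = g := by
  refine cons_ext h1 fun x t => ?_
  have key : ∀ t, (f - g) (ι K x * t) = 0 := by
    have : (f - g) ∘ₗ LinearMap.mulLeft K (ι K x) = 0 := by
      refine cons_ext (by simp [h2]) fun y t => ?_
      have h4 : (f - g) ∘ₗ cons ∘ₗ cons.lTensor V ∘ₗ
          (TensorProduct.assoc K V V (Ten K V)).toLinearMap ∘ₗ
          (TensorProduct.mk K (V ⊗[K] V) (Ten K V)).flip t = 0 :=
        X.tensor_ext X fun i j x hx y hy => by simp [h3 i j x hx y hy t]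
      simpa using LinearMap.congr_fun h4 (x ⊗ₜ y)
    exact LinearMap.congr_fun this
  simpa [sub_eq_zero] using key t

/-- `x ⊗ y ⊗ t ↦ x y t`. -/
def cons₂ : V ⊗[K] (V ⊗[K] Ten K V) →ₗ[K] Ten K V := cons ∘ₗ cons.lTensor V

@[simp] lemma cons₂_tmul (x y : V) (t : Ten K V) :
    cons₂ (x ⊗ₜ[K] (y ⊗ₜ[K] t)) = ι K x * (ι K y * t) := by simp [cons₂]

/-- `x y t ↦ x ⊗ y ⊗ t`. -/
def uncons₂ : Ten K V →ₗ[K] V ⊗[K] (V ⊗[K] Ten K V) := uncons.lTensor V ∘ₗ uncons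

@[simp] lemma uncons₂_one : uncons₂ (1 : Ten K V) = 0 := by simp [uncons₂]

@[simp] lemma uncons₂_ι (x : V) : uncons₂ (ι K x) = 0 := by simp [uncons₂]

@[simp] lemma uncons₂_mul (x y : V) (t : Ten K V) :
    uncons₂ (ι K x * (ι K y * t)) = x ⊗ₜ[K] (y ⊗ₜ[K] t) := by simp [uncons₂]

variable (X : DGSpace K V)

lemma cons₂_isHom : (X.tensor (X.tensor (dg X))).IsHom (dg X) cons₂ :=
  (cons_isHom X).comp ((IsHom.id (X := X)).tensor (cons_isHom X))

lemma uncons₂_isHom : (dg X).IsHom (X.tensor (X.tensor (dg X))) uncons₂ :=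
  ((IsHom.id (X := X)).tensor (uncons_isHom X)).comp (uncons_isHom X)

/-- The operator `1 - τ`, where `τ` transposes the first two letters of a word (and is the identity
on words of length at most one). -/
def antisymm₀ : Ten K V →ₗ[K] Ten K V :=
  cons₂ ∘ₗ (LinearMap.id - X.swapLeft X (Ten K V)) ∘ₗ uncons₂

@[simp] lemma antisymm₀_one : antisymm₀ X 1 = 0 := by simp [antisymm₀]

@[simp] lemma antisymm₀_ι (x : V) : antisymm₀ X (ι K x) = 0 := by simp [antisymm₀]

lemma antisymm₀_mul {i j : ℤ} {x y : V} (hx : x ∈ X.gr i) (hy : y ∈ X.gr j) (t : Ten K V) :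
    antisymm₀ X (ι K x * (ι K y * t)) =
      ι K x * (ι K y * t) - sg K (i * j) • (ι K y * (ι K x * t)) := by
  simp [antisymm₀, X.swapLeft_tmul X hx hy]

lemma antisymm₀_isHom : (dg X).IsHom (dg X) (antisymm₀ X) :=
  (cons₂_isHom X).comp ((IsHom.id.sub (swapLeft_isHom X X (dg X))).comp (uncons₂_isHom X))

/-- The operator `1 - τᵢ`, where `τᵢ` transposes the letters `i` and `i + 1` of a word. -/
def antisymm : ℕ → Module.End K (Ten K V)
  | 0 => antisymm₀ X
  | i + 1 => up (antisymm i)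

lemma antisymm_isHom (i : ℕ) : (dg X).IsHom (dg X) (antisymm X i) := by
  induction i with
  | zero => exact antisymm₀_isHom X
  | succ i ih => exact up_isHom ih

@[simp] lemma antisymm_one (i : ℕ) : antisymm X i 1 = 0 := by
  cases i <;> simp [antisymm]

lemma antisymm₀_sq : antisymm₀ X ∘ₗ antisymm₀ X = (2 : K) • antisymm₀ X := by
  refine cons_ext₂ X (by simp) (by simp) fun i j x hx y hy t => ?_
  rw [LinearMap.smul_apply, two_smul]
  simp only [LinearMap.comp_apply, antisymm₀_mul X hx hy, map_sub, map_smul,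
    antisymm₀_mul X hy hx, smul_sub, smul_smul, mul_comm j i, sg_sq, one_smul]
  abel

lemma antisymm_sq (i : ℕ) : antisymm X i ∘ₗ antisymm X i = (2 : K) • antisymm X i := by
  induction i with
  | zero => exact antisymm₀_sq X
  | succ i ih => rw [antisymm, ← up_comp, ih, up_smul]

lemma antisymm₀_up_up (f : Ten K V →ₗ[K] Ten K V) :
    antisymm₀ X ∘ₗ up (up f) = up (up f) ∘ₗ antisymm₀ X := by
  refine cons_ext₂ X (by simp) (by simp) fun i j x hx y hy t => ?_
  simp [antisymm₀_mul X hx hy]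

lemma antisymm_far {i j : ℕ} (h : i + 2 ≤ j) :
    antisymm X i ∘ₗ antisymm X j = antisymm X j ∘ₗ antisymm X i := by
  obtain ⟨k, rfl⟩ := Nat.exists_eq_add_of_le h
  clear h
  induction i with
  | zero =>
    rw [show 0 + 2 + k = k + 2 by omega]
    exact antisymm₀_up_up X _
  | succ i ih =>
    rw [show i + 1 + 2 + k = (i + 2 + k) + 1 by omega, antisymm, antisymm, ← up_comp, ih, up_comp]

/-- The projection onto the words of length at least `k`. -/
def lenGE : ℕ → Ten K V →ₗ[K] Ten K V
  | 0 => LinearMap.id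
  | k + 1 => up (lenGE k)

lemma lenGE_succ_one (k : ℕ) : lenGE (k + 1) (1 : Ten K V) = 0 := up_one _

lemma cons_ext₃ (X : DGSpace K V) {f g : Ten K V →ₗ[K] N}
    (h : ∀ i j k, ∀ x ∈ X.gr i, ∀ y ∈ X.gr j, ∀ z ∈ X.gr k, ∀ t,
      f (ι K x * (ι K y * (ι K z * t))) = g (ι K x * (ι K y * (ι K z * t)))) :
    f ∘ₗ lenGE 3 = g ∘ₗ lenGE 3 := by
  refine cons_ext₂ X (by simp [lenGE]) (by simp [lenGE]) fun i j x hx y hy t => ?_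
  have : f ∘ₗ LinearMap.mulLeft K (ι K x) ∘ₗ LinearMap.mulLeft K (ι K y) ∘ₗ cons =
      g ∘ₗ LinearMap.mulLeft K (ι K x) ∘ₗ LinearMap.mulLeft K (ι K y) ∘ₗ cons := by
    refine X.tensor_ext (dg X) fun k l z hz t _ => ?_
    simpa using h i j k x hx y hy z hz t
  simpa [lenGE, up] using LinearMap.congr_fun this (uncons t)

/-- The truncation is necessary: on words of i + 2 letters `antisymm X (i + 1)` is zero while
`antisymm X i` need not be, and the two sides differ. -/
lemma antisymm_braid (i : ℕ) :
    (antisymm X i ∘ₗ antisymm X (i + 1) ∘ₗ antisymm X i - antisymm X i) ∘ₗ lenGE (i + 3) =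
    (antisymm X (i + 1) ∘ₗ antisymm X i ∘ₗ antisymm X (i + 1) - antisymm X (i + 1)) ∘ₗ
      lenGE (i + 3) := by
  induction i with
  | zero =>
    refine cons_ext₃ X fun i j k x hx y hy z hz t => ?_
    simp only [antisymm, LinearMap.comp_apply, LinearMap.sub_apply, antisymm₀_mul X hx hy,
      antisymm₀_mul X hx hz, antisymm₀_mul X hy hz, antisymm₀_mul X hy hx,
      antisymm₀_mul X hz hy,
      map_sub, map_smul, up_mul, mul_sub, mul_smul_comm, smul_sub, smul_smul]
    rw [mul_comm j i, mul_comm k j, sg_sq, sg_sq, one_smul,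
      show sg K (i * j) * sg K (i * k) * sg K (j * k) =
        sg K (j * k) * sg K (i * k) * sg K (i * j) by ring]
    abel
  | succ i ih =>
    have := congrArg up ih
    simp only [up_comp, up_sub] at this
    exact this

lemma lTensor_lenGE_uncons (k : ℕ) (t : Ten K V) :
    uncons (lenGE (k + 1) t) = (lenGE k).lTensor V (uncons t) := uncons_up _ _

end operators

/-! ### The cobracket in one letter and its relations with the transpositions. -/

section cobracket

variable (L : DGLieCoalgebra K V)

/-- The map `(x ⊗ y) ⊗ t ↦ x y t`. -/
def word₂ : V ⊗[K] V →ₗ[K] Ten K V →ₗ[K] Ten K V :=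
  TensorProduct.curry (cons₂ ∘ₗ (TensorProduct.assoc K V V (Ten K V)).toLinearMap)

@[simp] lemma word₂_tmul (x y : V) (t : Ten K V) :
    word₂ (x ⊗ₜ[K] y) t = ι K x * (ι K y * t) := by simp [word₂]

/-- The cobracket applied to the first letter. -/
def cobr₀ : Ten K V →ₗ[K] Ten K V :=
  cons₂ ∘ₗ (TensorProduct.assoc K V V (Ten K V)).toLinearMap ∘ₗ L.cobr.rTensor (Ten K V) ∘ₗ uncons

@[simp] lemma cobr₀_one : cobr₀ L 1 = 0 := by simp [cobr₀]

@[simp] lemma cobr₀_mul (x : V) (t : Ten K V) :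
    cobr₀ L (ι K x * t) = word₂ (L.cobr x) t := by simp [cobr₀, word₂]

lemma cobr₀_isHom : (dg L.toDGSpace).IsHom (dg L.toDGSpace) (cobr₀ L) :=
  (cons₂_isHom _).comp ((assoc_isHom _ _ _).comp
    ((L.cobr_isHom.tensor IsHom.id).comp (uncons_isHom _)))

/-- The cobracket applied to the letter `i`. -/
def cobrAt : ℕ → Module.End K (Ten K V)
  | 0 => cobr₀ L
  | i + 1 => up (cobrAt i)

lemma cobrAt_isHom (i : ℕ) : (dg L.toDGSpace).IsHom (dg L.toDGSpace) (cobrAt L i) := by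
  induction i with
  | zero => exact cobr₀_isHom L
  | succ i ih => exact up_isHom ih

@[simp] lemma cobrAt_one (i : ℕ) : cobrAt L i 1 = 0 := by
  cases i <;> simp [cobrAt]

lemma antisymm₀_word₂ {X : DGSpace K V} (u : V ⊗[K] V) (t : Ten K V) :
    antisymm₀ X (word₂ u t) = word₂ u t - word₂ (X.swap X u) t := by
  have : antisymm₀ X ∘ₗ word₂.flip t = word₂.flip t ∘ₗ (LinearMap.id - X.swap X) := by
    refine X.tensor_ext X fun i j x hx y hy => ?_
    simp [antisymm₀_mul X hx hy, X.swap_tmul X hx hy]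
  simpa using LinearMap.congr_fun this u

/-- Antisymmetry of δ gives τ_i δ_i = −δ_i. Later this is the order-two relation of the cocycle, and
the reason why δ_i vanishes in the symmetric algebra. -/
lemma antisymm_cobrAt (i : ℕ) :
    antisymm L.toDGSpace i ∘ₗ cobrAt L i = (2 : K) • cobrAt L i := by
  induction i with
  | zero =>
    refine cons_ext (by simp) fun x t => ?_
    rw [LinearMap.smul_apply, two_smul]
    simp [antisymm, cobrAt, antisymm₀_word₂, L.antisymm]
  | succ i ih => rw [antisymm, cobrAt, ← up_comp, ih, up_smul]

lemma up_up_word₂ (f : Ten K V →ₗ[K] Ten K V) (u : V ⊗[K] V) (t : Ten K V) :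
    up (up f) (word₂ u t) = word₂ u (f t) := by
  induction u using TensorProduct.induction_on with
  | zero => simp
  | tmul x y => simp
  | add a b ha hb => simp only [map_add, LinearMap.add_apply, map_add, ha, hb]

/-- The cobracket makes two letters out of the first one, so an operator acting behind one letter
then acts behind two. The shifts from j to j + 1 in the commutation rules come from this. -/
lemma up_up_cobr₀ (f : Ten K V →ₗ[K] Ten K V) : up (up f) ∘ₗ cobr₀ L = cobr₀ L ∘ₗ up f :=
  cons_ext (by simp) fun x t => by simp [up_up_word₂]

lemma antisymm_cobrAt_far {i j : ℕ} (h : i + 1 ≤ j) :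
    antisymm L.toDGSpace (j + 1) ∘ₗ cobrAt L i = cobrAt L i ∘ₗ antisymm L.toDGSpace j := by
  obtain ⟨k, rfl⟩ := Nat.exists_eq_add_of_le h
  clear h
  induction i with
  | zero =>
    rw [show 0 + 1 + k = k + 1 by omega]
    exact up_up_cobr₀ L _
  | succ i ih =>
    rw [show i + 1 + 1 + k = (i + 1 + k) + 1 by omega, antisymm, cobrAt, ← up_comp, ih, up_comp]
    rfl

lemma cobrAt_cobrAt_far {i j : ℕ} (h : i + 1 ≤ j) :
    cobrAt L (j + 1) ∘ₗ cobrAt L i = cobrAt L i ∘ₗ cobrAt L j := by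
  obtain ⟨k, rfl⟩ := Nat.exists_eq_add_of_le h
  clear h
  induction i with
  | zero =>
    rw [show 0 + 1 + k = k + 1 by omega]
    exact up_up_cobr₀ L _
  | succ i ih =>
    have := congrArg up ih
    simp only [up_comp] at this
    rw [show i + 1 + 1 + k = (i + 1 + k) + 1 by omega]
    exact this

lemma antisymm_cobrAt_far' {i j : ℕ} (h : i + 2 ≤ j) :
    antisymm L.toDGSpace i ∘ₗ cobrAt L j = cobrAt L j ∘ₗ antisymm L.toDGSpace i := by
  obtain ⟨k, rfl⟩ := Nat.exists_eq_add_of_le h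
  clear h
  induction i with
  | zero =>
    rw [show 0 + 2 + k = k + 2 by omega]
    exact antisymm₀_up_up _ _
  | succ i ih =>
    rw [show i + 1 + 2 + k = (i + 2 + k) + 1 by omega, antisymm, cobrAt, ← up_comp, ih, up_comp]

/-- Moving `δ xᵢ` past the letter `xᵢ₊₁`. -/
lemma transposition_cobrAt (i : ℕ) :
    (cobrAt L i - antisymm L.toDGSpace i ∘ₗ cobrAt L i - antisymm L.toDGSpace (i + 1) ∘ₗ cobrAt L i
      + antisymm L.toDGSpace i ∘ₗ antisymm L.toDGSpace (i + 1) ∘ₗ cobrAt L i) ∘ₗ lenGE (i + 2) =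
    (cobrAt L (i + 1) - cobrAt L (i + 1) ∘ₗ antisymm L.toDGSpace i) ∘ₗ lenGE (i + 2) := by
  induction i with
  | zero =>
    -- In terms of τ = 1 − κ the identity reads τ_i τ_{i+1} δ_i = δ_{i+1} τ_i. It can fail on words
    -- in which the letter i is the last, since nothing follows it; hence the truncation.
    refine cons_ext₂ L.toDGSpace (by simp [lenGE]) (by simp [lenGE]) fun i j x hx y hy t => ?_
    have hu := L.cobr_isHom.map_mem i x hx
    simp only [lenGE, LinearMap.comp_apply, up_mul, LinearMap.id_apply, LinearMap.sub_apply,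
      LinearMap.add_apply, antisymm, cobrAt, cobr₀_mul, antisymm₀_mul _ hx hy, map_sub, map_smul]
    generalize L.cobr y = v
    generalize L.cobr x = u at hu
    rw [sub_sub_cancel]
    induction hu using Submodule.span_induction with
    | mem u hu =>
      obtain ⟨a, b, rfl, z, hz, w, hw, rfl⟩ := hu
      simp only [word₂_tmul, up_mul, antisymm₀_mul _ hz hw, antisymm₀_mul _ hw hy, mul_sub,
        map_sub, antisymm₀_mul _ hz hy, mul_smul_comm, map_smul, smul_sub, smul_smul,
        add_mul, sg_add]
      rw [mul_comm (sg K (b * j))]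
      abel
    | zero => simp
    | add a b _ _ ha hb =>
      simp only [map_add, LinearMap.add_apply, mul_add, smul_add, ← ha, ← hb]
      abel
    | smul c a _ ha =>
      simp only [map_smul, LinearMap.smul_apply, mul_smul_comm]
      rw [smul_comm _ c, ← ha]
      simp only [smul_add, smul_sub]
  | succ i ih =>
    have := congrArg up ih
    simp only [up_comp, up_sub, up_add] at this
    exact this

/-- The map `x ⊗ (y ⊗ z) ↦ x y z t`. -/
def word₃ (t : Ten K V) : V ⊗[K] (V ⊗[K] V) →ₗ[K] Ten K V :=
  cons ∘ₗ (word₂.flip t).lTensor V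

@[simp] lemma word₃_tmul (t : Ten K V) (x : V) (u : V ⊗[K] V) :
    word₃ t (x ⊗ₜ u) = ι K x * word₂ u t := by simp [word₃]

lemma cobr₀_word₂ (u : V ⊗[K] V) (t : Ten K V) :
    cobr₀ L (word₂ u t) =
      word₃ t (TensorProduct.assoc K V V V (L.cobr.rTensor V u)) := by
  induction u using TensorProduct.induction_on with
  | zero => simp
  | tmul x y =>
    rw [word₂_tmul, cobr₀_mul, LinearMap.rTensor_tmul]
    generalize L.cobr x = v
    induction v using TensorProduct.induction_on with
    | zero => simp
    | tmul p q => simp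
    | add a b ha hb => simp only [map_add, LinearMap.add_apply, TensorProduct.add_tmul, ha, hb]
  | add a b ha hb => simp only [map_add, LinearMap.add_apply, ha, hb]

lemma up_cobr₀_word₂ (u : V ⊗[K] V) (t : Ten K V) :
    up (cobr₀ L) (word₂ u t) = word₃ t (L.cobr.lTensor V u) := by
  induction u using TensorProduct.induction_on with
  | zero => simp
  | tmul x y => simp
  | add a b ha hb => simp only [map_add, LinearMap.add_apply, ha, hb]

lemma antisymm₀_word₃ {X : DGSpace K V} (u : V ⊗[K] (V ⊗[K] V)) (t : Ten K V) :
    antisymm₀ X (word₃ t u) = word₃ t (u - X.swapLeft X V u) := by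
  have : antisymm₀ X ∘ₗ word₃ t = word₃ t ∘ₗ (LinearMap.id - X.swapLeft X V) := by
    refine X.tensor_ext (X.tensor X) fun i n x hx u hu => ?_
    induction hu using Submodule.span_induction with
    | mem u hu =>
      obtain ⟨a, b, rfl, z, hz, w, hw, rfl⟩ := hu
      simp [antisymm₀_mul X hx hz, X.swapLeft_tmul X hx hz]
    | zero => simp
    | add a b _ _ ha hb => simp only [map_add, TensorProduct.tmul_add, ha, hb]
    | smul c a _ ha => simp only [map_smul, TensorProduct.tmul_smul, ha]
  exact LinearMap.congr_fun this u

/-- The co-Jacobi identity. -/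
lemma cobrAt_cobrAt (i : ℕ) :
    cobrAt L i ∘ₗ cobrAt L i =
      antisymm L.toDGSpace i ∘ₗ cobrAt L (i + 1) ∘ₗ cobrAt L i := by
  induction i with
  | zero =>
    refine cons_ext (by simp) fun x t => ?_
    simp only [cobrAt, antisymm, LinearMap.comp_apply, cobr₀_mul]
    rw [cobr₀_word₂, up_cobr₀_word₂, antisymm₀_word₃, L.coJacobi]
  | succ i ih =>
    have := congrArg up ih
    simp only [up_comp] at this
    exact this

end cobracket

/-! ### Components of words by length. -/

section length

lemma lenGE_comp (n : ℕ) :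
    lenGE (K := K) (V := V) (n + 1) ∘ₗ lenGE n = lenGE (n + 1) := by
  induction n with
  | zero => rfl
  | succ n ih => exact (up_comp _ _).symm.trans (congrArg up ih)

lemma ker_lenGE_mono : Monotone fun n => LinearMap.ker (lenGE (K := K) (V := V) n) := by
  refine monotone_nat_of_le_succ fun n t ht => ?_
  rw [LinearMap.mem_ker] at ht ⊢
  rw [← lenGE_comp, LinearMap.comp_apply, ht, map_zero]

lemma exists_lenGE_eq_zero (t : Ten K V) : ∃ n, lenGE n t = 0 := by
  have top : (⨆ n, LinearMap.ker (lenGE (K := K) (V := V) n)) = ⊤ := by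
    refine eq_top_of (Submodule.mem_iSup_of_mem 1 (lenGE_succ_one 0)) fun x a ha => ?_
    rw [Submodule.mem_iSup_of_directed _ ker_lenGE_mono.directed_le] at ha ⊢
    obtain ⟨n, hn⟩ := ha
    refine ⟨n + 1, ?_⟩
    rw [LinearMap.mem_ker] at hn ⊢
    rw [lenGE, up_mul, hn, mul_zero]
  have ht : t ∈ ⨆ n, LinearMap.ker (lenGE (K := K) (V := V) n) := by rw [top]; trivial
  rwa [Submodule.mem_iSup_of_directed _ ker_lenGE_mono.directed_le] at ht

/-- The projection onto the words of length `k`. -/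
def lenEQ : ℕ → Ten K V →ₗ[K] Ten K V
  | 0 => LinearMap.id - plus
  | k + 1 => up (lenEQ k)

lemma lenEQ_eq (k : ℕ) : lenEQ (K := K) (V := V) k = lenGE k - lenGE (k + 1) := by
  induction k with
  | zero => rfl
  | succ k ih => exact (congrArg up ih).trans (up_sub _ _)

/-- A tensor is zero if its components of all lengths are. -/
lemma eq_zero_of_lenEQ {W : Type*} [AddCommGroup W] [Module K W] {z : Ten K V ⊗[K] W}
    (h : ∀ k, (lenEQ k).rTensor W z = 0) : z = 0 := by
  have h1 : ∃ n, (lenGE n).rTensor W z = 0 := by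
    clear h
    induction z using TensorProduct.induction_on with
    | zero => exact ⟨0, map_zero _⟩
    | tmul a b =>
      obtain ⟨n, hn⟩ := exists_lenGE_eq_zero a
      exact ⟨n, by simp [hn]⟩
    | add a b ha hb =>
      obtain ⟨n, hn⟩ := ha
      obtain ⟨m, hm⟩ := hb
      have hle : ∀ n m, n ≤ m → ∀ y, (lenGE n).rTensor W y = 0 →
          (lenGE (K := K) (V := V) m).rTensor W y = 0 := by
        intro n m h y hy
        induction m, h using Nat.le_induction with
        | base => exact hy
        | succ m _ ih => rw [← lenGE_comp, LinearMap.rTensor_comp, LinearMap.comp_apply, ih,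
            map_zero]
      exact ⟨max n m, by rw [map_add, hle _ _ (le_max_left _ _) _ hn,
        hle _ _ (le_max_right _ _) _ hm, add_zero]⟩
  have h2 : ∀ n, (lenGE n).rTensor W z = z := by
    intro n
    induction n with
    | zero => simp [lenGE]
    | succ n ih =>
      have := h n
      rw [lenEQ_eq, LinearMap.rTensor_sub, LinearMap.sub_apply, ih, sub_eq_zero] at this
      exact this.symm
  obtain ⟨n, hn⟩ := h1
  rw [← h2 n, hn]

end length

/-! ### The envelope as a subcoalgebra of the tensor coalgebra. -/

section conditions

variable (L : DGLieCoalgebra K V)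

/-- The operators that cut out the universal enveloping coalgebra: a tensor `w` is in it if
antisymmetrizing `w` in the letters `i` and `i + 1` gives the cobracket of `w` in the letter `i`. -/
def cond (i : ℕ) : Ten K V →ₗ[K] Ten K V := antisymm L.toDGSpace i - cobrAt L i

lemma cond_succ (i : ℕ) : cond L (i + 1) = up (cond L i) := (up_sub _ _).symm

lemma cond_zero : cond L 0 = antisymm₀ L.toDGSpace - cobr₀ L := rfl

@[simp] lemma cond_one (i : ℕ) : cond L i 1 = 0 := by simp [cond]

lemma cond_isHom (i : ℕ) : (dg L.toDGSpace).IsHom (dg L.toDGSpace) (cond L i) :=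
  (antisymm_isHom _ i).sub (cobrAt_isHom L i)

@[simp] lemma aug_cond (i : ℕ) (t : Ten K V) : aug (cond L i t) = 0 := by
  cases i with
  | zero => simp [cond_zero, antisymm₀, cobr₀, cons₂]
  | succ i => rw [cond_succ, aug_up]

lemma up_rTensor_lmul {W : Type*} [AddCommGroup W] [Module K W] (f : Ten K V →ₗ[K] Ten K V)
    (x : V) (z : Ten K V ⊗[K] W) :
    (up f).rTensor W (lmul W x z) = lmul W x (f.rTensor W z) := by
  rw [rTensor_lmul (g := LinearMap.mulLeft K (ι K x) ∘ₗ f) (by simp), LinearMap.rTensor_comp]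
  rfl

lemma lmul_lmul {W : Type*} [AddCommGroup W] [Module K W] (x y : V) (z : Ten K V ⊗[K] W) :
    lmul W x (lmul W y z) = (word₂ (x ⊗ₜ[K] y)).rTensor W z := by
  have : lmul W x ∘ₗ lmul W y = (word₂ (x ⊗ₜ[K] y)).rTensor W :=
    TensorProduct.ext' fun a b => by simp
  exact LinearMap.congr_fun this z

lemma rTensor_word₂ {W W' : Type*} [AddCommGroup W] [Module K W] [AddCommGroup W'] [Module K W']
    {f : Ten K V →ₗ[K] W'} {u : V ⊗[K] V} {g : Ten K V →ₗ[K] W'} (h : ∀ a, f (word₂ u a) = g a)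
    (z : Ten K V ⊗[K] W) : f.rTensor W ((word₂ u).rTensor W z) = g.rTensor W z := by
  have : f.rTensor W ∘ₗ (word₂ u).rTensor W = g.rTensor W :=
    TensorProduct.ext' fun a b => by simp [h]
  exact LinearMap.congr_fun this z

lemma lenGE_two_word₂ (u : V ⊗[K] V) (a : Ten K V) : lenGE 2 (word₂ u a) = word₂ u a :=
  up_up_word₂ LinearMap.id u a

lemma lenGE_comul_word₂ (u : V ⊗[K] V) (t : Ten K V) :
    (lenGE 2).rTensor _ (comul (word₂ u t)) =
      (word₂ u).rTensor _ (comul t) + word₂ u 1 ⊗ₜ[K] plus t := by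
  induction u using TensorProduct.induction_on with
  | zero => simp
  | tmul x y =>
    simp only [word₂_tmul, comul_mul, map_add, lmul_lmul, LinearMap.rTensor_tmul, lmul_tmul]
    rw [rTensor_word₂ (lenGE_two_word₂ _)]
    simp [lenGE]
  | add a b ha hb =>
    simp only [map_add, LinearMap.add_apply, ha, hb, LinearMap.rTensor_add, TensorProduct.add_tmul]
    abel

lemma rTensor_antisymm₀_comul {X : DGSpace K V} (t : Ten K V) :
    (antisymm₀ X).rTensor _ (comul t) = (lenGE 2).rTensor _ (comul (antisymm₀ X t)) := by
  have : (antisymm₀ X).rTensor (Ten K V) ∘ₗ comul =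
      (lenGE 2).rTensor (Ten K V) ∘ₗ comul ∘ₗ antisymm₀ X := by
    refine cons_ext₂ X (by simp) (by simp) fun i j x _ y _ t => ?_
    have h1 : ∀ a, antisymm₀ X (word₂ (x ⊗ₜ[K] y) a) =
        word₂ (x ⊗ₜ[K] y - X.swap X (x ⊗ₜ[K] y)) a := by
      intro a; rw [antisymm₀_word₂, map_sub, LinearMap.sub_apply]
    have h2 := h1 1
    rw [word₂_tmul, mul_one] at h2
    simp only [LinearMap.comp_apply]
    rw [← word₂_tmul, h1, lenGE_comul_word₂, word₂_tmul]
    simp only [comul_mul, map_add, lmul_lmul, LinearMap.rTensor_tmul, lmul_tmul, plus_mul, h2,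
      antisymm₀_ι, TensorProduct.zero_tmul, add_zero]
    rw [rTensor_word₂ h1]
  exact LinearMap.congr_fun this t

lemma rTensor_cobr₀_comul (t : Ten K V) :
    (cobr₀ L).rTensor _ (comul t) = (lenGE 2).rTensor _ (comul (cobr₀ L t)) := by
  have : (cobr₀ L).rTensor (Ten K V) ∘ₗ comul =
      (lenGE 2).rTensor (Ten K V) ∘ₗ comul ∘ₗ cobr₀ L := by
    refine cons_ext (by simp) fun x t => ?_
    have h1 : cobr₀ L (ι K x) = word₂ (L.cobr x) 1 := by simpa using cobr₀_mul L x 1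
    simp only [LinearMap.comp_apply, cobr₀_mul, lenGE_comul_word₂, comul_mul, map_add,
      LinearMap.rTensor_tmul, h1]
    rw [rTensor_lmul (cobr₀_mul L x)]
  exact LinearMap.congr_fun this t

/-- After the operator has acted, a cut has the places i and i + 1 both on its left exactly when the
left factor has at least i + 2 letters. The remaining cuts have no counterpart when the operator
acts on the left factor alone, and the truncation discards them. -/
lemma rTensor_cond_comul (i : ℕ) (t : Ten K V) :
    (cond L i).rTensor _ (comul t) = (lenGE (i + 2)).rTensor _ (comul (cond L i t)) := by
  induction i generalizing t with
  | zero =>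
    rw [cond_zero, LinearMap.rTensor_sub, LinearMap.sub_apply, rTensor_antisymm₀_comul,
      rTensor_cobr₀_comul, LinearMap.sub_apply, map_sub, map_sub]
  | succ i ih =>
    rw [cond_succ]
    have : (up (cond L i)).rTensor (Ten K V) ∘ₗ comul =
        (lenGE (i + 1 + 2)).rTensor (Ten K V) ∘ₗ comul ∘ₗ up (cond L i) := by
      refine cons_ext (by simp) fun x t => ?_
      have h1 : lenGE (i + 1 + 2) = up (lenGE (K := K) (V := V) (i + 2)) := rfl
      simp only [LinearMap.comp_apply, comul_mul, up_mul, map_add, h1, up_rTensor_lmul, ih,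
        LinearMap.rTensor_tmul, up_ι, cond_one, lenGE_succ_one, mul_zero, TensorProduct.zero_tmul]
    exact LinearMap.congr_fun this t

/-- Behind a left factor of exactly k letters, place i of the right factor is place i + k of the
whole word. The shift depends on k, so the lengths of the left factor are separated and recombined
by `eq_zero_of_lenEQ`. -/
lemma map_lenEQ_cond_comul (k i : ℕ) (t : Ten K V) :
    (lenEQ k).rTensor _ ((cond L i).lTensor _ (comul t)) =
      (lenEQ k).rTensor _ (comul (cond L (i + k) t)) := by
  induction k generalizing t with
  | zero =>
    have h0 : ∀ t : Ten K V, (lenEQ 0).rTensor (Ten K V) (comul t) = 0 :=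
      fun t => rTensor_eq_zero_of_aug (fun t => by
        rw [lenEQ, LinearMap.sub_apply, plus_of_aug (t := plus t) (aug_up _ _)]
        simp) t
    rw [h0, ← LinearMap.comp_apply, LinearMap.rTensor_comp_lTensor,
      ← LinearMap.lTensor_comp_rTensor, LinearMap.comp_apply, h0, map_zero]
  | succ k ih =>
    have : (lenEQ (k + 1)).rTensor (Ten K V) ∘ₗ (cond L i).lTensor (Ten K V) ∘ₗ comul =
        (lenEQ (k + 1)).rTensor (Ten K V) ∘ₗ comul ∘ₗ cond L (i + k + 1) := by
      refine cons_ext (by simp) fun x t => ?_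
      simp only [LinearMap.comp_apply, comul_mul, map_add, cond_succ, up_mul, lmul_map, lenEQ,
        up_rTensor_lmul, ih, LinearMap.rTensor_tmul, LinearMap.lTensor_tmul, up_ι]
      congr 1
      cases k with
      | zero =>
        rw [apply_plus (cond_one L i), plus_of_aug (aug_cond L _ _)]
        rfl
      | succ k => simp [lenEQ]
    exact LinearMap.congr_fun this t

/-- The universal enveloping coalgebra, as a subspace of the cofree coalgebra. -/
def envelope : Submodule K (Ten K V) := LinearMap.ker aug ⊓ ⨅ i, LinearMap.ker (cond L i)

variable {L} in
lemma mem_envelope {t : Ten K V} : t ∈ envelope L ↔ aug t = 0 ∧ ∀ i, cond L i t = 0 := by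
  simp [envelope]

/-- The defining operators are dg morphisms, so their common kernel is stable under projections and
differential. For the slices, the conditions at all places are needed together: place i of a right
factor may be any later place of the word. -/
lemma envelope_isSub : (coalgebra L.toDGSpace).IsSub (envelope L) where
  proj_mem n x hx := by
    rw [mem_envelope] at hx ⊢
    have h := (plus_isHom L.toDGSpace).map_proj n x
    rw [plus_of_aug hx.1] at h
    change plus ((dg L.toDGSpace).proj n x) = (dg L.toDGSpace).proj n x at h
    refine ⟨?_, fun i => ?_⟩
    · change aug ((dg L.toDGSpace).proj n x) = 0
      rw [← h]; exact aug_up _ _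
    · refine ((cond_isHom L i).map_proj n x).trans ?_
      rw [hx.2, map_zero]
  d_mem x hx := by
    rw [mem_envelope] at hx ⊢
    refine ⟨aug_d _ _, fun i => ?_⟩
    refine ((cond_isHom L i).map_d x).trans ?_
    rw [hx.2, map_zero]
  left x hx φ := by
    rw [mem_envelope] at hx ⊢
    change aug (rslice φ (comul x)) = 0 ∧ ∀ i, cond L i (rslice φ (comul x)) = 0
    refine ⟨?_, fun i => ?_⟩
    · rw [← rslice_rTensor, rTensor_eq_zero_of_aug (fun t => aug_up _ t), map_zero]
    · rw [← rslice_rTensor, rTensor_cond_comul, hx.2]; simp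
  right x hx φ := by
    rw [mem_envelope] at hx ⊢
    change aug (rslice φ (TensorProduct.comm K _ _ (comul x))) = 0 ∧
      ∀ i, cond L i (rslice φ (TensorProduct.comm K _ _ (comul x))) = 0
    refine ⟨?_, fun i => ?_⟩
    · have h : plus (rslice φ (TensorProduct.comm K _ _ (comul x))) =
          rslice φ (TensorProduct.comm K _ _ (comul x)) := by
        rw [← rslice_comm_lTensor, lTensor_plus_comul]
      rw [← h]; exact aug_up _ _
    · rw [← rslice_comm_lTensor]
      -- For left factors of length k the condition at place i + k of x is used.
      have : (cond L i).lTensor (Ten K V) (comul x) = 0 := eq_zero_of_lenEQ fun k => by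
        rw [map_lenEQ_cond_comul, hx.2]; simp
      simp [this]

/-- The universal enveloping conilpotent coalgebra. -/
def enveloping : DGCoalgebra K (envelope L) := (envelope_isSub L).toDGCoalgebra

/-- The projection of the universal enveloping coalgebra to the Lie coalgebra. -/
def envelopingProj : envelope L →ₗ[K] V := fst ∘ₗ (envelope L).subtype

lemma enveloping_conilpotent : Conilpotent (enveloping L).comul :=
  (envelope_isSub L).conilpotent (Ten.conilpotent K V)

lemma enveloping_incl_isHom :
    (enveloping L).IsHom (coalgebra L.toDGSpace) (envelope L).subtype :=
  (envelope_isSub L).incl_isHom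

lemma envelopingProj_dg_isHom : (enveloping L).toDGSpace.IsHom L.toDGSpace (envelopingProj L) :=
  (fst_isHom L.toDGSpace).comp (enveloping_incl_isHom L).toIsHom

lemma rTensor_fst_comul_mul (x : V) (t : Ten K V) :
    fst.rTensor _ (comul (ι K x * t)) = x ⊗ₜ[K] plus t := by
  rw [comul_mul, map_add, rTensor_lmul (g := (LinearMap.toSpanSingleton K V x) ∘ₗ aug) (by simp),
    rTensor_eq_zero_of_aug (f := (LinearMap.toSpanSingleton K V x) ∘ₗ aug)
      (fun t => by simp [plus])]
  simp

/-- The part of length two. -/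
def fst₂ : Ten K V →ₗ[K] V ⊗[K] V := TensorProduct.map fst fst ∘ₗ comul

@[simp] lemma fst₂_mul (x : V) (t : Ten K V) : fst₂ (ι K x * t) = x ⊗ₜ[K] fst t := by
  rw [fst₂, LinearMap.comp_apply, ← LinearMap.lTensor_comp_rTensor, LinearMap.comp_apply,
    rTensor_fst_comul_mul, LinearMap.lTensor_tmul, fst_plus]

@[simp] lemma fst₂_one : fst₂ (1 : Ten K V) = 0 := by simp [fst₂]

lemma fst₂_word₂ (u : V ⊗[K] V) (t : Ten K V) : fst₂ (word₂ u t) = aug t • u := by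
  induction u using TensorProduct.induction_on with
  | zero => simp
  | tmul x y => simp
  | add a b ha hb => simp only [map_add, LinearMap.add_apply, ha, hb, smul_add]

/-- On the envelope the left side vanishes, and the identity then says that the projection to one
letter turns the cocommutator into the cobracket. -/
lemma fst₂_cond (t : Ten K V) :
    fst₂ (cond L 0 t) = fst₂ t - L.swap L.toDGSpace (fst₂ t) - L.cobr (fst t) := by
  have h1 : fst₂ (antisymm₀ L.toDGSpace t) = fst₂ t - L.swap L.toDGSpace (fst₂ t) := by
    have : fst₂ ∘ₗ antisymm₀ L.toDGSpace = fst₂ - L.swap L.toDGSpace ∘ₗ fst₂ := by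
      refine cons_ext₂ L.toDGSpace (by simp) (fun x => ?_) fun i j x hx y hy t => ?_
      · have := fst₂_mul x (1 : Ten K V)
        rw [mul_one, fst_one, TensorProduct.tmul_zero] at this
        simp [this]
      · simp [antisymm₀_mul _ hx hy, L.swap_tmul _ hx hy, smul_comm (aug t)]
    exact LinearMap.congr_fun this t
  have h2 : fst₂ (cobr₀ L t) = L.cobr (fst t) := by
    have : fst₂ ∘ₗ cobr₀ L = L.cobr ∘ₗ fst :=
      cons_ext (by simp) fun x t => by simp [fst₂_word₂]
    exact LinearMap.congr_fun this t
  rw [cond_zero, LinearMap.sub_apply, map_sub, h1, h2]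

lemma envelopingProj_isHom : (enveloping L).toLie.IsHom L (envelopingProj L) where
  toIsHom := envelopingProj_dg_isHom L
  map_cobr w := by
    have hp := envelopingProj_dg_isHom L
    have h1 : TensorProduct.map (envelopingProj L) (envelopingProj L) ((enveloping L).comul w) =
        fst₂ (w : Ten K V) := by
      rw [envelopingProj, TensorProduct.map_comp, LinearMap.comp_apply]
      exact congrArg (TensorProduct.map fst fst) ((envelope_isSub L).map_comul w)
    change L.cobr (fst (w : Ten K V)) = TensorProduct.map (envelopingProj L) (envelopingProj L)
      ((enveloping L).comul w - (enveloping L).swap (enveloping L).toDGSpace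
        ((enveloping L).comul w))
    rw [map_sub, ← swap_natural hp hp, h1]
    have := fst₂_cond L w
    rw [(mem_envelope.1 w.2).2, map_zero] at this
    exact (sub_eq_zero.1 this.symm).symm

end conditions

/-! ### The universal property. -/

section universal

@[simp] lemma aug_ι (x : V) : aug (ι K x) = 0 := by simpa using aug_mul (K := K) x 1

lemma comul_cons (u : V ⊗[K] Ten K V) :
    comul (cons u) = cons.rTensor _ ((TensorProduct.assoc K _ _ _).symm (comul.lTensor V u)) +
      TensorProduct.map (ι K) plus u := by
  have : comul ∘ₗ cons = cons.rTensor _ ∘ₗ (TensorProduct.assoc K V (Ten K V) (Ten K V)).symm ∘ₗ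
      comul.lTensor V + TensorProduct.map (ι K) plus := by
    refine TensorProduct.ext' fun x t => ?_
    simp only [LinearMap.comp_apply, LinearMap.add_apply, cons_tmul, comul_mul,
      LinearMap.lTensor_tmul, TensorProduct.map_tmul, LinearEquiv.coe_coe]
    congr 1
    generalize comul t = z
    induction z using TensorProduct.induction_on with
    | zero => simp
    | tmul a b => simp
    | add a b ha hb => simp only [map_add, TensorProduct.tmul_add, ha, hb]
  exact LinearMap.congr_fun this u

/-- A word is recovered from its first letter and the rest, and the cut behind the first letter is
part of the coproduct. Hence a coalgebra morphism into words without constant term obeys the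
recursion in `exists_coalgebra_isHom`. -/
lemma plus_eq_cons (t : Ten K V) : plus t = ι K (fst t) + cons (fst.rTensor _ (comul t)) := by
  have : plus = ι K ∘ₗ fst + cons ∘ₗ fst.rTensor _ ∘ₗ comul (K := K) (V := V) := by
    refine cons_ext (by simp) fun x t => ?_
    simp only [LinearMap.add_apply, LinearMap.comp_apply, rTensor_fst_comul_mul, plus_mul, fst_mul,
      cons_tmul]
    rw [plus_eq, mul_sub, mul_smul_comm, mul_one, map_smul, add_sub_cancel]
  exact LinearMap.congr_fun this t

lemma up_cons (f : Ten K V →ₗ[K] Ten K V) (u : V ⊗[K] Ten K V) :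
    up f (cons u) = cons (f.lTensor V u) := by simp [up, uncons_cons]

lemma antisymm₀_lift_word₂ {X : DGSpace K V} (z : (V ⊗[K] V) ⊗[K] Ten K V) :
    antisymm₀ X (TensorProduct.lift word₂ z) =
      TensorProduct.lift word₂ ((LinearMap.id - X.swap X).rTensor _ z) := by
  have : antisymm₀ X ∘ₗ TensorProduct.lift word₂ =
      TensorProduct.lift word₂ ∘ₗ (LinearMap.id - X.swap X).rTensor (Ten K V) :=
    TensorProduct.ext' fun u t => by simp [antisymm₀_word₂]
  exact LinearMap.congr_fun this z

lemma cobr₀_cons (L : DGLieCoalgebra K V) (z : V ⊗[K] Ten K V) :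
    cobr₀ L (cons z) = TensorProduct.lift word₂ (L.cobr.rTensor _ z) := by
  have : cobr₀ L ∘ₗ cons = TensorProduct.lift word₂ ∘ₗ L.cobr.rTensor (Ten K V) :=
    TensorProduct.ext' fun x t => by simp
  exact LinearMap.congr_fun this z

variable {D : Type w} [AddCommGroup D] [Module K D]

/-- The tensor coalgebra is cofree among conilpotent coalgebras. -/
lemma exists_coalgebra_isHom {X : DGSpace K V} {B : DGCoalgebra K D} (hB : Conilpotent B.comul)
    {f : D →ₗ[K] V} (hf : B.toDGSpace.IsHom X f) :
    ∃ g : D →ₗ[K] Ten K V, B.IsHom (coalgebra X) g ∧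
      ∀ x, g x = ι K (f x) + cons (TensorProduct.map f g (B.comul x)) := by
  obtain ⟨g, hg⟩ := hB.exists_eventually_recApprox (ι K ∘ₗ f) (cons ∘ₗ f.rTensor (Ten K V))
  have hrec : ∀ x, g x = ι K (f x) + cons (TensorProduct.map f g (B.comul x)) := by
    intro x
    have h := hB.recApprox_limit hg x
    rwa [LinearMap.comp_apply, LinearMap.comp_apply, ← LinearMap.comp_apply (f := f.rTensor _),
      LinearMap.rTensor_comp_lTensor] at h
  -- At each vector the limit equals a finite stage, so degree and differential are checked on the
  -- stages.
  have happrox : ∀ n, B.toDGSpace.IsHom (dg X)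
      (recApprox B.comul (ι K ∘ₗ f) (cons ∘ₗ f.rTensor (Ten K V)) n) := by
    intro n
    induction n with
    | zero => exact IsHom.zero
    | succ n ih =>
      exact ((ι_isHom X).comp hf).add (((cons_isHom X).comp (hf.tensor .id)).comp
        ((IsHom.id.tensor ih).comp B.comul_isHom))
  refine ⟨g, ⟨⟨fun i x hx => ?_, fun x => ?_⟩, fun x => ?_⟩, hrec⟩
  · obtain ⟨n, hn⟩ := hg x
    rw [hn n le_rfl]
    exact (happrox n).map_mem i x hx
  · obtain ⟨n, hn⟩ := hg x
    obtain ⟨m, hm⟩ := hg (B.d x)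
    rw [hn (max n m) (le_max_left _ _), hm (max n m) (le_max_right _ _)]
    exact (happrox _).map_d x
  · have haug : plus ∘ₗ g = g := by
      refine LinearMap.ext fun x => plus_of_aug ?_
      rw [hrec]; simp
    have hg' : g = ι K ∘ₗ f + cons ∘ₗ TensorProduct.map f g ∘ₗ B.comul := LinearMap.ext hrec
    change comul (g x) = TensorProduct.map g g (B.comul x)
    refine hB.induction (S := LinearMap.eqLocus (comul ∘ₗ g) (TensorProduct.map g g ∘ₗ B.comul))
      (fun x hx => ?_) x
    have h1 := lTensor_congr_of_mem_range hx fun y hy => hy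
    rw [LinearMap.lTensor_comp, LinearMap.comp_apply, LinearMap.lTensor_comp,
      LinearMap.comp_apply, ← B.coassoc] at h1
    have h2 : comul.lTensor V (TensorProduct.map f g (B.comul x)) =
        f.rTensor _ (comul.lTensor D (g.lTensor D (B.comul x))) := by
      rw [← LinearMap.comp_apply, ← LinearMap.comp_apply (f := comul.lTensor D),
        ← LinearMap.lTensor_comp, ← LinearMap.comp_apply (f := f.rTensor _),
        LinearMap.rTensor_comp_lTensor, LinearMap.lTensor_comp_map]
    have h3 : ∀ z : (D ⊗[K] D) ⊗[K] D, cons.rTensor (Ten K V)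
        ((TensorProduct.assoc K V (Ten K V) (Ten K V)).symm (f.rTensor _
          ((TensorProduct.map g g).lTensor D (TensorProduct.assoc K D D D z)))) =
        TensorProduct.map (cons ∘ₗ TensorProduct.map f g) g z := by
      intro z
      have : cons.rTensor (Ten K V) ∘ₗ
          (TensorProduct.assoc K V (Ten K V) (Ten K V)).symm.toLinearMap ∘ₗ f.rTensor _ ∘ₗ
          (TensorProduct.map g g).lTensor D ∘ₗ (TensorProduct.assoc K D D D).toLinearMap =
          TensorProduct.map (cons ∘ₗ TensorProduct.map f g) g :=
        TensorProduct.ext_threefold fun a b c => by simp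
      exact LinearMap.congr_fun this z
    have h4 : TensorProduct.map g g (B.comul x) = TensorProduct.map (ι K ∘ₗ f) g (B.comul x) +
        TensorProduct.map (cons ∘ₗ TensorProduct.map f g) g (B.comul.rTensor D (B.comul x)) := by
      conv_lhs => rw [show TensorProduct.map g g =
        TensorProduct.map (ι K ∘ₗ f + cons ∘ₗ TensorProduct.map f g ∘ₗ B.comul) g by rw [← hg']]
      rw [TensorProduct.map_add_left, LinearMap.add_apply, ← LinearMap.comp_assoc]
      congr 1
      rw [← LinearMap.comp_apply (g := B.comul.rTensor D), LinearMap.map_comp_rTensor]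
    rw [LinearMap.mem_eqLocus, LinearMap.comp_apply, LinearMap.comp_apply, hrec, map_add, comul_ι,
      zero_add, comul_cons, h2, h1, h3, h4, add_comm, ← LinearMap.comp_apply,
      ← TensorProduct.map_comp, haug]

/-- Unfolded twice, the recursion shows that the first two letters of g come from (f ⊗ f)Δ, and (1 −
τ)(f ⊗ f)Δ = δf because f is a Lie morphism; this settles place 0. Behind the first letter the
recursion contains g again, so the later places follow by induction. -/
lemma cond_eq_zero {L : DGLieCoalgebra K V} {B : DGCoalgebra K D} {f : D →ₗ[K] V}
    (hf : B.toLie.IsHom L f) {g : D →ₗ[K] Ten K V}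
    (hg : ∀ x, g x = ι K (f x) + cons (TensorProduct.map f g (B.comul x))) (i : ℕ) (x : D) :
    cond L i (g x) = 0 := by
  have hg' : g = ι K ∘ₗ f + cons ∘ₗ TensorProduct.map f g ∘ₗ B.comul := LinearMap.ext hg
  induction i generalizing x with
  | zero =>
    have hcobr : (LinearMap.id - L.swap L.toDGSpace) ∘ₗ TensorProduct.map f f ∘ₗ B.comul =
        L.cobr ∘ₗ f := by
      refine LinearMap.ext fun y => ?_
      have h := swap_natural hf.toIsHom hf.toIsHom (B.comul y)
      simp only [LinearMap.comp_apply, LinearMap.sub_apply, LinearMap.id_apply, hf.map_cobr y]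
      rw [h, ← map_sub]
      rfl
    -- The recursion is substituted for the second factor only; coassociativity then groups the
    -- first two letters as (f ⊗ f)Δ of one element.
    have h1 : TensorProduct.map f g (B.comul x) = (ι K).lTensor V (TensorProduct.map f f (B.comul x))
        + cons.lTensor V (TensorProduct.map f (TensorProduct.map f g)
          (TensorProduct.assoc K D D D (B.comul.rTensor D (B.comul x)))) := by
      conv_lhs => rw [show TensorProduct.map f g =
        TensorProduct.map f (ι K ∘ₗ f + cons ∘ₗ TensorProduct.map f g ∘ₗ B.comul) by rw [← hg']]
      rw [TensorProduct.map_add_right, LinearMap.add_apply, B.coassoc]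
      congr 1
      · exact (LinearMap.congr_fun (LinearMap.lTensor_comp_map ..) (B.comul x)).symm
      · rw [← LinearMap.comp_apply (f := cons.lTensor V), LinearMap.lTensor_comp_map,
          ← LinearMap.comp_apply (g := B.comul.lTensor D), LinearMap.map_comp_lTensor]
        rfl
    have h2 : ∀ u : V ⊗[K] V, cons ((ι K).lTensor V u) = word₂ u 1 := by
      intro u
      induction u using TensorProduct.induction_on with
      | zero => simp
      | tmul x y => simp
      | add a b ha hb => simp only [map_add, LinearMap.add_apply, ha, hb]
    have h3 : ∀ z : (D ⊗[K] D) ⊗[K] D, cons (cons.lTensor V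
        (TensorProduct.map f (TensorProduct.map f g) (TensorProduct.assoc K D D D z))) =
        TensorProduct.lift word₂ (TensorProduct.map (TensorProduct.map f f) g z) := by
      intro z
      have : cons ∘ₗ cons.lTensor V ∘ₗ TensorProduct.map f (TensorProduct.map f g) ∘ₗ
          (TensorProduct.assoc K D D D).toLinearMap =
          TensorProduct.lift word₂ ∘ₗ TensorProduct.map (TensorProduct.map f f) g :=
        TensorProduct.ext_threefold fun a b c => by simp
      exact LinearMap.congr_fun this z
    have h4 : cobr₀ L (ι K (f x)) = word₂ (L.cobr (f x)) 1 := by simpa using cobr₀_mul L (f x) 1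
    have h5 : antisymm₀ L.toDGSpace (word₂ (TensorProduct.map f f (B.comul x)) 1) =
        word₂ (L.cobr (f x)) 1 := by
      rw [antisymm₀_word₂, ← LinearMap.sub_apply, ← map_sub]
      exact congrArg (fun u => word₂ u 1) (LinearMap.congr_fun hcobr x)
    have h6 : antisymm₀ L.toDGSpace (cons (TensorProduct.map f g (B.comul x))) =
        cobr₀ L (ι K (f x)) + cobr₀ L (cons (TensorProduct.map f g (B.comul x))) := by
      rw [cobr₀_cons]
      conv_lhs => rw [h1]
      rw [map_add, map_add, h2, h5, h4, h3, antisymm₀_lift_word₂]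
      congr 2
      rw [← LinearMap.comp_apply, ← LinearMap.comp_apply, ← LinearMap.comp_apply (f := L.cobr.rTensor _),
        LinearMap.rTensor_comp_map, LinearMap.rTensor_comp_map, LinearMap.map_comp_rTensor,
        LinearMap.comp_assoc, hcobr]
    rw [cond_zero, LinearMap.sub_apply, hg, map_add, map_add, antisymm₀_ι, zero_add, h6, sub_self]
  | succ i ih =>
    have h : cond L i ∘ₗ g = 0 := LinearMap.ext ih
    rw [cond_succ, hg, map_add, up_ι, cond_one, mul_zero, zero_add, up_cons,
      ← LinearMap.comp_apply (f := (cond L i).lTensor V), LinearMap.lTensor_comp_map, h]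
    simp

/-- The universal property of the enveloping coalgebra. -/
lemma enveloping_isUniversal (L : DGLieCoalgebra K V) {B : DGCoalgebra K D}
    (hB : Conilpotent B.comul) {f : D →ₗ[K] V} (hf : B.toLie.IsHom L f) :
    ∃! g : D →ₗ[K] envelope L, B.IsHom (enveloping L) g ∧ envelopingProj L ∘ₗ g = f := by
  obtain ⟨g, hg, hrec⟩ := exists_coalgebra_isHom hB hf.toIsHom
  have hmem : ∀ x, g x ∈ envelope L := fun x =>
    mem_envelope.2 ⟨by rw [hrec]; simp, fun i => cond_eq_zero hf hrec i x⟩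
  have haug : aug ∘ₗ g = 0 := LinearMap.ext fun x => (mem_envelope.1 (hmem x)).1
  refine ⟨g.codRestrict _ hmem, ⟨(envelope_isSub L).codRestrict_isHom hg, ?_⟩, ?_⟩
  · refine LinearMap.ext fun x => ?_
    change fst (g x) = f x
    rw [hrec, map_add, fst_ι, fst, LinearMap.comp_apply, LinearMap.comp_apply, uncons_cons,
      ← LinearMap.comp_apply (f := aug.lTensor V), LinearMap.lTensor_comp_map, haug]
    simp
  · rintro g' ⟨hg', rfl⟩
    have h2 : ∀ x, (g' x : Ten K V) = ι K (envelopingProj L (g' x)) + cons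
        (TensorProduct.map (envelopingProj L ∘ₗ g') ((envelope L).subtype ∘ₗ g') (B.comul x)) := by
      intro x
      have h := ((enveloping_incl_isHom L).map_comul (g' x))
      rw [hg'.map_comul, ← LinearMap.comp_apply (g := TensorProduct.map g' g'),
        ← TensorProduct.map_comp] at h
      have h3 := plus_eq_cons (g' x : Ten K V)
      rw [plus_of_aug (mem_envelope.1 (g' x).2).1] at h3
      refine h3.trans ?_
      change _ + cons (fst.rTensor _ ((coalgebra L.toDGSpace).comul ((envelope L).subtype (g' x)))) = _
      rw [h, ← LinearMap.comp_apply (f := fst.rTensor _), LinearMap.rTensor_comp_map]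
      rfl
    -- Both maps solve the recursion with the same one-letter part, and the solution is unique.
    have h3 : (envelope L).subtype ∘ₗ g' = g := by
      refine hB.rec_unique (a := ι K ∘ₗ envelopingProj L ∘ₗ g')
        (b := cons ∘ₗ (envelopingProj L ∘ₗ g').rTensor (Ten K V)) (fun x => ?_) fun x => ?_
      · rw [LinearMap.comp_apply (f := cons), ← LinearMap.comp_apply (g := LinearMap.lTensor _ _),
          LinearMap.rTensor_comp_lTensor]
        exact h2 x
      · rw [LinearMap.comp_apply (f := cons), ← LinearMap.comp_apply (g := LinearMap.lTensor _ _),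
          LinearMap.rTensor_comp_lTensor]
        exact hrec x
    exact LinearMap.ext fun x => Subtype.ext (LinearMap.congr_fun h3 x)

end universal

/-! ### Compatibility of the operators with length. -/

section length

lemma lenEQ_zero_apply (t : Ten K V) : lenEQ 0 t = aug t • 1 := by
  rw [lenEQ, LinearMap.sub_apply, plus_eq, LinearMap.id_apply, sub_sub_cancel]

lemma lenEQ_comp_self (n : ℕ) : lenEQ (K := K) (V := V) n ∘ₗ lenEQ n = lenEQ n := by
  induction n with
  | zero => exact LinearMap.ext fun t => by simp [lenEQ_zero_apply]
  | succ n ih => rw [lenEQ, ← up_comp, ih]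

lemma lenGE_comp_lenEQ {k n : ℕ} (h : k ≤ n) :
    lenGE (K := K) (V := V) k ∘ₗ lenEQ n = lenEQ n := by
  induction k generalizing n with
  | zero => rfl
  | succ k ih =>
    obtain ⟨n, rfl⟩ : ∃ m, n = m + 1 := ⟨n - 1, by omega⟩
    rw [lenEQ, lenGE, ← up_comp, ih (by omega)]

lemma up_comp_lenEQ_zero (f : Ten K V →ₗ[K] Ten K V) : up f ∘ₗ lenEQ 0 = 0 :=
  LinearMap.ext fun t => by simp [lenEQ_zero_apply]

lemma lenEQ_zero_comp_up (f : Ten K V →ₗ[K] Ten K V) : lenEQ 0 ∘ₗ up f = 0 :=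
  LinearMap.ext fun t => by simp [lenEQ_zero_apply]

lemma antisymm_comp_lenEQ (X : DGSpace K V) (i n : ℕ) :
    antisymm X i ∘ₗ lenEQ n = lenEQ n ∘ₗ antisymm X i := by
  induction i generalizing n with
  | zero =>
    rcases n with _ | _ | n
    · exact LinearMap.ext fun t => by simp [lenEQ_zero_apply, antisymm, antisymm₀, cons₂]
    · refine cons_ext₂ X (by simp [lenEQ]) (by simp [lenEQ, antisymm])
        fun i j x hx y hy t => ?_
      simp [lenEQ, antisymm, antisymm₀_mul X hx hy]
    · exact antisymm₀_up_up X _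
  | succ i ih =>
    rcases n with _ | n
    · exact (up_comp_lenEQ_zero _).trans (lenEQ_zero_comp_up _).symm
    · rw [antisymm, lenEQ, ← up_comp, ih, up_comp]

lemma antisymm_comp_lenEQ_eq_zero (X : DGSpace K V) {i n : ℕ} (h : n ≤ i + 1) :
    antisymm X i ∘ₗ lenEQ n = 0 := by
  induction i generalizing n with
  | zero =>
    rcases n with _ | _ | n
    · exact LinearMap.ext fun t => by simp [lenEQ_zero_apply]
    · refine cons_ext (by simp [lenEQ]) fun x t => ?_
      rw [LinearMap.comp_apply, zero_add, lenEQ, up_mul, lenEQ_zero_apply]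
      simp [antisymm]
    · omega
  | succ i ih =>
    rcases n with _ | n
    · exact up_comp_lenEQ_zero _
    · rw [antisymm, lenEQ, ← up_comp, ih (by omega), up_zero]

lemma lenEQ_comp_cobrAt (L : DGLieCoalgebra K V) (i n : ℕ) :
    lenEQ (n + 1) ∘ₗ cobrAt L i = cobrAt L i ∘ₗ lenEQ n := by
  induction i generalizing n with
  | zero =>
    rcases n with _ | n
    · refine cons_ext (by simp [lenEQ_zero_apply]) fun x t => ?_
      simp only [LinearMap.comp_apply, lenEQ_zero_apply, aug_mul, zero_smul, map_zero, cobrAt,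
        cobr₀_mul]
      generalize L.cobr x = u
      induction u using TensorProduct.induction_on with
      | zero => simp
      | tmul x y => simp [lenEQ]
      | add a b ha hb => simp only [map_add, LinearMap.add_apply, ha, hb, add_zero]
    · exact up_up_cobr₀ L _
  | succ i ih =>
    rcases n with _ | n
    · rw [cobrAt, up_comp_lenEQ_zero, lenEQ, ← up_comp, lenEQ]
      refine (congrArg up ?_).trans up_zero
      cases i with
      | zero =>
        refine LinearMap.ext fun t => ?_
        change lenEQ 0 (cobr₀ L t) = 0
        rw [lenEQ_zero_apply]
        simp [cobr₀, cons₂]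
      | succ i => exact lenEQ_zero_comp_up _
    · exact (up_comp _ _).symm.trans ((congrArg up (ih n)).trans (up_comp _ _))

lemma cobrAt_comp_lenEQ_eq_zero (L : DGLieCoalgebra K V) {i n : ℕ} (h : n ≤ i) :
    cobrAt L i ∘ₗ lenEQ n = 0 := by
  induction i generalizing n with
  | zero =>
    obtain rfl : n = 0 := by omega
    exact LinearMap.ext fun t => by simp [lenEQ_zero_apply]
  | succ i ih =>
    rcases n with _ | n
    · exact up_comp_lenEQ_zero _
    · rw [cobrAt, lenEQ, ← up_comp, ih (by omega), up_zero]

/-- Words of n letters have n − 1 adjacent transpositions, and for these the words are long enough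
for the braid relations. -/
lemma coxeterOn_antisymm (X : DGSpace K V) {n : ℕ} {S : Submodule K (Ten K V)}
    (hS : ∀ t ∈ S, lenEQ n t = t) (hκ : ∀ i, ∀ t ∈ S, antisymm X i t ∈ S) :
    CoxeterOn (antisymm X) (n - 1) S where
  mem i _ := hκ i
  sq i _ t _ := LinearMap.congr_fun (antisymm_sq X i) t
  far i j hij _ t _ := LinearMap.congr_fun (antisymm_far X hij) t
  braid i hi t ht := by
    have h := LinearMap.congr_fun (antisymm_braid X i) t
    have hl : lenGE (i + 3) t = t := by
      rw [← hS t ht]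
      exact LinearMap.congr_fun (lenGE_comp_lenEQ (show i + 3 ≤ n by omega)) t
    simpa only [LinearMap.comp_apply, LinearMap.sub_apply, hl] using h

end length

/-! ### The symmetric algebra as coinvariants, and symmetrization. -/

section symmetric

variable (X : DGSpace K V)

/-- The quotient map to the symmetric algebra. -/
def toSym : Ten K V →ₐ[K] Sym X := lift (Sym.ι X)

@[simp] lemma toSym_ι (x : V) : toSym X (ι K x) = Sym.ι X x := lift_ι _ x

lemma toSym_surjective : Function.Surjective (toSym X) := by
  have : LinearMap.range (toSym X).toLinearMap = ⊤ := by
    refine Sym.eq_top_of X ⟨1, map_one (toSym X)⟩ ?_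
    rintro i x - _ ⟨t, rfl⟩
    exact ⟨ι K x * t, by simp⟩
  exact LinearMap.range_eq_top.1 this

lemma toSym_antisymm (i : ℕ) (t : Ten K V) : toSym X (antisymm X i t) = 0 := by
  induction i generalizing t with
  | zero =>
    have : (toSym X).toLinearMap ∘ₗ antisymm₀ X = 0 := by
      refine cons_ext₂ X (by simp) (by simp) fun i j x hx y hy t => ?_
      simp [antisymm₀_mul X hx hy, Sym.ι_mul_ι_mul X hx hy]
    exact LinearMap.congr_fun this t
  | succ i ih =>
    have : (toSym X).toLinearMap ∘ₗ up (antisymm X i) = 0 :=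
      cons_ext (by simp) fun x t => by simp [ih]
    exact LinearMap.congr_fun this t

lemma aug_toSym (t : Ten K V) : Sym.aug X (toSym X t) = aug t := by
  have : (Sym.aug X).toLinearMap ∘ₗ (toSym X).toLinearMap = aug :=
    cons_ext (by simp) fun x t => by simp [Sym.aug_mul, aug_mul, -map_mul, map_mul (toSym X)]
  exact LinearMap.congr_fun this t

lemma toSym_isHom : (dg X).IsHom (Sym.toDGSpace X) (toSym X).toLinearMap := by
  refine isHom_of_word ?_ ?_ (fun i m x hx a ha h => ?_) (fun i x hx a h => ?_)
  · rw [AlgHom.toLinearMap_apply, map_one]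
    exact Sym.one_mem X
  · rw [AlgHom.toLinearMap_apply, map_one]
    exact Sym.d_one X
  · rw [AlgHom.toLinearMap_apply, map_mul, toSym_ι]
    exact Sym.ι_mul_mem hx h
  · simp only [AlgHom.toLinearMap_apply, map_mul, toSym_ι] at h ⊢
    rw [h]
    exact (Sym.d_mul' X hx _).symm

/-- The span of the antisymmetrizations. -/
def antisymmSpan : Submodule K (Ten K V) := ⨆ i, LinearMap.range (antisymm X i)

lemma antisymm_mem_span (i : ℕ) (t : Ten K V) : antisymm X i t ∈ antisymmSpan X :=
  Submodule.mem_iSup_of_mem i ⟨t, rfl⟩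

lemma ι_mul_mem_antisymmSpan (x : V) :
    antisymmSpan X ≤ (antisymmSpan X).comap (LinearMap.mulLeft K (ι K x)) := by
  refine iSup_le fun i => ?_
  rintro _ ⟨t, rfl⟩
  rw [Submodule.mem_comap, LinearMap.mulLeft_apply, ← up_mul]
  exact antisymm_mem_span X (i + 1) _

/-- Left multiplication by letters on the coinvariants. -/
def coinvariantAct : V →ₗ[K] Module.End K (Ten K V ⧸ antisymmSpan X) where
  toFun x := (antisymmSpan X).mapQ _ (LinearMap.mulLeft K (ι K x)) (ι_mul_mem_antisymmSpan X x)
  map_add' x y := by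
    refine Submodule.linearMap_qext _ (LinearMap.ext fun t => ?_)
    simp [add_mul]
  map_smul' c x := by
    refine Submodule.linearMap_qext _ (LinearMap.ext fun t => ?_)
    simp

/-- Left multiplication by letters on the quotient by `antisymmSpan X` is graded commutative, so the
symmetric algebra acts there. Acting on the class of 1, the image of t gives back the class of t. -/
lemma ker_toSym_le (t : Ten K V) (ht : toSym X t = 0) : t ∈ antisymmSpan X := by
  let Φ : Sym X →ₐ[K] Module.End K (Ten K V ⧸ antisymmSpan X) :=
    Sym.lift X (A := Module.End K (Ten K V ⧸ antisymmSpan X)) (coinvariantAct X) (by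
      intro i j x hx y hy
      refine Submodule.linearMap_qext _ (LinearMap.ext fun t => ?_)
      have h := antisymm_mem_span X 0 (ι K x * (ι K y * t))
      rw [antisymm, antisymm₀_mul X hx hy, ← Submodule.Quotient.mk_eq_zero,
        Submodule.Quotient.mk_sub, sub_eq_zero] at h
      exact h)
  have h1 : ∀ x, Φ (Sym.ι X x) = coinvariantAct X x := fun x => Sym.lift_ι X _ _ x
  have key : ∀ s : Ten K V, Φ (toSym X s) (Submodule.Quotient.mk 1) = Submodule.Quotient.mk s := by
    intro s
    have : (LinearMap.applyₗ (Submodule.Quotient.mk 1 : Ten K V ⧸ antisymmSpan X)) ∘ₗ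
        Φ.toLinearMap ∘ₗ (toSym X).toLinearMap = (antisymmSpan X).mkQ := by
      refine hom_ext (by simp) fun x a ha => ?_
      simp only [LinearMap.comp_apply, LinearMap.applyₗ_apply_apply, AlgHom.toLinearMap_apply,
        Submodule.mkQ_apply, map_mul, toSym_ι, h1, Module.End.mul_apply] at ha ⊢
      rw [ha]
      rfl
    exact LinearMap.congr_fun this s
  rw [← Submodule.Quotient.mk_eq_zero, ← key, ht]
  simp

lemma toSym_eq_zero_iff (t : Ten K V) : toSym X t = 0 ↔ t ∈ antisymmSpan X := by
  refine ⟨ker_toSym_le X t, fun h => ?_⟩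
  have : antisymmSpan X ≤ LinearMap.ker (toSym X).toLinearMap := iSup_le fun i => by
    rintro _ ⟨t, rfl⟩
    exact toSym_antisymm X i t
  exact this h

lemma toSym_lenEQ {t : Ten K V} (ht : toSym X t = 0) (n : ℕ) : toSym X (lenEQ n t) = 0 := by
  rw [toSym_eq_zero_iff] at ht ⊢
  have : antisymmSpan X ≤ (antisymmSpan X).comap (lenEQ n) := iSup_le fun i => by
    rintro _ ⟨t, rfl⟩
    rw [Submodule.mem_comap, ← LinearMap.comp_apply, ← antisymm_comp_lenEQ]
    exact antisymm_mem_span X i _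
  exact this ht

variable [CharZero K]

/-- In characteristic zero, the invariants of the symmetric groups inject into the coinvariants. -/
lemma eq_zero_of_antisymm_of_toSym {n : ℕ} {t : Ten K V} (hn : lenEQ n t = t)
    (h : ∀ i, antisymm X i t = 0) (ht : toSym X t = 0) : t = 0 := by
  -- The vanishing of cohomology is applied not to words but to operators on words of length n that
  -- kill t, with τ_i acting by composition on the right. This produces a projection to coinvariants
  -- as an operator, without summing over permutations.
  let S : Submodule K (Module.End K (Ten K V)) :=
    { carrier := {b | b ∘ₗ lenEQ n = b ∧ b t = 0}
      add_mem' := fun {a b} ha hb => ⟨by rw [LinearMap.add_comp, ha.1, hb.1], by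
        rw [LinearMap.add_apply, ha.2, hb.2, add_zero]⟩
      zero_mem' := ⟨LinearMap.zero_comp _, rfl⟩
      smul_mem' := fun c a ha => ⟨by rw [LinearMap.smul_comp, ha.1], by
        rw [LinearMap.smul_apply, ha.2, smul_zero]⟩ }
  have hS : ∀ b, b ∈ S ↔ b ∘ₗ lenEQ n = b ∧ b t = 0 := fun _ => Iff.rfl
  let κ : ℕ → Module.End K (Module.End K (Ten K V)) := fun i => LinearMap.mulRight K (antisymm X i)
  have hκ : ∀ i b, κ i b = b ∘ₗ antisymm X i := fun _ _ => rfl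
  have hcomm : ∀ i, antisymm X i ∘ₗ lenEQ n = lenEQ n ∘ₗ antisymm X i :=
    fun i => antisymm_comp_lenEQ X i n
  have hbr : ∀ i, i + 1 < n - 1 →
      lenEQ n ∘ₗ (antisymm X i ∘ₗ antisymm X (i + 1) ∘ₗ antisymm X i - antisymm X i) =
      lenEQ n ∘ₗ (antisymm X (i + 1) ∘ₗ antisymm X i ∘ₗ antisymm X (i + 1)
        - antisymm X (i + 1)) := by
    intro i hi
    have h1 := congrArg (fun f => f ∘ₗ lenEQ n) (antisymm_braid X i)
    simp only [LinearMap.comp_assoc, lenGE_comp_lenEQ (K := K) (V := V) (show i + 3 ≤ n by omega),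
      LinearMap.sub_comp, hcomm] at h1
    simp only [← LinearMap.comp_assoc, hcomm] at h1
    simpa only [LinearMap.comp_sub, LinearMap.comp_assoc] using h1
  have hcox : CoxeterOn κ (n - 1) S :=
    { mem := fun i _ b hb => by
        rw [hS] at hb ⊢
        rw [hκ, LinearMap.comp_assoc, hcomm, ← LinearMap.comp_assoc, hb.1, LinearMap.comp_apply, h,
          map_zero]
        exact ⟨rfl, rfl⟩
      sq := fun i _ b _ => by
        rw [hκ, hκ, LinearMap.comp_assoc, antisymm_sq, LinearMap.comp_smul]
      far := fun i j hij _ b _ => by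
        simp only [hκ, LinearMap.comp_assoc, antisymm_far X hij]
      braid := fun i hi b hb => by
        have h1 := congrArg (fun f => b ∘ₗ f) (hbr i hi)
        simp only [← LinearMap.comp_assoc, ((hS b).1 hb).1] at h1
        simpa only [hκ, LinearMap.comp_sub, LinearMap.comp_assoc] using h1 }
  -- This cocycle is the coboundary of `lenEQ n`, which does not kill t unless t = 0. Since t is
  -- invariant the values do kill t, so a primitive B exists that kills t as well.
  obtain ⟨B, hB, hBκ⟩ := hcox.exists_primitive (a := fun i => antisymm X i ∘ₗ lenEQ n)
    (fun i _ => ⟨by rw [LinearMap.comp_assoc, lenEQ_comp_self], by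
      rw [LinearMap.comp_apply, hn, h]⟩)
    (fun i _ => by
      rw [hκ, LinearMap.comp_assoc, ← hcomm, ← LinearMap.comp_assoc, antisymm_sq,
        LinearMap.smul_comp])
    (fun i j hij _ => by
      simp only [hκ]
      rw [LinearMap.comp_assoc, ← hcomm, ← LinearMap.comp_assoc, antisymm_far X hij,
        LinearMap.comp_assoc, hcomm, ← LinearMap.comp_assoc])
    (fun i hi => by
      have h1 := hbr i hi
      simp only [hκ, hcomm, LinearMap.comp_assoc]
      simpa only [LinearMap.comp_sub] using h1)
  -- The difference `lenEQ n - B` annihilates all antisymmetrizations and fixes t; as t is itself a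
  -- sum of antisymmetrizations, it vanishes.
  have hE : antisymmSpan X ≤ LinearMap.ker (lenEQ n - B) := iSup_le fun i => by
    rintro _ ⟨s, rfl⟩
    have h1 : (lenEQ n - B) ∘ₗ antisymm X i = 0 := by
      rw [LinearMap.sub_comp]
      by_cases hi : i < n - 1
      · have := hBκ i hi
        rw [hκ] at this
        rw [this, hcomm, sub_self]
      · have h0 := antisymm_comp_lenEQ_eq_zero X (show n ≤ i + 1 by omega)
        have h2 : lenEQ n ∘ₗ antisymm X i = 0 := by rw [← hcomm, h0]
        rw [h2, ← ((hS B).1 hB).1, LinearMap.comp_assoc, h2, LinearMap.comp_zero, sub_zero]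
    exact LinearMap.congr_fun h1 s
  have := hE (ker_toSym_le X t ht)
  rwa [LinearMap.mem_ker, LinearMap.sub_apply, hn, ((hS B).1 hB).2, sub_zero] at this

/-- Symmetrization. -/
lemma exists_symmetrization {n : ℕ} {S : Submodule K (Ten K V)} (hS : ∀ t ∈ S, lenEQ n t = t)
    (hκ : ∀ i, ∀ t ∈ S, antisymm X i t ∈ S) {t : Ten K V} (ht : t ∈ S) :
    ∃ w ∈ S, toSym X w = toSym X t ∧ ∀ i, antisymm X i w = 0 := by
  have hcox : CoxeterOn (antisymm X) (n - 1) (S ⊓ LinearMap.ker (toSym X).toLinearMap) :=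
    coxeterOn_antisymm X (fun t ht => hS t ht.1) fun i t ht => ⟨hκ i t ht.1, toSym_antisymm X i t⟩
  have hcox' := coxeterOn_antisymm X hS hκ
  -- The family is the coboundary of t, but its values lie in the smaller module of tensors with
  -- zero image in the symmetric algebra, so it has a primitive r there too. Then t − r is invariant
  -- and has the image of t.
  obtain ⟨r, hr, h⟩ := hcox.exists_primitive (a := fun i => antisymm X i t)
    (fun i _ => ⟨hκ i t ht, toSym_antisymm X i t⟩) (fun i hi => hcox'.sq i hi t ht)
    (fun i j hij hj => (hcox'.far i j hij hj t ht).symm) (fun i hi => hcox'.braid i hi t ht)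
  refine ⟨t - r, sub_mem ht hr.1, ?_, fun i => ?_⟩
  · have : toSym X r = 0 := hr.2
    rw [map_sub, this, sub_zero]
  · rw [map_sub]
    by_cases hi : i < n - 1
    · rw [h i hi, sub_self]
    · have h0 := antisymm_comp_lenEQ_eq_zero X (show n ≤ i + 1 by omega)
      rw [← map_sub, ← hS _ (sub_mem ht hr.1)]
      exact LinearMap.congr_fun h0 _

end symmetric

end Ten

/-! ### The coradical filtration of a dg Lie coalgebra. -/

section Coradical

variable {K : Type u} [Field K] {V : Type v} [AddCommGroup V] [Module K V]

/-- The symmetry of the tensor product in terms of parities. -/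
lemma DGSpace.swap_eq_parity [CharZero K] (X : DGSpace K V) (x y : V) :
    X.swap X (x ⊗ₜ[K] y) = y ⊗ₜ[K] ((2⁻¹ : K) • (x + X.sgn 1 x)) +
      X.sgn 1 y ⊗ₜ[K] ((2⁻¹ : K) • (x - X.sgn 1 x)) := by
  -- The operators (1 ± sgn)/2 project to the even and odd parts of the first factor; only the odd
  -- part puts a sign on the second.
  have : X.swap X = (TensorProduct.comm K V V).toLinearMap ∘ₗ
      (((2⁻¹ : K) • (LinearMap.id + X.sgn 1)).rTensor V +
        TensorProduct.map ((2⁻¹ : K) • (LinearMap.id - X.sgn 1)) (X.sgn 1)) := by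
    refine X.tensor_ext X fun i j x hx y hy => ?_
    have h2 : (2 : K)⁻¹ • (x + x) = x := by
      rw [← two_smul K, smul_smul, inv_mul_cancel₀ two_ne_zero, one_smul]
    rw [X.swap_tmul X hx hy]
    simp only [LinearMap.comp_apply, LinearMap.add_apply, LinearMap.rTensor_tmul,
      TensorProduct.map_tmul, LinearMap.smul_apply, LinearMap.sub_apply, LinearMap.id_apply,
      X.sgn_apply 1 hx, X.sgn_apply 1 hy, one_mul, LinearEquiv.coe_coe, map_add,
      TensorProduct.comm_tmul]
    rcases Int.even_or_odd i with hi | hi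
    · rw [sg_even hi, sg_even (hi.mul_right j), one_smul, one_smul, h2]
      simp
    · have : sg K (i * j) = sg K j := by
        rcases Int.even_or_odd j with hj | hj
        · rw [sg_even hj, sg_even (hj.mul_left i)]
        · rw [sg_odd hj, sg_odd (hi.mul hj)]
      rw [this, sg_odd hi, neg_one_smul, sub_neg_eq_add, h2, add_neg_cancel, smul_zero,
        TensorProduct.tmul_zero, zero_add, TensorProduct.smul_tmul']
  exact LinearMap.congr_fun this (x ⊗ₜ y)

variable {L : DGLieCoalgebra K V}

/-- The cobracket preserves degree, so it commutes with the sign operators. With the parity form of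
the symmetry, this avoids decomposing elements of the filtration into homogeneous ones. -/
lemma sgn_mem_coradical (k : ℤ) {n : ℕ} {x : V} (hx : x ∈ coradical L.cobr n) :
    L.sgn k x ∈ coradical L.cobr n := by
  induction n generalizing x with
  | zero =>
    have : x = 0 := hx
    rw [this, map_zero]; exact zero_mem _
  | succ n ih =>
    rw [mem_coradical_succ] at hx ⊢
    rw [L.cobr_isHom.map_sgn, sgn_tensor]
    exact lTensor_mem_range hx _ fun y hy => ih hy

lemma swap_mem_range_rTensor [CharZero K] {n : ℕ} {u : V ⊗[K] V}
    (hu : u ∈ LinearMap.range ((coradical L.cobr n).subtype.lTensor V)) :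
    L.swap L.toDGSpace u ∈ LinearMap.range ((coradical L.cobr n).subtype.rTensor V) := by
  obtain ⟨u, rfl⟩ := hu
  induction u using TensorProduct.induction_on with
  | zero => simp
  | tmul x y =>
    rw [LinearMap.lTensor_tmul, swap_eq_parity]
    exact add_mem ⟨y ⊗ₜ _, rfl⟩ ⟨⟨_, sgn_mem_coradical 1 y.2⟩ ⊗ₜ _, rfl⟩
  | add a b ha hb => rw [map_add, map_add]; exact add_mem ha hb

/-- The cobracket of the coradical filtration lies in it in both factors. -/
lemma cobr_mem_range_map [CharZero K] {n : ℕ} {x : V} (hx : x ∈ coradical L.cobr (n + 1)) :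
    L.cobr x ∈ LinearMap.range
      (TensorProduct.map (coradical L.cobr n).subtype (coradical L.cobr n).subtype) := by
  rw [mem_coradical_succ] at hx
  have hx' := swap_mem_range_rTensor hx
  -- By definition the filtration restricts only the second factor of δx; antisymmetry transfers the
  -- restriction to the first.
  rw [L.antisymm, neg_mem_iff] at hx'
  obtain ⟨P, hP⟩ := exists_retract (coradical L.cobr n)
  have e1 := retract_lTensor_of_mem_range hP hx
  have e2 := retract_rTensor_of_mem_range hP hx'
  rw [← e1, ← e2, ← LinearMap.comp_apply, LinearMap.lTensor_comp_rTensor, TensorProduct.map_comp]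
  exact ⟨_, rfl⟩

end Coradical

namespace Ten

variable {K : Type u} [Field K] {V : Type v} [AddCommGroup V] [Module K V]

/-! ### The weight of words. -/

section weight

variable (L : DGLieCoalgebra K V)

/-- The words of weight at most `m`, where a letter that is killed by `k` iterates of the cobracket
counts `2 ^ k`. -/
inductive WeightWord : ℕ → Ten K V → Prop
  | one (m : ℕ) : WeightWord m 1
  | cons {k m : ℕ} {x : V} {t : Ten K V} (hx : x ∈ coradical L.cobr k) (ht : WeightWord m t) :
      WeightWord (m + 2 ^ k) (ι K x * t)

/-- The span of the words of weight at most `m`. -/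
def weightLE (m : ℕ) : Submodule K (Ten K V) := Submodule.span K {t | WeightWord L m t}

variable {L}

lemma WeightWord.mono {m m' : ℕ} {t : Ten K V} (h : WeightWord L m t) (hm : m ≤ m') :
    WeightWord L m' t := by
  induction h generalizing m' with
  | one => exact .one _
  | @cons k m x t hx _ ih =>
    obtain ⟨j, rfl⟩ := Nat.exists_eq_add_of_le hm
    rw [show m + 2 ^ k + j = (m + j) + 2 ^ k by omega]
    exact .cons hx (ih (by omega))

lemma weightLE_mono : Monotone (weightLE L) :=
  fun _ _ h => Submodule.span_mono fun _ ht => ht.mono h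

lemma ι_mul_mem_weightLE {k m : ℕ} {x : V} {t : Ten K V} (hx : x ∈ coradical L.cobr k)
    (ht : t ∈ weightLE L m) : ι K x * t ∈ weightLE L (m + 2 ^ k) := by
  induction ht using Submodule.span_induction with
  | mem a ha => exact Submodule.subset_span (.cons hx ha)
  | zero => simp
  | add a b _ _ ha hb => rw [mul_add]; exact add_mem ha hb
  | smul c a _ ha => rw [mul_smul_comm]; exact Submodule.smul_mem _ _ ha

lemma weightLE_induction {m : ℕ} {S : ℕ → Submodule K (Ten K V)} (h1 : ∀ m, 1 ∈ S m)
    (h : ∀ k m, ∀ x ∈ coradical L.cobr k, ∀ t, WeightWord L m t → t ∈ S m →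
      ι K x * t ∈ S (m + 2 ^ k)) : weightLE L m ≤ S m := by
  refine Submodule.span_le.mpr fun t ht => ?_
  induction ht with
  | one => exact h1 _
  | cons hx ht ih => exact h _ _ _ hx _ ht ih

lemma exists_mem_weightLE (hL : Conilpotent L.cobr) (t : Ten K V) : ∃ m, t ∈ weightLE L m := by
  have top : (⨆ m, weightLE L m) = ⊤ := by
    refine eq_top_of (Submodule.mem_iSup_of_mem 0 (Submodule.subset_span (.one 0)))
      fun x a ha => ?_
    rw [Submodule.mem_iSup_of_directed _ weightLE_mono.directed_le] at ha ⊢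
    obtain ⟨m, hm⟩ := ha
    obtain ⟨k, hk⟩ := hL x
    exact ⟨_, ι_mul_mem_weightLE hk hm⟩
  have ht : t ∈ ⨆ m, weightLE L m := by rw [top]; trivial
  rwa [Submodule.mem_iSup_of_directed _ weightLE_mono.directed_le] at ht

/-- Each letter adds 2 ^ k ≥ 1 to the weight, so weight at most m forces length at most m. This
bound ends the lifting in `exists_cond_eq_cobrAt`. -/
lemma lenGE_eq_zero_of_mem_weightLE {m : ℕ} {t : Ten K V} (ht : t ∈ weightLE L m) :
    lenGE (m + 1) t = 0 := by
  refine weightLE_induction (S := fun m => LinearMap.ker (lenGE (m + 1)))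
    (fun m => lenGE_succ_one m) (fun k m x hx t _ ht => ?_) ht
  have h : lenGE (m + 2 ^ k) t = 0 :=
    ker_lenGE_mono (show m + 1 ≤ m + 2 ^ k by have := Nat.one_le_two_pow (n := k); omega) ht
  rw [LinearMap.mem_ker, lenGE, up_mul, h, mul_zero]

lemma eq_zero_of_mem_weightLE {m n : ℕ} (hmn : m < n) {t : Ten K V} (ht : t ∈ weightLE L m)
    (hn : lenEQ n t = t) : t = 0 := by
  have h : lenGE n t = 0 := ker_lenGE_mono (show m + 1 ≤ n from hmn)
    (lenGE_eq_zero_of_mem_weightLE ht)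
  rw [← hn, ← LinearMap.congr_fun (lenGE_comp_lenEQ le_rfl) t, LinearMap.comp_apply, hn, h]

lemma lenEQ_mem_weightLE (n : ℕ) {m : ℕ} {t : Ten K V} (ht : t ∈ weightLE L m) :
    lenEQ n t ∈ weightLE L m := by
  induction n generalizing m t with
  | zero =>
    rw [lenEQ_zero_apply]
    exact Submodule.smul_mem _ _ (Submodule.subset_span (.one m))
  | succ n ih =>
    refine weightLE_induction (S := fun m => (weightLE L m).comap (lenEQ (n + 1)))
      (fun m => by simp [lenEQ]) (fun k m x hx t ht _ => ?_) ht
    rw [Submodule.mem_comap, lenEQ, up_mul]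
    exact ι_mul_mem_weightLE hx (ih (Submodule.subset_span ht))

lemma up_mem_weightLE {f : Ten K V →ₗ[K] Ten K V}
    (hf : ∀ m, ∀ t ∈ weightLE L m, f t ∈ weightLE L m) (m : ℕ) (t : Ten K V)
    (ht : t ∈ weightLE L m) : up f t ∈ weightLE L m := by
  refine weightLE_induction (S := fun m => (weightLE L m).comap (up f))
    (fun m => by simp) (fun k m x hx t ht _ => ?_) ht
  rw [Submodule.mem_comap, up_mul]
  exact ι_mul_mem_weightLE hx (hf m t (Submodule.subset_span ht))

lemma antisymm_mem_weightLE [CharZero K] (i m : ℕ) (t : Ten K V) (ht : t ∈ weightLE L m) :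
    antisymm L.toDGSpace i t ∈ weightLE L m := by
  induction i generalizing m t with
  | zero =>
    refine weightLE_induction (S := fun m => (weightLE L m).comap (antisymm₀ L.toDGSpace))
      (fun m => by simp) (fun k m x hx t ht _ => ?_) ht
    rw [Submodule.mem_comap]
    cases ht with
    | one => simp
    | @cons l m y t hy ht =>
      have ht' : t ∈ weightLE L m := Submodule.subset_span ht
      have h : ∀ {x y : V}, x ∈ coradical L.cobr k → y ∈ coradical L.cobr l →
          ι K y * (ι K x * t) ∈ weightLE L (m + 2 ^ l + 2 ^ k) := by
        intro x y hx hy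
        rw [add_right_comm]
        exact ι_mul_mem_weightLE hy (ι_mul_mem_weightLE hx ht')
      have hs : ∀ {x : V}, x ∈ coradical L.cobr k → L.sgn 1 x ∈ coradical L.cobr k :=
        sgn_mem_coradical 1
      -- The letters are taken from the filtration and need not be homogeneous, so the parity form
      -- of the exchange is used.
      rw [← word₂_tmul, antisymm₀_word₂, swap_eq_parity, map_add, LinearMap.add_apply]
      simp only [word₂_tmul]
      exact sub_mem (ι_mul_mem_weightLE hx (ι_mul_mem_weightLE hy ht'))
        (add_mem (h (Submodule.smul_mem _ _ (add_mem hx (hs hx))) hy)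
          (h (Submodule.smul_mem _ _ (sub_mem hx (hs hx))) (sgn_mem_coradical 1 hy)))
  | succ i ih => exact up_mem_weightLE ih m t ht

/-- A letter at level k + 1 splits into two letters at level k, and 2^k + 2^k = 2^(k+1). The weights
are powers of 2 precisely so that the extra letter costs nothing. -/
lemma cobrAt_mem_weightLE [CharZero K] (i m : ℕ) (t : Ten K V) (ht : t ∈ weightLE L m) :
    cobrAt L i t ∈ weightLE L m := by
  induction i generalizing m t with
  | zero =>
    refine weightLE_induction (S := fun m => (weightLE L m).comap (cobr₀ L))
      (fun m => by simp) (fun k m x hx t ht _ => ?_) ht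
    rw [Submodule.mem_comap, cobr₀_mul]
    rcases k with _ | k
    · have : x = 0 := hx
      simp [this]
    · obtain ⟨u, hu⟩ := cobr_mem_range_map hx
      rw [← hu]
      clear hu
      induction u using TensorProduct.induction_on with
      | zero => simp
      | tmul a b =>
        rw [TensorProduct.map_tmul, word₂_tmul, pow_succ, mul_two, ← add_assoc]
        exact ι_mul_mem_weightLE a.2 (ι_mul_mem_weightLE b.2 (Submodule.subset_span ht))
      | add a b ha hb => simp only [map_add, LinearMap.add_apply]; exact add_mem ha hb
  | succ i ih => exact up_mem_weightLE ih m t ht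

end weight

/-! ### Lifting symmetric tensors to the envelope, and bijectivity. -/

section surjective

variable {L : DGLieCoalgebra K V}

/-- The braid relation of a cocycle, for `D` and `E` the cobrackets in two adjacent letters of a
tensor, and `D'` and `E'` those of its antisymmetrization. -/
lemma cocycle_of_relations {M : Type*} [AddCommGroup M] [Module K M] {k l : Module.End K M}
    {D D' E E' : M} (hk : ∀ t, k (k t) = k t + k t) (hl : ∀ t, l (l t) = l t + l t)
    (hD : k D = D + D) (hD' : k D' = D' + D') (hE : l E = E + E)
    (e1 : D - k D - l D + k (l D) = E - E') (e2 : D' - k D' - l D' + k (l D') = E' - (E' + E'))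
    (e4 : D' = k E') : k (l D) - D = l (k E) - E := by
  have e3 := congrArg k e1
  -- This is τ_i τ_{i+1} δ_i τ_i = δ_{i+1}, evaluated on the tensor. Applying τ_i gives e7.
  have e5 : (D - D') - k (D - D') - l (D - D') + k (l (D - D')) = E := by
    simp only [map_sub]
    linear_combination (norm := module) e1 - e2
  have e6 := congrArg k e5
  simp only [map_sub, map_add, hk, hD, hD', ← e4] at e3 e5 e6
  have e7 : (D - D') - l (D - D') = E - k E := by
    simp only [map_sub]
    linear_combination (norm := module) e5 - e6
  have e8 := congrArg l e7
  simp only [map_sub, hl, hE] at e7 e8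
  linear_combination (norm := module) e3 + e7 - e8

/-- The components of a lift from length `n` satisfy the relations of a cocycle on adjacent
transpositions. -/
lemma cobrAt_cocycle {i n : ℕ} (hi : i + 1 < n) {w w' : Ten K V} (hn : lenEQ n w = w)
    (h : antisymm L.toDGSpace i w = cobrAt L i w') :
    antisymm L.toDGSpace i (antisymm L.toDGSpace (i + 1) (cobrAt L i w)) - cobrAt L i w =
      antisymm L.toDGSpace (i + 1) (antisymm L.toDGSpace i (cobrAt L (i + 1) w)) -
        cobrAt L (i + 1) w := by
  have hsq : ∀ i t, antisymm L.toDGSpace i (antisymm L.toDGSpace i t) =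
      antisymm L.toDGSpace i t + antisymm L.toDGSpace i t := by
    intro i t
    have := LinearMap.congr_fun (antisymm_sq L.toDGSpace i) t
    rwa [LinearMap.smul_apply, two_smul] at this
  have hA : ∀ i t, antisymm L.toDGSpace i (cobrAt L i t) = cobrAt L i t + cobrAt L i t := by
    intro i t
    have := LinearMap.congr_fun (antisymm_cobrAt L i) t
    rwa [LinearMap.smul_apply, two_smul] at this
  have hlen : ∀ t : Ten K V, lenEQ n t = t → lenGE (i + 2) t = t := by
    intro t ht
    rw [← ht]
    exact LinearMap.congr_fun (lenGE_comp_lenEQ (show i + 2 ≤ n by omega)) t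
  have hT : ∀ t, lenEQ n t = t → cobrAt L i t - antisymm L.toDGSpace i (cobrAt L i t)
      - antisymm L.toDGSpace (i + 1) (cobrAt L i t)
      + antisymm L.toDGSpace i (antisymm L.toDGSpace (i + 1) (cobrAt L i t)) =
      cobrAt L (i + 1) t - cobrAt L (i + 1) (antisymm L.toDGSpace i t) := by
    intro t ht
    have := LinearMap.congr_fun (transposition_cobrAt L i) t
    simpa only [LinearMap.comp_apply, LinearMap.sub_apply, LinearMap.add_apply, hlen t ht]
      using this
  have hτ : lenEQ n (antisymm L.toDGSpace i w) = antisymm L.toDGSpace i w := by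
    have := LinearMap.congr_fun (antisymm_comp_lenEQ L.toDGSpace i n) w
    simp only [LinearMap.comp_apply, hn] at this
    exact this.symm
  have e1 := hT w hn
  have e2 := hT (antisymm L.toDGSpace i w) hτ
  -- Co-Jacobi enters here, on the preceding component w', and the hypothesis turns δ_i w' into (1 −
  -- τ_i) w.
  have e4 := LinearMap.congr_fun (cobrAt_cobrAt L i) w'
  simp only [LinearMap.comp_apply, ← h] at e4
  rw [hsq, map_add] at e2
  exact cocycle_of_relations (hsq i) (hsq (i + 1)) (hA i w) (hA i _) (hA (i + 1) w) e1 e2 e4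

/-- The tensor w is a component of an element under construction, w' plays the role of the one
before it, and r is the sum of all components after w. Each new component u solves (1 − τ_i) u = δ_i
w, after which u takes the place of w; in the sum u + r the terms δ_i u cancel. -/
lemma exists_cond_eq_cobrAt [CharZero K] {m n : ℕ} {w w' : Ten K V} (hw : w ∈ weightLE L m)
    (hn : lenEQ n w = w) (h : ∀ i, antisymm L.toDGSpace i w = cobrAt L i w') :
    ∃ r, toSym L.toDGSpace r = 0 ∧ ∀ i, cond L i r = cobrAt L i w := by
  -- A tensor of weight at most m and length n > m is zero, so no further component is needed.
  by_cases hmn : m < n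
  · exact ⟨0, map_zero _, fun i => by simp [eq_zero_of_mem_weightLE hmn hw hn]⟩
  · have hq : ∀ i t, toSym L.toDGSpace (cobrAt L i t) = 0 := by
      intro i t
      have h1 := LinearMap.congr_fun (antisymm_cobrAt L i) t
      have h2 := toSym_antisymm L.toDGSpace i (cobrAt L i t)
      rw [LinearMap.comp_apply] at h1
      rw [h1, LinearMap.smul_apply, map_smul] at h2
      exact (smul_eq_zero.1 h2).resolve_left two_ne_zero
    have hlen : ∀ i, lenEQ (n + 1) (cobrAt L i w) = cobrAt L i w := by
      intro i
      have := LinearMap.congr_fun (lenEQ_comp_cobrAt L i n) w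
      rwa [LinearMap.comp_apply, LinearMap.comp_apply, hn] at this
    -- The primitive is sought with three properties: length n + 1 to iterate, the same weight bound
    -- to terminate, and zero image in the symmetric algebra to keep the image of w.
    let S : Submodule K (Ten K V) := LinearMap.eqLocus (lenEQ (n + 1)) LinearMap.id ⊓ weightLE L m ⊓
      LinearMap.ker (toSym L.toDGSpace).toLinearMap
    have hcox : CoxeterOn (antisymm L.toDGSpace) n S := by
      refine coxeterOn_antisymm (n := n + 1) L.toDGSpace (fun t ht => ht.1.1)
        fun i t ht => ⟨⟨?_, antisymm_mem_weightLE i m t ht.1.2⟩, toSym_antisymm _ _ _⟩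
      have h1 : lenEQ (n + 1) t = t := ht.1.1
      have h2 := LinearMap.congr_fun (antisymm_comp_lenEQ L.toDGSpace i (n + 1)) t
      rw [LinearMap.comp_apply, h1] at h2
      exact h2.symm
    obtain ⟨u, hu, hκ⟩ := hcox.exists_primitive (a := fun i => cobrAt L i w)
      (fun i _ => ⟨⟨hlen i, cobrAt_mem_weightLE i m w hw⟩, hq i w⟩)
      (fun i _ => LinearMap.congr_fun (antisymm_cobrAt L i) w)
      -- For distant places both sides are the double cobracket of w' in two different letters.
      (fun i j hij hj => by
        obtain ⟨j, rfl⟩ : ∃ k, j = k + 1 := ⟨j - 1, by omega⟩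
        have h1 := LinearMap.congr_fun (antisymm_cobrAt_far L (show i + 1 ≤ j by omega)) w
        have h2 := LinearMap.congr_fun (antisymm_cobrAt_far' L hij) w
        have h3 := LinearMap.congr_fun (cobrAt_cobrAt_far L (show i + 1 ≤ j by omega)) w'
        simp only [LinearMap.comp_apply, h] at h1 h2 h3
        rw [h1, h2, h3])
      (fun i hi => cobrAt_cocycle hi hn (h i))
    have hu' : lenEQ (n + 1) u = u := hu.1.1
    have hκ' : ∀ i, antisymm L.toDGSpace i u = cobrAt L i w := by
      intro i
      -- A word of n + 1 letters has only the transpositions with i < n. For i ≥ n both operators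
      -- are zero by convention.
      by_cases hi : i < n
      · exact hκ i hi
      · have h1 := LinearMap.congr_fun
          (antisymm_comp_lenEQ_eq_zero L.toDGSpace (show n + 1 ≤ i + 1 by omega)) u
        have h2 := LinearMap.congr_fun (cobrAt_comp_lenEQ_eq_zero L (show n ≤ i by omega)) w
        rw [LinearMap.comp_apply, hu'] at h1
        rw [LinearMap.comp_apply, hn] at h2
        rw [h1, h2]; rfl
    obtain ⟨r, hr, hr'⟩ := exists_cond_eq_cobrAt hu.1.2 hu' hκ'
    have hqu : toSym L.toDGSpace u = 0 := hu.2
    refine ⟨u + r, by rw [map_add, hqu, hr, add_zero], fun i => ?_⟩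
    rw [map_add, hr', cond, LinearMap.sub_apply, hκ', sub_add_cancel]
termination_by m + 1 - n

/-- The universal enveloping coalgebra maps onto the augmentation ideal of the symmetric
algebra. -/
lemma exists_mem_envelope [CharZero K] (hL : Conilpotent L.cobr) (t : Ten K V) :
    ∃ w ∈ envelope L, toSym L.toDGSpace w = toSym L.toDGSpace (plus t) := by
  let R : Submodule K (Sym L.toDGSpace) := (envelope L).map (toSym L.toDGSpace).toLinearMap
  have h1 : ∀ n, toSym L.toDGSpace (lenEQ (n + 1) t) ∈ R := by
    intro n
    obtain ⟨m, hm⟩ := exists_mem_weightLE hL t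
    let S : Submodule K (Ten K V) := LinearMap.eqLocus (lenEQ (n + 1)) LinearMap.id ⊓ weightLE L m
    have hmem : ∀ i, ∀ s ∈ S, antisymm L.toDGSpace i s ∈ S := by
      intro i s hs
      refine ⟨?_, antisymm_mem_weightLE i m s hs.2⟩
      have h1 : lenEQ (n + 1) s = s := hs.1
      have h2 := LinearMap.congr_fun (antisymm_comp_lenEQ L.toDGSpace i (n + 1)) s
      rw [LinearMap.comp_apply, h1] at h2
      exact h2.symm
    obtain ⟨w, hw, hqw, hκw⟩ := exists_symmetrization L.toDGSpace (n := n + 1) (S := S)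
      (fun s hs => hs.1) hmem (t := lenEQ (n + 1) t)
      ⟨LinearMap.congr_fun (lenEQ_comp_self (n + 1)) t, lenEQ_mem_weightLE _ hm⟩
    have hw1 : lenEQ (n + 1) w = w := hw.1
    -- A symmetric w is the lowest component of its lift, so there is no preceding one.
    obtain ⟨r, hr, hcr⟩ := exists_cond_eq_cobrAt (w' := 0) hw.2 hw1
      fun i => by rw [hκw, map_zero]
    refine ⟨w + r, mem_envelope.2 ⟨?_, fun i => ?_⟩, ?_⟩
    · rw [map_add, ← aug_toSym L.toDGSpace r, hr, map_zero, add_zero, ← hw1]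
      exact aug_up _ _
    · rw [map_add, hcr, cond, LinearMap.sub_apply, hκw]; abel
    · rw [AlgHom.toLinearMap_apply, map_add, hr, add_zero, hqw]
  -- The components of positive length are added up by telescoping, up to a length where nothing of
  -- t remains.
  have h2 : ∀ n, toSym L.toDGSpace (lenGE 1 t) - toSym L.toDGSpace (lenGE (n + 1) t) ∈ R := by
    intro n
    induction n with
    | zero => simp
    | succ n ih =>
      have h3 := h1 n
      rw [lenEQ_eq, LinearMap.sub_apply, map_sub] at h3
      have h4 := add_mem ih h3
      rwa [sub_add_sub_cancel] at h4
  obtain ⟨n, hn⟩ := exists_lenGE_eq_zero t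
  have hn' : lenGE (n + 1) t = 0 := ker_lenGE_mono (Nat.le_succ n) hn
  have h3 := h2 n
  rw [hn', map_zero, sub_zero] at h3
  exact h3

/-- If the component of length n vanishes, the conditions make the next one invariant under all τ_i.
Its image in the symmetric algebra is zero since the kernel is graded by length, and invariants
inject into coinvariants. -/
lemma eq_zero_of_mem_envelope [CharZero K] {w : Ten K V} (hw : w ∈ envelope L)
    (h : toSym L.toDGSpace w = 0) : w = 0 := by
  rw [mem_envelope] at hw
  have key : ∀ n, lenEQ n w = 0 := by
    intro n
    induction n with
    | zero => rw [lenEQ_zero_apply, hw.1, zero_smul]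
    | succ n ih =>
      refine eq_zero_of_antisymm_of_toSym L.toDGSpace (n := n + 1)
        (LinearMap.congr_fun (lenEQ_comp_self (n + 1)) w) (fun i => ?_) (toSym_lenEQ _ h _)
      have h1 := LinearMap.congr_fun (antisymm_comp_lenEQ L.toDGSpace i (n + 1)) w
      have h2 := LinearMap.congr_fun (lenEQ_comp_cobrAt L i n) w
      have h3 := hw.2 i
      rw [cond, LinearMap.sub_apply, sub_eq_zero] at h3
      simp only [LinearMap.comp_apply] at h1 h2
      rw [h1, h3, h2, ih, map_zero]
  have := eq_zero_of_lenEQ (z := w ⊗ₜ[K] (1 : K)) fun k => by simp [key]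
  simpa using congrArg (TensorProduct.rid K (Ten K V)) this

end surjective

/-! ### Comparison of the coactions. -/

section comodule

lemma fst_toSym_swap_lmul {X : DGSpace K V} {i : ℤ} {x : V} (hx : x ∈ X.gr i)
    (z : Ten K V ⊗[K] Ten K V) :
    TensorProduct.map fst (toSym X).toLinearMap ((dg X).swap (dg X) (lmul _ x z)) =
      Sym.lact X x (TensorProduct.map fst (toSym X).toLinearMap ((dg X).swap (dg X) z)) := by
  have : TensorProduct.map fst (toSym X).toLinearMap ∘ₗ (dg X).swap (dg X) ∘ₗ lmul _ x =
      Sym.lact X x ∘ₗ TensorProduct.map fst (toSym X).toLinearMap ∘ₗ (dg X).swap (dg X) := by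
    refine (dg X).tensor_ext (dg X) fun j k a ha b hb => ?_
    have h1 : ι K x * a ∈ (dg X).gr (i + j) := ι_mul_mem hx ha
    simp only [LinearMap.comp_apply, lmul_tmul, (dg X).swap_tmul _ h1 hb,
      (dg X).swap_tmul _ ha hb, map_smul, TensorProduct.map_tmul, AlgHom.toLinearMap_apply,
      map_mul, toSym_ι, Sym.lact_tmul X hx ((fst_isHom X).map_mem k b hb), smul_smul, add_mul,
      sg_add]
    rw [mul_comm (sg K (i * k))]
  exact LinearMap.congr_fun this z

lemma fst_toSym_swap_ι {X : DGSpace K V} (x : V) (t : Ten K V) :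
    TensorProduct.map fst (toSym X).toLinearMap ((dg X).swap (dg X) (ι K x ⊗ₜ t)) =
      (Sym.ι X).lTensor V (X.swap X (x ⊗ₜ fst t)) := by
  have h1 := swap_natural (ι_isHom X) (IsHom.id (X := dg X)) (x ⊗ₜ[K] t)
  have h2 := swap_natural (IsHom.id (X := X)) (fst_isHom X) (x ⊗ₜ[K] t)
  rw [TensorProduct.map_tmul, LinearMap.id_apply] at h1 h2
  rw [h1, h2]
  generalize X.swap (dg X) (x ⊗ₜ[K] t) = z
  induction z using TensorProduct.induction_on with
  | zero => simp
  | tmul a b => simp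
  | add a b ha hb => simp only [map_add, ha, hb]

variable (L : DGLieCoalgebra K V)

/-- The difference of the coaction on the tensor coalgebra and the coaction on the symmetric
algebra. -/
def coactDefect : Ten K V →ₗ[K] V ⊗[K] Sym L.toDGSpace :=
  TensorProduct.map fst (toSym L.toDGSpace).toLinearMap ∘ₗ (coalgebra L.toDGSpace).toLie.cobr -
    Sym.coact L ∘ₗ (toSym L.toDGSpace).toLinearMap

lemma coactDefect_apply (t : Ten K V) : coactDefect L t =
    TensorProduct.map fst (toSym L.toDGSpace).toLinearMap (comul t) -
    TensorProduct.map fst (toSym L.toDGSpace).toLinearMap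
      ((dg L.toDGSpace).swap (dg L.toDGSpace) (comul t)) -
    Sym.coact L (toSym L.toDGSpace t) := by
  rw [← map_sub]
  rfl

lemma lTensor_toSym_uncons_word₂ (X : DGSpace K V) (u : V ⊗[K] V) (t : Ten K V) :
    (toSym X).toLinearMap.lTensor V (uncons (word₂ u t)) = Sym.ract X u (toSym X t) := by
  induction u using TensorProduct.induction_on with
  | zero => simp
  | tmul x y => simp [Sym.ract_tmul]
  | add a b ha hb => simp only [map_add, LinearMap.add_apply, ha, hb]

/-- The cocommutator contributes the first letter minus the last one moved to the front. Peeling off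
the first letter x leaves the same defect for the tail, with x multiplied back in, and the remaining
terms exchange x with its neighbour and take δx: this is the condition at place 0 with its first
letter split off. -/
lemma coactDefect_rec (t : Ten K V) : coactDefect L t =
    (toSym L.toDGSpace).toLinearMap.lTensor V (uncons (cond L 0 t)) +
      TensorProduct.lift (Sym.lact L.toDGSpace) ((coactDefect L).lTensor V (uncons t)) := by
  have h1 : coactDefect L 1 = 0 := by simp [coactDefect_apply, Sym.coact_one]
  have hl : ∀ x t, TensorProduct.map fst (toSym L.toDGSpace).toLinearMap (comul (ι K x * t)) =
      x ⊗ₜ toSym L.toDGSpace (plus t) := by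
    intro x t
    rw [← LinearMap.lTensor_comp_rTensor, LinearMap.comp_apply, rTensor_fst_comul_mul]
    rfl
  have : coactDefect L = (toSym L.toDGSpace).toLinearMap.lTensor V ∘ₗ uncons ∘ₗ cond L 0 +
      TensorProduct.lift (Sym.lact L.toDGSpace) ∘ₗ (coactDefect L).lTensor V ∘ₗ uncons := by
    refine cons_ext₂ L.toDGSpace (by simp [h1]) (fun x => ?_) fun i j x hx y hy t => ?_
    · have h2 := cobr₀_mul L x 1
      have h3 := Sym.coact_mul L x 1
      rw [mul_one] at h2 h3
      simp only [LinearMap.add_apply, LinearMap.comp_apply, uncons_ι, LinearMap.lTensor_tmul, h1,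
        TensorProduct.lift.tmul, map_zero, cond_zero, LinearMap.sub_apply, antisymm₀_ι, h2, zero_sub,
        map_neg, lTensor_toSym_uncons_word₂, map_one, add_zero, coactDefect_apply, comul_ι, sub_zero,
        toSym_ι, h3, Sym.coact_one, zero_add]
    · have h2 : Sym.coact L (toSym L.toDGSpace (ι K x * (ι K y * t))) =
          Sym.lact L.toDGSpace x (Sym.coact L (toSym L.toDGSpace (ι K y * t))) +
            Sym.ract L.toDGSpace (L.cobr x) (toSym L.toDGSpace (ι K y * t)) := by
        rw [map_mul (toSym L.toDGSpace) (ι K x), toSym_ι, Sym.coact_mul]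
      simp only [LinearMap.add_apply, LinearMap.comp_apply, uncons_mul, LinearMap.lTensor_tmul,
        TensorProduct.lift.tmul, cond_zero, LinearMap.sub_apply, antisymm₀_mul _ hx hy, map_sub,
        map_smul, cobr₀_mul, lTensor_toSym_uncons_word₂]
      rw [coactDefect_apply, coactDefect_apply, hl, hl, h2, map_sub, map_sub,
        Sym.lact_tmul _ hx hy, comul_mul, map_add, map_add, fst_toSym_swap_lmul hx,
        fst_toSym_swap_ι, plus_mul, fst_mul, TensorProduct.tmul_smul, map_smul,
        L.swap_tmul _ hx hy]
      simp only [map_smul, LinearMap.lTensor_tmul, AlgHom.toLinearMap_apply, plus_eq t, map_sub,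
        map_mul, toSym_ι, mul_sub, map_one, mul_smul_comm, mul_one, TensorProduct.tmul_sub,
        TensorProduct.tmul_smul, smul_sub]
      rw [smul_comm (aug t)]
      abel
  exact LinearMap.congr_fun this t

/-- The condition at place i + 1 is the condition at place i behind the first letter, so the tails
of t again satisfy all conditions. The recursion loses its source term and the length drops. -/
lemma coactDefect_eq_zero {t : Ten K V} (ht : ∀ i, cond L i t = 0) : coactDefect L t = 0 := by
  have key : ∀ n, ∀ t : Ten K V, (∀ i, cond L i t = 0) → lenGE n t = 0 → coactDefect L t = 0 := by
    intro n
    induction n with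
    | zero =>
      intro t _ h
      have : t = 0 := h
      rw [this, map_zero]
    | succ n ih =>
      intro t ht hn
      let S : Submodule K (Ten K V) := (⨅ i, LinearMap.ker (cond L i)) ⊓ LinearMap.ker (lenGE n)
      have hS : ∀ s, s ∈ S ↔ (∀ i, cond L i s = 0) ∧ lenGE n s = 0 := by simp [S]
      have hmem : uncons t ∈ LinearMap.range (S.subtype.lTensor V) := by
        refine mem_range_lTensor_of_slices fun φ => (hS _).2 ⟨fun i => ?_, ?_⟩
        · rw [← rslice_comm_lTensor, ← uncons_up, ← cond_succ, ht]; simp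
        · rw [← rslice_comm_lTensor, ← lTensor_lenGE_uncons, hn]; simp
      rw [coactDefect_rec, ht, lTensor_congr_of_mem_range hmem (g := 0)
        fun s hs => ih s ((hS s).1 hs).1 ((hS s).1 hs).2]
      simp
  obtain ⟨n, hn⟩ := exists_lenGE_eq_zero t
  exact key n t ht hn

end comodule

/-! ### The isomorphism for the constructed envelope. -/

section isomorphism

variable (L : DGLieCoalgebra K V)

lemma isUniversalEnveloping : IsUniversalEnveloping L (enveloping L) (envelopingProj L) where
  conilpotent := enveloping_conilpotent L
  isHom := envelopingProj_isHom L
  existsUnique _ _ _ _ hB _ hf := enveloping_isUniversal L hB hf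

/-- The map from the universal enveloping coalgebra to the symmetric algebra. -/
def envelopeToPlus : envelope L →ₗ[K] Sym.Plus L.toDGSpace :=
  ((toSym L.toDGSpace).toLinearMap ∘ₗ (envelope L).subtype).codRestrict _ fun w => by
    change Sym.aug _ (toSym L.toDGSpace (w : Ten K V)) = 0
    rw [aug_toSym, (mem_envelope.1 w.2).1]

lemma envelopeToPlus_coe (w : envelope L) :
    (envelopeToPlus L w : Sym L.toDGSpace) = toSym L.toDGSpace (w : Ten K V) := rfl

lemma envelopeToPlus_bijective [CharZero K] (hL : Conilpotent L.cobr) :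
    Function.Bijective (envelopeToPlus L) := by
  constructor
  · rw [← LinearMap.ker_eq_bot, LinearMap.ker_eq_bot']
    exact fun w hw => Subtype.ext (eq_zero_of_mem_envelope w.2 (congrArg Subtype.val hw))
  · rintro ⟨a, ha⟩
    obtain ⟨t, rfl⟩ := toSym_surjective L.toDGSpace a
    have h : aug t = 0 := by rw [← aug_toSym L.toDGSpace]; exact ha
    obtain ⟨w, hw, hwt⟩ := exists_mem_envelope hL t
    rw [plus_of_aug h] at hwt
    exact ⟨⟨w, hw⟩, Subtype.ext hwt⟩

/-- The inclusion of the envelope is a morphism of coalgebras, so its cocommutator is the one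
computed on words, and the claim becomes the vanishing of `coactDefect` on w. -/
lemma symc_coact_envelopeToPlus (w : envelope L) :
    L.symc.coact (envelopeToPlus L w) =
      (envelopeToPlus L).lTensor V ((isUniversalEnveloping L).comodule.coact w) := by
  obtain ⟨P, hP⟩ := exists_retract (Sym.Plus L.toDGSpace)
  have hinj : Function.Injective ((Sym.Plus L.toDGSpace).subtype.lTensor V) := by
    refine Function.LeftInverse.injective (g := P.lTensor V) fun z => ?_
    rw [← LinearMap.comp_apply, ← LinearMap.lTensor_comp,
      show P ∘ₗ (Sym.Plus L.toDGSpace).subtype = LinearMap.id from LinearMap.ext hP,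
      LinearMap.lTensor_id, LinearMap.id_apply]
  apply hinj
  have h1 := coactDefect_eq_zero L (mem_envelope.1 w.2).2
  rw [coactDefect, LinearMap.sub_apply, sub_eq_zero] at h1
  rw [L.symc_coact, envelopeToPlus_coe]
  refine h1.symm.trans ?_
  have hi := enveloping_incl_isHom L
  have h2 : (coalgebra L.toDGSpace).toLie.cobr (w : Ten K V) =
      TensorProduct.map (envelope L).subtype (envelope L).subtype ((enveloping L).toLie.cobr w) := by
    change comul (w : Ten K V) - _ = TensorProduct.map _ _ ((enveloping L).comul w -
      (enveloping L).swap (enveloping L).toDGSpace ((enveloping L).comul w))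
    rw [map_sub, ← swap_natural hi.toIsHom hi.toIsHom, ← hi.map_comul]
    rfl
  have h3 : ∀ z : envelope L ⊗[K] envelope L, TensorProduct.map fst (toSym L.toDGSpace).toLinearMap
      (TensorProduct.map (envelope L).subtype (envelope L).subtype z) =
      (Sym.Plus L.toDGSpace).subtype.lTensor V ((envelopeToPlus L).lTensor V
        ((envelopingProj L).rTensor _ z)) := by
    intro z
    induction z using TensorProduct.induction_on with
    | zero => simp
    | tmul a b => rfl
    | add a b ha hb => simp only [map_add, ha, hb]
  rw [LinearMap.comp_apply, h2, h3]
  rfl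

/-- The dual Poincaré–Birkhoff–Witt theorem. -/
def envelopeIso [CharZero K] (hL : Conilpotent L.cobr) :
    (isUniversalEnveloping L).comodule.Iso L.symc where
  equiv := LinearEquiv.ofBijective (envelopeToPlus L) (envelopeToPlus_bijective L hL)
  isHom := by
    have hi : L.symc.toDGSpace.IsHom (Sym.toDGSpace L.toDGSpace) (Sym.Plus L.toDGSpace).subtype :=
      sub_incl_isHom _ _ _ (Sym.toPlus_coe _) (Sym.toPlusAux_isHom _)
    exact hi.of_comp_injective (Submodule.injective_subtype _)
      ((toSym_isHom L.toDGSpace).comp (enveloping_incl_isHom L).toIsHom)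
  coact_equiv := symc_coact_envelopeToPlus L

end isomorphism

end Ten

/-! ### Uniqueness of universal enveloping coalgebras. -/

section uniqueness

variable {K : Type u} [Field K] {V : Type v} [AddCommGroup V] [Module K V]
variable {L : DGLieCoalgebra K V} {C D E : Type w} [AddCommGroup C] [Module K C]
variable [AddCommGroup D] [Module K D] [AddCommGroup E] [Module K E]

lemma DGCoalgebra.IsHom.comp {A : DGCoalgebra K C} {B : DGCoalgebra K D} {G : DGCoalgebra K E}
    {g : D →ₗ[K] E} {f : C →ₗ[K] D} (hg : B.IsHom G g) (hf : A.IsHom B f) : A.IsHom G (g ∘ₗ f) where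
  toIsHom := hg.toIsHom.comp hf.toIsHom
  map_comul x := by
    rw [LinearMap.comp_apply, hg.map_comul, hf.map_comul, TensorProduct.map_comp]; rfl

lemma DGCoalgebra.IsHom.id {A : DGCoalgebra K C} : A.IsHom A LinearMap.id :=
  ⟨.id, fun x => by simp⟩

lemma DGCoalgebra.IsHom.map_cobr {A : DGCoalgebra K C} {B : DGCoalgebra K D} {f : C →ₗ[K] D}
    (hf : A.IsHom B f) (x : C) : B.toLie.cobr (f x) = TensorProduct.map f f (A.toLie.cobr x) := by
  change B.comul (f x) - B.swap B.toDGSpace (B.comul (f x)) =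
    TensorProduct.map f f (A.comul x - A.swap A.toDGSpace (A.comul x))
  rw [map_sub, ← swap_natural hf.toIsHom hf.toIsHom, ← hf.map_comul]

lemma IsUniversalEnveloping.comp_eq_id {A : DGCoalgebra K C} {B : DGCoalgebra K D} {p : C →ₗ[K] V}
    {q : D →ₗ[K] V} (hA : IsUniversalEnveloping L A p) {f : C →ₗ[K] D} (hf : A.IsHom B f)
    (hfp : q ∘ₗ f = p) {g : D →ₗ[K] C} (hg : B.IsHom A g) (hgp : p ∘ₗ g = q) :
    g ∘ₗ f = LinearMap.id :=
  (hA.existsUnique C A hA.conilpotent p hA.isHom).unique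
    ⟨hg.comp hf, by rw [← LinearMap.comp_assoc, hgp, hfp]⟩ ⟨.id, LinearMap.comp_id p⟩

/-- Universal enveloping coalgebras are isomorphic as comodules. -/
lemma IsUniversalEnveloping.nonempty_iso {A : DGCoalgebra K C} {B : DGCoalgebra K D}
    {p : C →ₗ[K] V} {q : D →ₗ[K] V} (hA : IsUniversalEnveloping L A p)
    (hB : IsUniversalEnveloping L B q) : Nonempty (hA.comodule.Iso hB.comodule) := by
  obtain ⟨f, ⟨hf, hfp⟩, -⟩ := hB.existsUnique C A hA.conilpotent p hA.isHom
  obtain ⟨g, ⟨hg, hgp⟩, -⟩ := hA.existsUnique D B hB.conilpotent q hB.isHom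
  refine ⟨⟨LinearEquiv.ofLinearMap f g (hB.comp_eq_id hg hgp hf hfp) (hA.comp_eq_id hf hfp hg hgp),
    hf.toIsHom, fun m => ?_⟩⟩
  -- The coactions are built from the cocommutator and the projection to L, and f respects both.
  change q.rTensor D (B.toLie.cobr (f m)) = f.lTensor V (p.rTensor C (A.toLie.cobr m))
  rw [hf.map_cobr, ← LinearMap.comp_apply, LinearMap.rTensor_comp_map, hfp,
    ← LinearMap.lTensor_comp_rTensor]
  rfl

/-- The composite of isomorphisms of comodules. -/
def DGLieComodule.Iso.trans {M N P : Type*} [AddCommGroup M] [Module K M] [AddCommGroup N]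
    [Module K N] [AddCommGroup P] [Module K P] {R : DGLieComodule L M} {S : DGLieComodule L N}
    {T : DGLieComodule L P} (e : R.Iso S) (f : S.Iso T) : R.Iso T where
  equiv := e.equiv.trans f.equiv
  isHom := f.isHom.comp e.isHom
  coact_equiv m := by
    rw [LinearEquiv.trans_apply, f.coact_equiv, e.coact_equiv, ← LinearMap.comp_apply,
      ← LinearMap.lTensor_comp]
    rfl

end uniqueness

end DGCo

end

theorem proposition2p1 {K : Type u} [Field K] [CharZero K] {V : Type v} [AddCommGroup V]
    [Module K V] (L : DGCo.DGLieCoalgebra K V) (hL : DGCo.Conilpotent L.cobr) :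
    (∃ (C : Type (max u v)) (_ : AddCommGroup C) (_ : Module K C) (U : DGCo.DGCoalgebra K C)
        (p : C →ₗ[K] V), DGCo.IsUniversalEnveloping L U p) ∧
      ∀ (C : Type (max u v)) [AddCommGroup C] [Module K C] (U : DGCo.DGCoalgebra K C)
        (p : C →ₗ[K] V) (h : DGCo.IsUniversalEnveloping L U p),
        Nonempty (h.comodule.Iso L.symc) := by
  refine ⟨⟨_, _, _, _, _, DGCo.Ten.isUniversalEnveloping L⟩, fun C _ _ U p h => ?_⟩
  obtain ⟨e⟩ := h.nonempty_iso (DGCo.Ten.isUniversalEnveloping L)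
  exact ⟨e.trans (DGCo.Ten.envelopeIso L hL)⟩
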